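/- Let $n\ge 2$, let $\Omega\subset\mathbb R^n$ be an open set with $0\in\Omega$ whose closure is contained in the open unit ball $\{|x|<1\}$, let $\gamma>0$, and consider the divergence form equation $$\sum_{i,j=1}^n\partial_j\bigl(a_{ij}(x)\,\partial_i u\bigr)=0\quad\text{in }\Omega,\qquad a_{ij}(x)=\delta_{ij}+g(|x|)\,\frac{x_i x_j}{|x|^2},\qquad g(r)=|\log r|^{-\gamma}.\tag{1}$$ A weak solution of (1) is a function $u\in H^{1,2}_{\mathrm{loc}}(\Omega)$ with $\int_\Omega\sum_{i,j}a_{ij}\,\partial_i u\,\partial_j\varphi\,dx=0$ for all $\varphi\in C_c^\infty(\Omega)$. (i) If $0<\gamma\le 1$, then there exists a weak solution $u$ of (1), continuous on $\Omega$, that is not Lipschitz continuous at $0$: there are no $c,\rho>0$ with $|u(x)-u(0)|\le c|x|$ for all $|x|<\rho$. Moreover, in this case the coefficients do not have Dini mean oscillation in $\Omega$: it is not true that for all $i,j$ the function $a=a_{ij}$ satisfies $$\int_0^{1/2}\frac{\omega_a(r)}{r}\,dr<\infty,\qquad\text{where}\quad \omega_a(r)=\sup_{B_r(x)\subset\Omega}\frac1{|B_r(x)|}\int_{B_r(x)}|a(y)-\tilde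 a_{x,r}|\,dy,\quad \tilde a_{x,r}=\frac1{|B_r(x)|}\int_{B_r(x)}a(y)\,dy$$ (the supremum being over all balls of radius $r$ contained in $\Omega$). (ii) If $\gamma>1$, then every weak solution of (1) is Lipschitz continuous, i.e. it agrees almost everywhere in $\Omega$ with a function that is locally Lipschitz continuous on $\Omega$. -/

import Mathlib

open MeasureTheory Metric
open scoped ENNReal

noncomputable section

/-- Test functions on `Ω`: smooth real functions with compact support contained in `Ω`. -/
def IsTestFunction {n : ℕ} (Ω : Set (EuclideanSpace ℝ (Fin n)))
    (φ : EuclideanSpace ℝ (Fin n) → ℝ) : Prop :=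
  ContDiff ℝ (⊤ : ℕ∞) φ ∧ HasCompactSupport φ ∧ tsupport φ ⊆ Ω

/-- The partial derivative `∂_i φ` at `x`. -/
def partialDeriv {n : ℕ} (i : Fin n) (φ : EuclideanSpace ℝ (Fin n) → ℝ)
    (x : EuclideanSpace ℝ (Fin n)) : ℝ :=
  fderiv ℝ φ x (EuclideanSpace.single i 1)

/-- `f` is locally square integrable on `Ω`: `f ∈ L²(K)` for every compact `K ⊆ Ω`. -/
def LocallySquareIntegrableOn {n : ℕ} {F : Type*} [NormedAddCommGroup F]
    (Ω : Set (EuclideanSpace ℝ (Fin n))) (f : EuclideanSpace ℝ (Fin n) → F) : Prop :=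
  ∀ K ⊆ Ω, IsCompact K → MemLp f 2 (volume.restrict K)

/-- `u ∈ H^{1,2}_loc(Ω)` with weak gradient `G`: both are locally square integrable on `Ω`, and
`∫_Ω u ∂_i φ = - ∫_Ω G_i φ` for all test functions `φ` and all `i`. -/
def HasWeakGradientOn {n : ℕ} (Ω : Set (EuclideanSpace ℝ (Fin n)))
    (u : EuclideanSpace ℝ (Fin n) → ℝ)
    (G : EuclideanSpace ℝ (Fin n) → EuclideanSpace ℝ (Fin n)) : Prop :=
  LocallySquareIntegrableOn Ω u ∧ LocallySquareIntegrableOn Ω G ∧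
    ∀ φ, IsTestFunction Ω φ → ∀ i,
      ∫ x in Ω, u x * partialDeriv i φ x = - ∫ x in Ω, G x i * φ x

/-- `u ∈ H^{1,2}_loc(Ω)` is a weak solution of `∂_j (a_ij ∂_i u) = 0` in `Ω`:
`∫_Ω ∑_{i,j} a_ij (∂_i u) (∂_j φ) = 0` for all test functions `φ`. -/
def IsWeakSolution {n : ℕ} (Ω : Set (EuclideanSpace ℝ (Fin n)))
    (a : Fin n → Fin n → EuclideanSpace ℝ (Fin n) → ℝ)
    (u : EuclideanSpace ℝ (Fin n) → ℝ) : Prop :=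
  ∃ G, HasWeakGradientOn Ω u G ∧
    ∀ φ, IsTestFunction Ω φ →
      ∫ x in Ω, ∑ i, ∑ j, a i j x * G x i * partialDeriv j φ x = 0

/-- Gilbarg-Serrin coefficients `a_ij(x) = δ_ij + g(r) θ_i θ_j`, with `r = |x|`, `θ = x / r`. -/
def gilbargSerrinCoeff {n : ℕ} (g : ℝ → ℝ) (i j : Fin n) (x : EuclideanSpace ℝ (Fin n)) : ℝ :=
  (if i = j then 1 else 0) + g ‖x‖ * (x i / ‖x‖) * (x j / ‖x‖)

/-- The function `g(r) = |log r|^{-γ}`. -/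
def logPow (γ r : ℝ) : ℝ := |Real.log r| ^ (-γ)

/-- `u` is Lipschitz continuous at the origin: `|u(x) - u(0)| ≤ c |x|` for all small `x`. -/
def IsLipschitzAtZero {n : ℕ} (u : EuclideanSpace ℝ (Fin n) → ℝ) : Prop :=
  ∃ c ρ : ℝ, 0 < ρ ∧ ∀ x ∈ ball (0 : EuclideanSpace ℝ (Fin n)) ρ, |u x - u 0| ≤ c * ‖x‖

/-- The mean oscillation `ω_a(r)`: the supremum, over all balls `B_r(x) ⊆ Ω` of radius `r`, of the
mean value over `B_r(x)` of `|a - ã|`, where `ã` is the mean value of `a` over `B_r(x)`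
(for `a` integrable on `Ω`). -/
def meanOscillation {n : ℕ} (Ω : Set (EuclideanSpace ℝ (Fin n)))
    (a : EuclideanSpace ℝ (Fin n) → ℝ) (r : ℝ) : ℝ≥0∞ :=
  ⨆ (x : EuclideanSpace ℝ (Fin n)) (_ : ball x r ⊆ Ω),
    ENNReal.ofReal (⨍ y in ball x r, |a y - ⨍ z in ball x r, a z|)

/-- A function `a`, integrable on `Ω`, has Dini mean oscillation if `∫_0^{1/2} ω_a(r)/r dr < ∞`. -/
def HasDiniMeanOscillation {n : ℕ} (Ω : Set (EuclideanSpace ℝ (Fin n)))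
    (a : EuclideanSpace ℝ (Fin n) → ℝ) : Prop :=
  ∫⁻ r in Set.Ioo (0 : ℝ) (1 / 2), meanOscillation Ω a r / ENNReal.ofReal r < ⊤

end

/-! Put `t = -log|x|` and `θ = x/|x|`, and look for `u = x₁ v(t)`. Then `∇u = v e₁ - v' θ₁ θ`, and
the flux is `v e₁ + d θ₁ θ` with `d = g v - (1+g) v'`. With `h = g/(1+g)` and `N = n`, the
definition of `d` and the vanishing of the divergence become the linear system `v' = h (v+d) - d`,
`d' = N d - h (v+d)`. The sum `v+d` has derivative `(N-1) d`, so `v+d = exp Y`, `Y' = y`, reduces it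
to the Riccati equation `y' = N y - (N-1) h - y²`. Generic solutions have a mode growing like `exp
(N t)`. The slow one solves the integral equation over `(t,∞)` and satisfies `exp(-N) h(t+1) ≤ y(t)
≤ h(t)`, so `v` behaves like `exp ∫ h`. If `γ ≤ 1` then `h` is at least a multiple of `1/t`, the
integral diverges, and `u/x₁` is unbounded at the origin. Since `h ≤ H < 1`, the growth is at most
`|x|^(-H)`: `u` stays continuous and the singularity is too weak to be seen by test functions
(`exists_slow_solution`, `exists_weakSolution_of_profile`).

For the oscillation claim, an off-diagonal coefficient is odd under a reflection, so its mean over a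
ball centred at 0 vanishes. Its mean absolute value there is at least a multiple of `logPow γ
(r/6)`, which is not integrable against `dr/r` when `γ ≤ 1`.

For `γ > 1` the modulus of continuity `ω` of the coefficients is summable over dyadic scales. Freeze
the coefficients at `y` and let `B` be the inverse matrix. Weighted averages of the weak gradient
`G` over the ellipsoids `⟨z, Bz⟩ ≤ 1`, `z = 2^k (x-y)`, telescope: the difference of two consecutive
averages is the equation tested with an explicit compactly supported function, up to an error
`ω(2^-k)` times the mean of `|G|` (`exists_telescoping_profile`, `abs_kernelAverage_sub_le`). This
uses only that `G` is curl free; no regularity theory for constant coefficients enters. At Lebesgue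
points, `|G(y)|` is therefore at most a constant plus a potential of `|G|` with summable weights
(`exists_ae_enorm_gradient_le`). An iteration over expanding balls absorbs the potential and bounds
`G` locally (`exists_ae_le_of_le_potential`); mollification turns the bound into a Lipschitz
representative. -/

open Set Filter Topology Convolution

/-! ### The Riccati equation and the slow solution of the radial system -/

/-- The weighted tail average `∫_0^∞ e^{-Nt} ((N-1) h(τ+t) + y(τ+t)²) dt`. -/
noncomputable def riccatiMap (N : ℝ) (h y : ℝ → ℝ) (τ : ℝ) : ℝ :=
  ∫ t in Ioi (0 : ℝ), Real.exp (-N * t) * ((N - 1) * h (τ + t) + y (τ + t) ^ 2)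

theorem integrableOn_exp_mul_of_bdd {N C : ℝ} (hN : 0 < N) {f : ℝ → ℝ} (hf : Measurable f)
    (hC : ∀ t, |f t| ≤ C) (a : ℝ) : IntegrableOn (fun t => Real.exp (-N * t) * f t) (Ioi a) := by
  have h1 : IntegrableOn (fun t => Real.exp (-N * t)) (Ioi a) :=
    integrableOn_exp_mul_Ioi (by linarith) a
  exact Integrable.mul_bdd (c := C) h1 hf.aestronglyMeasurable (ae_of_all _ hC)

theorem integral_exp_neg_mul_Ioi_zero {N : ℝ} (hN : 0 < N) :
    ∫ t in Ioi (0 : ℝ), Real.exp (-N * t) = 1 / N := by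
  rw [integral_exp_mul_Ioi (by linarith)]
  simp [neg_div_neg_eq]

theorem measurable_riccati_integrand {N : ℝ} {h y : ℝ → ℝ} (hh : Antitone h) (hy : Antitone y)
    (τ : ℝ) : Measurable fun t => (N - 1) * h (τ + t) + y (τ + t) ^ 2 := by
  have h1 := hh.measurable
  have h2 := hy.measurable
  fun_prop

theorem riccati_integrand_le {N : ℝ} (hN : 2 ≤ N) {h y : ℝ → ℝ}
    (h0 : ∀ t, 0 ≤ h t) (h1 : ∀ t, h t ≤ 1)
    (y0 : ∀ t, 0 ≤ y t) (y1 : ∀ t, y t ≤ 1) (t : ℝ) :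
    |(N - 1) * h t + y t ^ 2| ≤ N := by
  have := h0 t
  have := y0 t
  have := h1 t
  have := y1 t
  rw [abs_of_nonneg (by nlinarith)]
  nlinarith

theorem integrableOn_riccati {N : ℝ} (hN : 2 ≤ N) {h y : ℝ → ℝ} (hh : Antitone h)
    (hy : Antitone y) (h0 : ∀ t, 0 ≤ h t) (h1 : ∀ t, h t ≤ 1)
    (y0 : ∀ t, 0 ≤ y t) (y1 : ∀ t, y t ≤ 1) (τ a : ℝ) :
    IntegrableOn (fun t => Real.exp (-N * t) * ((N - 1) * h (τ + t) + y (τ + t) ^ 2)) (Ioi a) :=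
  integrableOn_exp_mul_of_bdd (by linarith) (measurable_riccati_integrand hh hy τ)
    (fun t => riccati_integrand_le hN h0 h1 y0 y1 (τ + t)) a

theorem riccatiMap_nonneg {N : ℝ} (hN : 2 ≤ N) {h y : ℝ → ℝ} (h0 : ∀ t, 0 ≤ h t) (τ : ℝ) :
    0 ≤ riccatiMap N h y τ := by
  refine integral_nonneg fun t => ?_
  have := h0 (τ + t)
  have : 0 ≤ N - 1 := by linarith
  positivity

/-- One inequality serves two purposes: with `y = z` it keeps the image antitone in `τ`, and with `τ
= τ'` it makes the map monotone in `y`. Both are needed for a lattice fixed point. -/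
theorem riccatiMap_mono {N : ℝ} (hN : 2 ≤ N) {h y z : ℝ → ℝ} (hh : Antitone h)
    (hy : Antitone y) (hz : Antitone z) (h0 : ∀ t, 0 ≤ h t) (h1 : ∀ t, h t ≤ 1)
    (y0 : ∀ t, 0 ≤ y t) (z1 : ∀ t, z t ≤ 1) (hyz : ∀ t, y t ≤ z t) {τ τ' : ℝ} (hτ : τ ≤ τ') :
    riccatiMap N h y τ' ≤ riccatiMap N h z τ := by
  refine integral_mono
    (integrableOn_riccati hN hh hy h0 h1 y0 (fun t => (hyz t).trans (z1 t)) _ _)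
    (integrableOn_riccati hN hh hz h0 h1 (fun t => (y0 t).trans (hyz t)) z1 _ _) fun t => ?_
  have e1 := hh (add_le_add_left hτ t)
  have e2 := (hyz (τ' + t)).trans (hz (add_le_add_left hτ t))
  have : 0 ≤ N - 1 := by linarith
  have := y0 (τ' + t)
  dsimp only
  gcongr

/-- The function `h` is a supersolution: `y ≤ h ≤ 1` gives `y² ≤ h`, hence `(N-1) h + y² ≤ N h`, and
the weight `exp (-N t)` has mass `1/N`. -/
theorem riccatiMap_le {N : ℝ} (hN : 2 ≤ N) {h y : ℝ → ℝ} (hh : Antitone h)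
    (hy : Antitone y) (h0 : ∀ t, 0 ≤ h t) (h1 : ∀ t, h t ≤ 1)
    (y0 : ∀ t, 0 ≤ y t) (hyh : ∀ t, y t ≤ h t) (τ : ℝ) :
    riccatiMap N h y τ ≤ h τ := by
  have key : riccatiMap N h y τ ≤ ∫ t in Ioi (0 : ℝ), Real.exp (-N * t) * (N * h τ) := by
    refine setIntegral_mono_on
      (integrableOn_riccati hN hh hy h0 h1 y0 (fun t => (hyh t).trans (h1 t)) _ _)
      (integrableOn_exp_mul_of_bdd (C := |N * h τ|) (by linarith) measurable_const
        (fun t => le_rfl) _) measurableSet_Ioi fun t ht => ?_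
    have ht : 0 < t := ht
    have e1 : h (τ + t) ≤ h τ := hh (by linarith)
    have e2 := hyh (τ + t)
    have e3 := y0 (τ + t)
    have e4 := h1 (τ + t)
    gcongr
    nlinarith
  refine key.trans (le_of_eq ?_)
  rw [integral_mul_const, integral_exp_neg_mul_Ioi_zero (by linarith)]
  field_simp

/-- The Riccati map has an antitone fixed point between `0` and `h`. -/
theorem exists_riccati_fixedPoint {N : ℝ} (hN : 2 ≤ N) {h : ℝ → ℝ} (hh : Antitone h)
    (h0 : ∀ t, 0 ≤ h t) (h1 : ∀ t, h t ≤ 1) :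
    ∃ y : ℝ → ℝ, Antitone y ∧ (∀ t, 0 ≤ y t) ∧ (∀ t, y t ≤ h t) ∧
      ∀ τ, y τ = riccatiMap N h y τ := by
  -- Antitone functions with values in `[0,1]`, encoded as monotone maps from the dual order, form a
  -- complete lattice, so Knaster–Tarski applies without any contraction estimate.
  let V := ℝᵒᵈ →o Icc (0 : ℝ) 1
  let c : V → ℝ → ℝ := fun y t => (y (OrderDual.toDual t) : ℝ)
  have c_anti : ∀ y : V, Antitone (c y) := fun y a b hab => y.monotone (a := OrderDual.toDual b)
    (b := OrderDual.toDual a) hab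
  have c0 : ∀ (y : V) t, 0 ≤ c y t := fun y t => (y _).2.1
  have c1 : ∀ (y : V) t, c y t ≤ 1 := fun y t => (y _).2.2
  let hV : V := ⟨fun t => ⟨h (OrderDual.ofDual t), h0 _, h1 _⟩, fun a b hab => hh hab⟩
  -- Values stay below 1 by comparison with `h = 1`, `y = 1`, for which `riccatiMap_le` gives the
  -- bound 1.
  have le1 : ∀ (y : V) τ, riccatiMap N h (c y) τ ≤ 1 := fun y τ =>
    (riccatiMap_mono hN (antitone_const (c := (1 : ℝ))) (c_anti y)
      (antitone_const (c := (1 : ℝ))) (fun _ => zero_le_one) (fun _ => le_rfl) (c0 y)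
      (fun _ => le_rfl) (c1 y) le_rfl).trans' (integral_mono
        (integrableOn_riccati hN hh (c_anti y) h0 h1 (c0 y) (c1 y) _ _)
        (integrableOn_riccati hN antitone_const (c_anti y) (fun _ => zero_le_one)
          (fun _ => le_rfl) (c0 y) (c1 y) _ _) (fun t => by
            have : 0 ≤ N - 1 := by linarith
            have := h1 (τ + t)
            dsimp only
            gcongr)) |>.trans
      (riccatiMap_le hN (h := fun _ => (1 : ℝ)) antitone_const antitone_const
        (fun _ => zero_le_one) (fun _ => le_rfl) (fun _ => zero_le_one) (fun _ => le_rfl) τ)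
  let T : V →o V :=
    { toFun := fun y =>
        ⟨fun τ => ⟨riccatiMap N h (c y) (OrderDual.ofDual τ), riccatiMap_nonneg hN h0 _,
          le1 y _⟩, fun a b hab => riccatiMap_mono hN hh (c_anti y) (c_anti y) h0 h1 (c0 y)
            (c1 y) (fun _ => le_rfl) hab⟩
      monotone' := fun y z hyz τ => riccatiMap_mono hN hh (c_anti y) (c_anti z) h0 h1 (c0 y)
            (c1 z) (fun t => hyz (OrderDual.toDual t)) le_rfl }
  refine ⟨c T.lfp, c_anti _, c0 _, fun t => ?_, fun τ => ?_⟩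
  -- The least fixed point lies below every supersolution, in particular below `h`.
  · have : T.lfp ≤ hV := by
      refine OrderHom.lfp_le _ fun τ => ?_
      exact riccatiMap_le hN hh (c_anti hV) h0 h1 (c0 hV) (fun t => le_rfl) _
    exact this (OrderDual.toDual t)
  · have : T T.lfp = T.lfp := OrderHom.map_lfp (α := V) T
    conv_lhs => rw [← this]
    rfl

theorem riccatiMap_eq {N : ℝ} {h y : ℝ → ℝ} (τ : ℝ) :
    riccatiMap N h y τ =
      Real.exp (N * τ) * ∫ s in Ioi τ, Real.exp (-N * s) * ((N - 1) * h s + y s ^ 2) := by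
  have e : ∫ s in Ioi τ, Real.exp (-N * s) * ((N - 1) * h s + y s ^ 2) =
      ∫ t in Ioi (0 : ℝ), Real.exp (-N * (τ + t)) * ((N - 1) * h (τ + t) + y (τ + t) ^ 2) := by
    have := (measurePreserving_add_left (volume : Measure ℝ) τ).setIntegral_preimage_emb
      (measurableEmbedding_addLeft τ)
      (fun s => Real.exp (-N * s) * ((N - 1) * h s + y s ^ 2)) (Ioi τ)
    rw [← this]
    simp
  rw [e, ← integral_const_mul, riccatiMap]
  congr 1
  ext t
  rw [← mul_assoc, ← Real.exp_add]
  ring_nf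

/-- Solution of the Riccati equation `y' = N y - (N-1) h - y²` with `0 ≤ y ≤ h`, bounded below by
a multiple of the shifted `h`. -/
theorem exists_riccati_solution {N : ℝ} (hN : 2 ≤ N) {h : ℝ → ℝ} (hc : Continuous h)
    (hh : Antitone h) (h0 : ∀ t, 0 ≤ h t) (h1 : ∀ t, h t ≤ 1) :
    ∃ y : ℝ → ℝ, (∀ t, 0 ≤ y t) ∧ (∀ t, y t ≤ h t) ∧
      (∀ t, HasDerivAt y (N * y t - (N - 1) * h t - y t ^ 2) t) ∧
      ∀ t, Real.exp (-N) * h (t + 1) ≤ y t := by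
  obtain ⟨y, ya, y0, yh, yT⟩ := exists_riccati_fixedPoint hN hh h0 h1
  have y1 : ∀ t, y t ≤ 1 := fun t => (yh t).trans (h1 t)
  let k : ℝ → ℝ := fun s => Real.exp (-N * s) * ((N - 1) * h s + y s ^ 2)
  have hk : ∀ a, IntegrableOn k (Ioi a) := fun a => by
    simpa only [zero_add] using integrableOn_riccati hN hh ya h0 h1 y0 y1 0 a
  have hkint : ∀ a b, IntervalIntegrable k volume a b := fun a b =>
    ⟨(hk a).mono_set fun x hx => hx.1, (hk b).mono_set fun x hx => hx.1⟩
  have hJ : ∀ τ, ∫ s in Ioi τ, k s = (∫ s in Ioi 0, k s) - ∫ s in (0 : ℝ)..τ, k s := fun τ => by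
    rw [eq_sub_iff_add_eq, add_comm]
    exact intervalIntegral.integral_interval_add_Ioi (hk 0) (hk τ)
  -- A bootstrap: so far `y` is only antitone. Written as `exp (N τ)` times a constant minus a
  -- primitive, it is continuous; then the integrand `k` is continuous and the fundamental theorem
  -- of calculus gives the derivative.
  have yeq : y = fun τ => Real.exp (N * τ) * ((∫ s in Ioi 0, k s) - ∫ s in (0 : ℝ)..τ, k s) := by
    ext τ
    rw [yT τ, riccatiMap_eq, ← hJ]
  have ycont : Continuous y := by
    rw [yeq]
    have := intervalIntegral.continuous_primitive (fun a b => hkint a b) 0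
    fun_prop
  have kcont : Continuous k := by fun_prop
  refine ⟨y, y0, yh, fun t => ?_, fun t => ?_⟩
  · have d1 : HasDerivAt (fun τ => ∫ s in (0 : ℝ)..τ, k s) (k t) t :=
      intervalIntegral.integral_hasDerivAt_right (hkint 0 t)
        (kcont.stronglyMeasurableAtFilter _ _) kcont.continuousAt
    have d2 : HasDerivAt (fun τ => Real.exp (N * τ)) (Real.exp (N * t) * N) t := by
      simpa using ((hasDerivAt_id t).const_mul N).exp
    have d3 := d2.mul (d1.const_sub (∫ s in Ioi 0, k s))
    have e : (Real.exp (N * t) * N * ((∫ s in Ioi 0, k s) - ∫ s in (0 : ℝ)..t, k s) +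
        Real.exp (N * t) * -k t) = N * y t - (N - 1) * h t - y t ^ 2 := by
      have e1 : Real.exp (N * t) * Real.exp (-N * t) = 1 := by
        rw [← Real.exp_add]; simp
      have e2 := congrFun yeq t
      have e3 : Real.exp (N * t) * k t = (N - 1) * h t + y t ^ 2 := by
        simp only [k]
        rw [← mul_assoc, e1, one_mul]
      rw [mul_right_comm, ← e2, mul_neg, e3]
      ring
    rw [← e]
    exact d3.congr_of_eventuallyEq (Eventually.of_forall fun τ => congrFun yeq τ)
  · rw [yT t]
    -- The lower bound keeps only `0 < s ≤ 1` in the integral, where the weight is at least `exp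
    -- (-N)` and `h (t+s) ≥ h (t+1)`; the factor `N-1` is at least 1.
    have e : ∫ s in Ioc (0 : ℝ) 1, Real.exp (-N) * h (t + 1) = Real.exp (-N) * h (t + 1) := by
      simp
    rw [← e]
    have hconst : IntegrableOn (fun _ : ℝ => Real.exp (-N) * h (t + 1))
        (Ioc 0 1) := integrableOn_const (by simp)
    refine (setIntegral_mono_on hconst ((integrableOn_riccati hN hh ya h0 h1 y0 y1 t 0).mono_set
      fun x hx => hx.1) measurableSet_Ioc fun s hs => ?_).trans (setIntegral_mono_set
        (integrableOn_riccati hN hh ya h0 h1 y0 y1 t 0) (ae_of_all _ fun s => ?_)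
        (Eventually.of_forall fun x hx => hx.1))
    · have e1 : h (t + 1) ≤ h (t + s) := hh (by linarith [hs.2])
      have e2 := h0 (t + 1)
      have e3 : Real.exp (-N) ≤ Real.exp (-N * s) := by
        apply Real.exp_le_exp.2
        nlinarith [hs.2]
      have e4 := h0 (t + s)
      refine mul_le_mul e3 ?_ e2 (by positivity)
      nlinarith [sq_nonneg (y (t + s))]
    · have := h0 (t + s)
      have : 0 ≤ N - 1 := by linarith
      simp only [Pi.zero_apply]
      positivity

theorem tendsto_atTop_of_deriv_ge_div {Y y : ℝ → ℝ} {c T : ℝ} (hc : 0 < c) (hT : 0 ≤ T)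
    (hY : ∀ t, HasDerivAt Y (y t) t) (hy : ∀ t, T ≤ t → c / (t + 1) ≤ y t) :
    Tendsto Y atTop atTop := by
  let W : ℝ → ℝ := fun t => Y t - c * Real.log (t + 1)
  have hW : ∀ t, T ≤ t → HasDerivAt W (y t - c * (1 / (t + 1))) t := fun t ht =>
    (hY t).sub ((((hasDerivAt_id t).add_const 1).log (by simp only [id]; linarith)).const_mul c)
  have mono : MonotoneOn W (Ici T) := by
    refine monotoneOn_of_deriv_nonneg (convex_Ici T)
      (fun t ht => (hW t ht).continuousAt.continuousWithinAt)
      (fun t ht => ?_) (fun t ht => ?_)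
    · rw [interior_Ici] at ht
      exact (hW t ht.le).differentiableAt.differentiableWithinAt
    · rw [interior_Ici] at ht
      rw [(hW t ht.le).deriv]
      have := hy t ht.le
      rw [mul_one_div]
      linarith
  have h1 : Tendsto (fun t : ℝ => W T + c * Real.log (t + 1)) atTop atTop :=
    tendsto_atTop_add_const_left _ _
      ((Real.tendsto_log_atTop.comp (tendsto_atTop_add_const_right _ _ tendsto_id)).const_mul_atTop
        hc)
  refine tendsto_atTop_mono' _ ?_ h1
  filter_upwards [eventually_ge_atTop T] with t ht
  have := mono (mem_Ici.2 le_rfl) (mem_Ici.2 ht) ht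
  simp only [W] at this ⊢
  linarith

/-- A solution of the linear system `v' = h (v + d) - d`, `d' = N d - h (v + d)` of slow growth,
unbounded if `h` decays at most like `1 / t`. -/
theorem exists_slow_solution {N : ℝ} (hN : 2 ≤ N) {h : ℝ → ℝ} (hc : Continuous h)
    (hh : Antitone h) (h0 : ∀ t, 0 ≤ h t) {H : ℝ} (H1 : H < 1) (hH : ∀ t, h t ≤ H)
    {c T : ℝ} (c0 : 0 < c) (hT : 0 ≤ T) (hcT : ∀ t, T ≤ t → c / t ≤ h t) :
    ∃ v d : ℝ → ℝ, (∀ t, HasDerivAt v (h t * (v t + d t) - d t) t) ∧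
      (∀ t, HasDerivAt d (N * d t - h t * (v t + d t)) t) ∧
      (∀ t, 0 ≤ t → |v t| ≤ Real.exp (H * t) ∧ |d t| ≤ Real.exp (H * t)) ∧
      Tendsto v atTop atTop := by
  obtain ⟨y, y0, yh, yd, yl⟩ := exists_riccati_solution hN hc hh h0 (fun t => (hH t).trans H1.le)
  have ycont : Continuous y := continuous_iff_continuousAt.2 fun t => (yd t).continuousAt
  let Y : ℝ → ℝ := fun t => ∫ s in (0 : ℝ)..t, y s
  have Yd : ∀ t, HasDerivAt Y (y t) t := fun t =>
    intervalIntegral.integral_hasDerivAt_right (ycont.intervalIntegrable _ _)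
      (ycont.stronglyMeasurableAtFilter _ _) ycont.continuousAt
  have Yle : ∀ t, 0 ≤ t → Y t ≤ H * t := fun t ht => by
    calc Y t ≤ ∫ s in (0 : ℝ)..t, H :=
          intervalIntegral.integral_mono_on ht (ycont.intervalIntegrable _ _) (by simp)
            fun s _ => (yh s).trans (hH s)
      _ = H * t := by simp [mul_comm]
  have Ytop : Tendsto Y atTop atTop := by
    refine tendsto_atTop_of_deriv_ge_div (c := Real.exp (-N) * c) (by positivity) hT Yd
      fun t ht => (yl t).trans' ?_
    rw [mul_div_assoc]
    gcongr
    -- The unit shift in the lower bound for `y` is the reason for the denominator `t + 1`.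
    exact hcT _ (by linarith)
  have hm : 0 < N - 1 := by linarith
  have Zd : ∀ t, HasDerivAt (fun t => Real.exp (Y t)) (Real.exp (Y t) * y t) t :=
    fun t => (Yd t).exp
  have yle : ∀ t, y t / (N - 1) ≤ H := fun t =>
    (div_le_self (y0 t) (by linarith)).trans ((yh t).trans (hH t))
  have ynn : ∀ t, 0 ≤ y t / (N - 1) := fun t => div_nonneg (y0 t) hm.le
  have hm' := hm.ne'
  -- Chosen so that `v + d = exp Y` and `(v + d)' = (N-1) d`; the equation for `d` is then the
  -- Riccati equation for `y`.
  refine ⟨fun t => Real.exp (Y t) * (1 - y t / (N - 1)), fun t => Real.exp (Y t) * (y t / (N - 1)),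
    fun t => ?_, fun t => ?_, fun t ht => ⟨?_, ?_⟩, ?_⟩
  · refine ((Zd t).mul (((yd t).div_const (N - 1)).const_sub 1)).congr_deriv ?_
    field_simp
    ring
  · refine ((Zd t).mul ((yd t).div_const (N - 1))).congr_deriv ?_
    field_simp
    ring
  · have h1 := yle t
    have h2 := ynn t
    rw [abs_of_nonneg (mul_nonneg (Real.exp_nonneg _) (by linarith))]
    refine (mul_le_of_le_one_right (Real.exp_nonneg _) (by linarith)).trans
      (Real.exp_le_exp.2 (Yle t ht))
  · have h1 := yle t
    have h2 := ynn t
    rw [abs_of_nonneg (mul_nonneg (Real.exp_nonneg _) (by linarith))]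
    refine (mul_le_of_le_one_right (Real.exp_nonneg _) (by linarith)).trans
      (Real.exp_le_exp.2 (Yle t ht))
  -- Since `y/(N-1) ≤ H < 1`, the function `v` is at least `(1-H) exp Y`.
  · refine tendsto_atTop_mono (fun t => ?_)
      ((Real.tendsto_exp_atTop.comp Ytop).atTop_mul_const (sub_pos.2 H1))
    have h1 := yle t
    simp only [Function.comp]
    gcongr

/-! ### Integrability and integration by parts across a point singularity -/

theorem aestronglyMeasurable_of_continuousOn_compl_zero {n : ℕ} (hn : 1 ≤ n) {F : Type*}
    [NormedAddCommGroup F] {f : EuclideanSpace ℝ (Fin n) → F} (hf : ContinuousOn f {0}ᶜ) :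
    AEStronglyMeasurable f volume := by
  have : Nonempty (Fin n) := ⟨⟨0, hn⟩⟩
  have h := hf.aestronglyMeasurable (μ := volume) (measurableSet_singleton 0).compl
  rwa [Measure.restrict_eq_self_of_ae_mem] at h
  simp [ae_iff]

theorem integrable_of_singular_bound {n : ℕ} (hn : 1 ≤ n) {f : EuclideanSpace ℝ (Fin n) → ℝ}
    {β C : ℝ} (hβ : β < n) (hf : AEStronglyMeasurable f volume)
    (hb : ∀ x, x ≠ 0 → ‖f x‖ ≤ C * (ball 0 1).indicator (fun x => ‖x‖ ^ (-β)) x) :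
    Integrable f := by
  have : Nonempty (Fin n) := ⟨⟨0, hn⟩⟩
  have h0 : ∀ᵐ x : EuclideanSpace ℝ (Fin n), x ≠ 0 := by simp [ae_iff]
  rw [← integrableOn_iff_integrable_of_support_subset (s := ball 0 1)]
  · refine integrableOn_ball_of_norm_le_rpow (α := β) (C := C) (by simpa using hn)
      (by simpa using hβ) ?_ hf
    rw [ae_restrict_iff' measurableSet_ball]
    filter_upwards [h0] with x hx hx1
    have := hb x hx
    rwa [indicator_of_mem hx1] at this
  · intro x hx
    by_contra hx1
    have hx0 : x ≠ 0 := by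
      rintro rfl
      simp at hx1
    have := hb x hx0
    rw [indicator_of_notMem hx1, mul_zero] at this
    exact hx (norm_le_zero_iff.1 this)

/-- Integration by parts against a test function, for a function with a point singularity
at the origin. -/
theorem integral_mul_partialDeriv_of_singular {n : ℕ} (hn : 1 ≤ n) {i : Fin n}
    {f : EuclideanSpace ℝ (Fin n) → ℝ}
    {f' : EuclideanSpace ℝ (Fin n) → EuclideanSpace ℝ (Fin n) →L[ℝ] ℝ}
    {D : EuclideanSpace ℝ (Fin n) → ℝ} (hf : ∀ x, x ≠ 0 → HasFDerivAt f (f' x) x)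
    (hD : ∀ x, x ≠ 0 → f' x (EuclideanSpace.single i 1) = D x) (hDc : ContinuousOn D {0}ᶜ)
    {α C : ℝ} (hα : α + 1 < n)
    (hfb : ∀ x, x ≠ 0 → ‖x‖ < 1 → |f x| ≤ C * ‖x‖ ^ (-α))
    (hDb : ∀ x, x ≠ 0 → ‖x‖ < 1 → |D x| ≤ C * ‖x‖ ^ (-(α + 1)))
    {φ : EuclideanSpace ℝ (Fin n) → ℝ} (hφ : IsTestFunction (ball 0 1) φ) :
    Integrable (fun x => f x * partialDeriv i φ x) ∧ Integrable (fun x => D x * φ x) ∧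
      ∫ x, f x * partialDeriv i φ x = - ∫ x, D x * φ x := by
  obtain ⟨φs, φc, φt⟩ := hφ
  have φd : Differentiable ℝ φ := φs.differentiable (by simp)
  let e : EuclideanSpace ℝ (Fin n) := EuclideanSpace.single i 1
  let β : ContDiffBump (0 : EuclideanSpace ℝ (Fin n)) := ⟨1, 2, one_pos, one_lt_two⟩
  have βs : ContDiff ℝ (⊤ : ℕ∞) β := β.contDiff
  have βd : Differentiable ℝ β := βs.differentiable (by simp)
  have pc : Continuous (partialDeriv i φ) := (φs.continuous_fderiv (by simp)).clm_apply
    continuous_const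
  have βpc : Continuous (fun x => fderiv ℝ β x e) := (βs.continuous_fderiv (by simp)).clm_apply
    continuous_const
  obtain ⟨M, hM⟩ : ∃ M, ∀ x, ‖φ x‖ ≤ M := φc.exists_bound_of_continuous φs.continuous
  obtain ⟨M1, hM1⟩ : ∃ M, ∀ x, ‖partialDeriv i φ x‖ ≤ M :=
    HasCompactSupport.exists_bound_of_continuous (φc.fderiv_apply (𝕜 := ℝ) e) pc
  obtain ⟨M2, hM2⟩ : ∃ M, ∀ x, ‖fderiv ℝ β x e‖ ≤ M :=
    HasCompactSupport.exists_bound_of_continuous (β.hasCompactSupport.fderiv_apply (𝕜 := ℝ) e) βpc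
  have φ0 : ∀ x, x ∉ ball (0 : EuclideanSpace ℝ (Fin n)) 1 → φ x = 0 := fun x hx =>
    image_eq_zero_of_notMem_tsupport fun h => hx (φt h)
  have p0 : ∀ x, x ∉ ball (0 : EuclideanSpace ℝ (Fin n)) 1 → partialDeriv i φ x = 0 := fun x hx => by
    have : x ∉ tsupport (fun x => fderiv ℝ φ x e) := fun h =>
      hx (φt (tsupport_fderiv_apply_subset ℝ e h))
    exact image_eq_zero_of_notMem_tsupport this
  have M0 : 0 ≤ M := (norm_nonneg _).trans (hM 0)
  have M10 : 0 ≤ M1 := (norm_nonneg _).trans (hM1 0)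
  have M20 : 0 ≤ M2 := (norm_nonneg _).trans (hM2 0)
  have fc : ContinuousOn f {0}ᶜ := fun x hx => (hf x hx).continuousAt.continuousWithinAt
  have fm := aestronglyMeasurable_of_continuousOn_compl_zero hn fc
  have Dm := aestronglyMeasurable_of_continuousOn_compl_zero hn hDc
  let b : EuclideanSpace ℝ (Fin n) → ℝ := (ball 0 1).indicator (fun x => ‖x‖ ^ (-(α + 1)))
  have hb1 : ∀ x : EuclideanSpace ℝ (Fin n), x ≠ 0 → ‖x‖ < 1 → ‖x‖ ^ (-α) ≤ ‖x‖ ^ (-(α + 1)) := fun x hx h1 =>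
    Real.rpow_le_rpow_of_exponent_ge (norm_pos_iff.2 hx) h1.le (by linarith)
  have hb2 : ∀ x : EuclideanSpace ℝ (Fin n), x ≠ 0 →
      ‖x‖ ^ (-α) * ‖x‖⁻¹ = ‖x‖ ^ (-(α + 1)) := fun x hx => by
    rw [neg_add, Real.rpow_add (norm_pos_iff.2 hx), Real.rpow_neg_one]
  -- The cutoff `ζ k` vanishes near the origin and equals 1 where `k |x| ≥ 2`; `ζ' k` is its
  -- derivative in direction `e`.
  let ζ : ℕ → EuclideanSpace ℝ (Fin n) → ℝ := fun k x => 1 - β ((k : ℝ) • x)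
  let ζ' : ℕ → EuclideanSpace ℝ (Fin n) → ℝ := fun k x => - (k * fderiv ℝ β ((k : ℝ) • x) e)
  have ζc : ∀ k, Continuous (ζ k) := fun k => by
    have := β.continuous
    fun_prop
  have ζ'c : ∀ k, Continuous (ζ' k) := fun k => by
    have h2 : Continuous (fun x : EuclideanSpace ℝ (Fin n) => (k : ℝ) • x) := by fun_prop
    exact (continuous_const.mul (βpc.comp h2)).neg
  have ζ01 : ∀ k x, |ζ k x| ≤ 1 := fun k x => by
    have h1 := β.nonneg (x := (k : ℝ) • x)
    have h2 := β.le_one (x := (k : ℝ) • x)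
    rw [abs_le]
    constructor <;> simp only [ζ] <;> linarith
  have ζd : ∀ k x, HasFDerivAt (ζ k) (-((fderiv ℝ β ((k : ℝ) • x)).comp
      ((k : ℝ) • ContinuousLinearMap.id ℝ (EuclideanSpace ℝ (Fin n))))) x := fun k x => by
    have h2 : HasFDerivAt (fun x : EuclideanSpace ℝ (Fin n) => (k : ℝ) • x)
      ((k : ℝ) • ContinuousLinearMap.id ℝ (EuclideanSpace ℝ (Fin n))) x :=
        (hasFDerivAt_id x).const_smul (k : ℝ)
    exact ((βd _).hasFDerivAt.comp x h2).const_sub 1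
  -- The bound is uniform in `k`: the derivative is of size `k`, but it lives where `k ≤ 2/|x|`. The
  -- term `f ζ'` is then no more singular than `D`, which supplies an integrable majorant because `α
  -- + 1 < n`.
  have ζ'b : ∀ k x, x ≠ 0 → |ζ' k x| ≤ 2 * M2 * ‖x‖⁻¹ := fun k x hx => by
    have hx' := norm_pos_iff.2 hx
    by_cases hk : (k : ℝ) * ‖x‖ ≤ 2
    · have h1 : (k : ℝ) ≤ 2 * ‖x‖⁻¹ := by
        rw [← div_eq_mul_inv, le_div_iff₀ hx']
        exact hk
      have h2 := hM2 ((k : ℝ) • x)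
      rw [Real.norm_eq_abs] at h2
      simp only [ζ', abs_neg, abs_mul, Nat.abs_cast]
      calc (k : ℝ) * |fderiv ℝ β ((k : ℝ) • x) e| ≤ (2 * ‖x‖⁻¹) * M2 := by gcongr
        _ = _ := by ring
    · have h1 : (k : ℝ) • x ∉ tsupport β := by
        rw [β.tsupport_eq, mem_closedBall_zero_iff, norm_smul]
        simpa using hk
      have h2 : fderiv ℝ β ((k : ℝ) • x) = 0 := by
        refine image_eq_zero_of_notMem_tsupport (f := fderiv ℝ β) fun h => h1 ?_
        exact tsupport_fderiv_subset ℝ h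
      simp only [ζ', h2]
      simp
      positivity
  have ζ0 : ∀ k : ℕ, ∀ᶠ x in 𝓝 (0 : EuclideanSpace ℝ (Fin n)), ζ k x = 0 := fun k => by
    have h2 : Continuous (fun x : EuclideanSpace ℝ (Fin n) => (k : ℝ) • x) := by fun_prop
    have h4 : Tendsto (fun x : EuclideanSpace ℝ (Fin n) => (k : ℝ) • x) (𝓝 0) (𝓝 0) := by
      simpa using h2.tendsto 0
    have h3 := h4.eventually β.eventuallyEq_one
    filter_upwards [h3] with x hx
    simp [ζ, hx]
  -- At the origin the truncated function is differentiable because it vanishes nearby. The product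
  -- formula is asserted only elsewhere, since nothing is known of `f` and `D` at 0.
  have fk : ∀ k x, ∃ L : EuclideanSpace ℝ (Fin n) →L[ℝ] ℝ, HasFDerivAt (fun x => f x * ζ k x) L x ∧
      (x ≠ 0 → L e = D x * ζ k x + f x * ζ' k x) := fun k x => by
    by_cases hx : x = 0
    · subst hx
      refine ⟨0, ?_, fun h => absurd rfl h⟩
      refine (hasFDerivAt_const (0 : ℝ) _).congr_of_eventuallyEq ?_
      filter_upwards [ζ0 k] with x hx
      simp [hx]
    · refine ⟨_, (hf x hx).mul (ζd k x), fun _ => ?_⟩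
      simp [ζ', e, hD x hx]
      ring
  have B1 : ∀ (w ψ : EuclideanSpace ℝ (Fin n) → ℝ) (M W : ℝ), 0 ≤ M → 0 ≤ W →
      (∀ x, ‖ψ x‖ ≤ M) → (∀ x, x ∉ ball (0 : EuclideanSpace ℝ (Fin n)) 1 → ψ x = 0) →
      (∀ x, x ≠ 0 → ‖x‖ < 1 → |w x| ≤ W * ‖x‖ ^ (-(α + 1))) →
      ∀ x, x ≠ 0 → ‖w x * ψ x‖ ≤ (W * M) * b x := by
    intro w ψ M W hM hW h1 h2 h3 x hx
    by_cases hx1 : x ∈ ball (0 : EuclideanSpace ℝ (Fin n)) 1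
    · simp only [b]
      rw [indicator_of_mem hx1, norm_mul]
      have h4 := h3 x hx (by simpa using hx1)
      have h5 := h1 x
      have h6 : 0 ≤ ‖x‖ ^ (-(α + 1)) := Real.rpow_nonneg (norm_nonneg x) _
      calc ‖w x‖ * ‖ψ x‖ ≤ (W * ‖x‖ ^ (-(α + 1))) * M := by
            rw [Real.norm_eq_abs (w x)]
            gcongr
        _ = _ := by ring
    · simp only [b]
      rw [h2 x hx1, indicator_of_notMem hx1]
      simp
  have hfb' : ∀ x, x ≠ 0 → ‖x‖ < 1 → |f x| ≤ |C| * ‖x‖ ^ (-(α + 1)) := fun x hx h1 =>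
    (hfb x hx h1).trans (mul_le_mul (le_abs_self C) (hb1 x hx h1)
      (Real.rpow_nonneg (norm_nonneg x) _) (abs_nonneg C))
  have hDb' : ∀ x, x ≠ 0 → ‖x‖ < 1 → |D x| ≤ |C| * ‖x‖ ^ (-(α + 1)) := fun x hx h1 =>
    (hDb x hx h1).trans (mul_le_mul_of_nonneg_right (le_abs_self C)
      (Real.rpow_nonneg (norm_nonneg x) _))
  have hfk : ∀ k x, x ≠ 0 → ‖x‖ < 1 → |f x * ζ k x| ≤ |C| * ‖x‖ ^ (-(α + 1)) :=
    fun k x hx h1 => by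
      rw [abs_mul]
      exact (mul_le_of_le_one_right (abs_nonneg _) (ζ01 k x)).trans (hfb' x hx h1)
  have hDk : ∀ k x, x ≠ 0 → ‖x‖ < 1 → |D x * ζ k x + f x * ζ' k x| ≤
      (|C| + |C| * (2 * M2)) * ‖x‖ ^ (-(α + 1)) := fun k x hx h1 => by
    have e1 : |D x * ζ k x| ≤ |C| * ‖x‖ ^ (-(α + 1)) := by
      rw [abs_mul]
      exact (mul_le_of_le_one_right (abs_nonneg _) (ζ01 k x)).trans (hDb' x hx h1)
    have e2 : |f x * ζ' k x| ≤ |C| * (2 * M2) * ‖x‖ ^ (-(α + 1)) := by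
      rw [abs_mul, ← hb2 x hx]
      calc |f x| * |ζ' k x| ≤ (|C| * ‖x‖ ^ (-α)) * (2 * M2 * ‖x‖⁻¹) := by
            have := ζ'b k x hx
            have := (hfb x hx h1).trans (mul_le_mul_of_nonneg_right (le_abs_self C)
              (Real.rpow_nonneg (norm_nonneg x) _))
            gcongr
        _ = _ := by ring
    calc _ ≤ |D x * ζ k x| + |f x * ζ' k x| := abs_add_le _ _
      _ ≤ _ := by rw [add_mul]; exact add_le_add e1 e2
  have hbm : ∀ (W : ℝ), Integrable (fun x => W * b x) := fun W => by
    refine Integrable.const_mul ?_ W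
    refine integrable_of_singular_bound (C := 1) hn hα ?_ fun x hx => ?_
    · refine aestronglyMeasurable_of_continuousOn_compl_zero (F := ℝ) hn ?_ |>.indicator
        measurableSet_ball
      exact fun x hx => (continuous_norm.continuousAt.rpow_const
        (Or.inl (norm_ne_zero_iff.2 hx))).continuousWithinAt
    · have : 0 ≤ b x := indicator_nonneg (fun x _ => Real.rpow_nonneg (norm_nonneg x) _) x
      rw [Real.norm_eq_abs, abs_of_nonneg this, one_mul]
  have C1 : 0 ≤ |C| + |C| * (2 * M2) := by positivity
  have I1 : Integrable (fun x => f x * partialDeriv i φ x) :=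
    integrable_of_singular_bound hn hα (fm.mul pc.aestronglyMeasurable)
      (B1 f _ M1 |C| M10 (abs_nonneg _) hM1 p0 hfb')
  have I2 : Integrable (fun x => D x * φ x) :=
    integrable_of_singular_bound hn hα (Dm.mul φs.continuous.aestronglyMeasurable)
      (B1 D _ M |C| M0 (abs_nonneg _) hM φ0 hDb')
  have I1k : ∀ k, Integrable (fun x => f x * ζ k x * partialDeriv i φ x) := fun k =>
    integrable_of_singular_bound hn hα
      ((fm.mul (ζc k).aestronglyMeasurable).mul pc.aestronglyMeasurable)
      (B1 _ _ M1 |C| M10 (abs_nonneg _) hM1 p0 (hfk k))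
  have I3k : ∀ k, Integrable (fun x => f x * ζ k x * φ x) := fun k =>
    integrable_of_singular_bound hn hα
      ((fm.mul (ζc k).aestronglyMeasurable).mul φs.continuous.aestronglyMeasurable)
      (B1 _ _ M |C| M0 (abs_nonneg _) hM φ0 (hfk k))
  have I2k : ∀ k, Integrable (fun x => (D x * ζ k x + f x * ζ' k x) * φ x) := fun k =>
    integrable_of_singular_bound hn hα
      (((Dm.mul (ζc k).aestronglyMeasurable).add (fm.mul (ζ'c k).aestronglyMeasurable)).mul
        φs.continuous.aestronglyMeasurable)
      (B1 _ _ M _ M0 C1 hM φ0 (hDk k))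
  have : Nonempty (Fin n) := ⟨i⟩
  have ae0 : ∀ᵐ x : EuclideanSpace ℝ (Fin n), x ≠ 0 := by simp [ae_iff]
  have fkD : ∀ k, (fun x => fderiv ℝ (fun x => f x * ζ k x) x e * φ x) =ᵐ[volume]
      fun x => (D x * ζ k x + f x * ζ' k x) * φ x := fun k => by
    filter_upwards [ae0] with x hx
    obtain ⟨L, hL, hLe⟩ := fk k x
    rw [hL.fderiv, hLe hx]
  have Sk : ∀ k, ∫ x, (f x * ζ k x * partialDeriv i φ x +
      (D x * ζ k x + f x * ζ' k x) * φ x) = 0 := fun k => by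
    rw [integral_add (I1k k) (I2k k), ← integral_congr_ae (fkD k)]
    have := integral_mul_fderiv_eq_neg_fderiv_mul_of_integrable (μ := volume)
      (f := fun x => f x * ζ k x) (g := φ) (v := e) ((I2k k).congr (fkD k).symm) (I1k k) (I3k k)
      (fun x _ => by
        obtain ⟨L, hL, _⟩ := fk k x
        exact hL.differentiableAt) (fun x _ => φd x)
    exact add_eq_zero_iff_eq_neg.2 this
  have lim := tendsto_integral_of_dominated_convergence (μ := volume)
    (F := fun (k : ℕ) x => f x * ζ k x * partialDeriv i φ x +
      (D x * ζ k x + f x * ζ' k x) * φ x)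
    (f := fun x => f x * partialDeriv i φ x + D x * φ x)
    (fun x => (|C| * M1) * b x + ((|C| + |C| * (2 * M2)) * M) * b x)
    (fun k => ((I1k k).add (I2k k)).aestronglyMeasurable)
    ((hbm _).add (hbm _)) (fun k => by
      filter_upwards [ae0] with x hx
      exact (norm_add_le _ _).trans (add_le_add
        (B1 _ _ M1 |C| M10 (abs_nonneg _) hM1 p0 (hfk k) x hx)
        (B1 _ _ M _ M0 C1 hM φ0 (hDk k) x hx)))
    (by
      filter_upwards [ae0] with x hx
      have hx' := norm_pos_iff.2 hx
      obtain ⟨k0, hk0⟩ := exists_nat_gt (2 / ‖x‖)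
      -- For a fixed `x ≠ 0` the integrand no longer depends on `k` once `k |x| > 2`.
      refine tendsto_const_nhds.congr' ?_
      filter_upwards [eventually_ge_atTop k0] with k hk
      have hk1 : 2 < (k : ℝ) * ‖x‖ := by
        rw [div_lt_iff₀ hx'] at hk0
        have : (k0 : ℝ) ≤ k := by exact_mod_cast hk
        nlinarith
      have h1 : (k : ℝ) • x ∉ tsupport β := by
        rw [β.tsupport_eq, mem_closedBall_zero_iff, norm_smul]
        simpa using hk1
      have h2 : fderiv ℝ β ((k : ℝ) • x) = 0 := by
        refine image_eq_zero_of_notMem_tsupport (f := fderiv ℝ β) fun h => h1 ?_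
        exact tsupport_fderiv_subset ℝ h
      have h3 : β ((k : ℝ) • x) = 0 := image_eq_zero_of_notMem_tsupport h1
      simp [ζ, ζ', h2, h3])
  simp only [Sk] at lim
  have := tendsto_nhds_unique lim tendsto_const_nhds
  rw [integral_add I1 I2] at this
  exact ⟨I1, I2, add_eq_zero_iff_eq_neg.1 this⟩

theorem locallySquareIntegrableOn_of_singular_bound {n : ℕ} (hn : 1 ≤ n) {F : Type*}
    [NormedAddCommGroup F] {Ω : Set (EuclideanSpace ℝ (Fin n))} (hΩ : Ω ⊆ ball 0 1)
    {f : EuclideanSpace ℝ (Fin n) → F} (hf : AEStronglyMeasurable f volume) {H C : ℝ}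
    (hH : 2 * H < n) (hb : ∀ x, x ≠ 0 → ‖x‖ < 1 → ‖f x‖ ≤ C * ‖x‖ ^ (-H)) :
    LocallySquareIntegrableOn Ω f := by
  intro K hK _
  have : Nonempty (Fin n) := ⟨⟨0, hn⟩⟩
  have h0 : ∀ᵐ x : EuclideanSpace ℝ (Fin n), x ≠ 0 := by simp [ae_iff]
  rw [memLp_two_iff_integrable_sq_norm hf.restrict]
  have : IntegrableOn (fun x => ‖f x‖ ^ 2) (ball 0 1) := by
    refine integrableOn_ball_of_norm_le_rpow (α := 2 * H) (C := C ^ 2) (by simpa using hn)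
      (by simpa using hH) ?_ (hf.norm.pow 2)
    rw [ae_restrict_iff' measurableSet_ball]
    filter_upwards [h0] with x hx hx1
    have h1 := hb x hx (by simpa using hx1)
    rw [norm_pow, norm_norm]
    calc ‖f x‖ ^ 2 ≤ (C * ‖x‖ ^ (-H)) ^ 2 := by gcongr
      _ = C ^ 2 * ‖x‖ ^ (-(2 * H)) := by
        rw [mul_pow, ← Real.rpow_natCast (‖x‖ ^ (-H)), ← Real.rpow_mul (norm_nonneg _)]
        congr 2
        push_cast
        ring
  exact this.mono_set (hK.trans hΩ)

/-! ### The weak solution attached to a radial profile -/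

theorem hasFDerivAt_comp_neg_log_norm {n : ℕ} {w : ℝ → ℝ} {w' : ℝ}
    {x : EuclideanSpace ℝ (Fin n)} (hx : x ≠ 0) (hw : HasDerivAt w w' (-Real.log ‖x‖)) :
    HasFDerivAt (fun x : EuclideanSpace ℝ (Fin n) => w (-Real.log ‖x‖))
      (-(w' * (‖x‖ ^ 2)⁻¹) • innerSL ℝ x) x := by
  have hx' : ‖x‖ ^ 2 ≠ 0 := pow_ne_zero 2 (norm_ne_zero_iff.2 hx)
  have h1 : HasFDerivAt (fun x : EuclideanSpace ℝ (Fin n) => ‖x‖ ^ 2) (2 • innerSL ℝ x) x :=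
    (hasStrictFDerivAt_norm_sq x).hasFDerivAt
  have h2 : HasFDerivAt (fun x : EuclideanSpace ℝ (Fin n) => -Real.log ‖x‖)
      (-(‖x‖ ^ 2)⁻¹ • innerSL ℝ x) x := by
    have h3 := (h1.log hx').const_mul (-(1 / 2 : ℝ))
    refine (h3.congr_fderiv ?_).congr_of_eventuallyEq (Eventually.of_forall fun y => ?_)
    · ext z
      simp
      ring
    · change -Real.log ‖y‖ = -(1 / 2) * Real.log (‖y‖ ^ 2)
      rw [Real.log_pow]
      push_cast
      ring
  refine (hw.comp_hasFDerivAt x h2).congr_fderiv ?_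
  ext z
  simp
  ring

theorem hasFDerivAt_euclidean_coord {n : ℕ} (i : Fin n) (x : EuclideanSpace ℝ (Fin n)) :
    HasFDerivAt (fun x : EuclideanSpace ℝ (Fin n) => x i)
      (EuclideanSpace.proj i : EuclideanSpace ℝ (Fin n) →L[ℝ] ℝ) x :=
  (EuclideanSpace.proj i : EuclideanSpace ℝ (Fin n) →L[ℝ] ℝ).hasFDerivAt

theorem abs_coord_div_norm_le_one {n : ℕ} (i : Fin n) (x : EuclideanSpace ℝ (Fin n)) :
    |x i / ‖x‖| ≤ 1 := by
  rw [abs_div, abs_norm]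
  exact div_le_one_of_le₀ (by simpa using PiLp.norm_apply_le x i) (norm_nonneg _)

theorem sum_sq_coord_div_norm {n : ℕ} {x : EuclideanSpace ℝ (Fin n)} (hx : x ≠ 0) :
    ∑ i, (x i / ‖x‖) ^ 2 = 1 := by
  simp_rw [div_pow]
  rw [← Finset.sum_div, EuclideanSpace.norm_sq_eq]
  simp only [Real.norm_eq_abs, sq_abs]
  apply div_self
  have : 0 < ‖x‖ ^ 2 := pow_pos (norm_pos_iff.2 hx) 2
  rw [EuclideanSpace.norm_sq_eq] at this
  simpa using this.ne'

theorem continuousOn_comp_neg_log_norm {n : ℕ} {w : ℝ → ℝ} (hw : Continuous w) :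
    ContinuousOn (fun x : EuclideanSpace ℝ (Fin n) => w (-Real.log ‖x‖)) {0}ᶜ :=
  hw.comp_continuousOn ((continuous_norm.continuousOn.log fun _ hx =>
    norm_ne_zero_iff.2 hx).neg)

theorem continuousOn_coord_div_norm {n : ℕ} (i : Fin n) :
    ContinuousOn (fun x : EuclideanSpace ℝ (Fin n) => x i / ‖x‖) {0}ᶜ :=
  (by fun_prop : Continuous fun x : EuclideanSpace ℝ (Fin n) => x i).continuousOn.div
    continuous_norm.continuousOn fun _ hx => norm_ne_zero_iff.2 hx

theorem abs_mul_le_of_abs_le_one {a s M : ℝ} (ha : |a| ≤ M) (hs : |s| ≤ 1) : |a * s| ≤ M := by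
  rw [abs_mul]
  exact (mul_le_of_le_one_right (abs_nonneg a) hs).trans ha

/-- A solution of the radial system yields a weak solution `x_i v(-log|x|)` for the
Gilbarg-Serrin coefficients. -/
theorem exists_weakSolution_of_profile {n : ℕ} (hn : 2 ≤ n) {Ω : Set (EuclideanSpace ℝ (Fin n))}
    (hΩ1 : Ω ⊆ ball 0 1) {g h v d : ℝ → ℝ} {H : ℝ} (H1 : H < 1) (hc : Continuous h)
    (h0 : ∀ t, 0 ≤ h t) (h1 : ∀ t, h t ≤ 1)
    (hv : ∀ t, HasDerivAt v (h t * (v t + d t) - d t) t)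
    (hd : ∀ t, HasDerivAt d (n * d t - h t * (v t + d t)) t)
    (hb : ∀ t, 0 ≤ t → |v t| ≤ Real.exp (H * t) ∧ |d t| ≤ Real.exp (H * t))
    (htop : Tendsto v atTop atTop)
    (hgh : ∀ x ∈ Ω, x ≠ 0 → h (-Real.log ‖x‖) * (1 + g ‖x‖) = g ‖x‖) :
    ∃ u : EuclideanSpace ℝ (Fin n) → ℝ, IsWeakSolution Ω (gilbargSerrinCoeff g) u ∧
      ContinuousOn u Ω ∧ ¬ IsLipschitzAtZero u := by
  have hn1 : 1 ≤ n := by omega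
  have hnR : (2 : ℝ) ≤ n := by exact_mod_cast hn
  let o : Fin n := ⟨0, hn1⟩
  have : Nonempty (Fin n) := ⟨o⟩
  have ae0 : ∀ᵐ x : EuclideanSpace ℝ (Fin n), x ≠ 0 := by simp [ae_iff]
  have vc : Continuous v := continuous_iff_continuousAt.2 fun t => (hv t).continuousAt
  have dc : Continuous d := continuous_iff_continuousAt.2 fun t => (hd t).continuousAt
  let v' : ℝ → ℝ := fun t => h t * (v t + d t) - d t
  let d' : ℝ → ℝ := fun t => n * d t - h t * (v t + d t)
  have v'c : Continuous v' := by fun_prop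
  have d'c : Continuous d' := by fun_prop
  let l : EuclideanSpace ℝ (Fin n) → ℝ := fun x => -Real.log ‖x‖
  let s : Fin n → EuclideanSpace ℝ (Fin n) → ℝ := fun i x => x i / ‖x‖
  have sle : ∀ i x, |s i x| ≤ 1 := abs_coord_div_norm_le_one
  let δ : Fin n → ℝ := fun i => if i = o then 1 else 0
  have δle : ∀ i, |δ i| ≤ 1 := fun i => by
    simp only [δ]
    split_ifs <;> simp
  have hexp : ∀ x : EuclideanSpace ℝ (Fin n), x ≠ 0 → Real.exp (H * l x) = ‖x‖ ^ (-H) :=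
    fun x hx => by
      rw [Real.rpow_def_of_pos (norm_pos_iff.2 hx)]
      congr 1
      simp only [l]
      ring
  have lnn : ∀ x : EuclideanSpace ℝ (Fin n), ‖x‖ < 1 → 0 ≤ l x := fun x hx =>
    neg_nonneg.2 (Real.log_nonpos (norm_nonneg _) hx.le)
  have vb : ∀ x : EuclideanSpace ℝ (Fin n), x ≠ 0 → ‖x‖ < 1 → |v (l x)| ≤ ‖x‖ ^ (-H) :=
    fun x hx hx1 => (hb _ (lnn x hx1)).1.trans_eq (hexp x hx)
  have db : ∀ x : EuclideanSpace ℝ (Fin n), x ≠ 0 → ‖x‖ < 1 → |d (l x)| ≤ ‖x‖ ^ (-H) :=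
    fun x hx hx1 => (hb _ (lnn x hx1)).2.trans_eq (hexp x hx)
  have hvdb : ∀ x : EuclideanSpace ℝ (Fin n), x ≠ 0 → ‖x‖ < 1 →
      |h (l x) * (v (l x) + d (l x))| ≤ 2 * ‖x‖ ^ (-H) := fun x hx hx1 => by
    rw [mul_comm]
    refine abs_mul_le_of_abs_le_one ?_ (abs_le.2 ⟨by linarith [h0 (l x)], h1 _⟩)
    linarith [abs_add_le (v (l x)) (d (l x)), vb x hx hx1, db x hx hx1]
  have v'b : ∀ x : EuclideanSpace ℝ (Fin n), x ≠ 0 → ‖x‖ < 1 → |v' (l x)| ≤ 3 * ‖x‖ ^ (-H) :=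
    fun x hx hx1 => by
      refine (abs_sub _ _).trans ?_
      linarith [hvdb x hx hx1, db x hx hx1]
  have d'b : ∀ x : EuclideanSpace ℝ (Fin n), x ≠ 0 → ‖x‖ < 1 →
      |d' (l x)| ≤ (n + 2) * ‖x‖ ^ (-H) := fun x hx hx1 => by
    refine (abs_sub _ _).trans ?_
    rw [abs_mul, Nat.abs_cast]
    nlinarith [hvdb x hx hx1, db x hx hx1]
  let u : EuclideanSpace ℝ (Fin n) → ℝ := fun x => x o * v (l x)
  let G : EuclideanSpace ℝ (Fin n) → EuclideanSpace ℝ (Fin n) := fun x =>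
    WithLp.toLp 2 fun i => δ i * v (l x) - v' (l x) * s o x * s i x
  -- The flux `v e₁ + d θ₁ θ`, identified with the coefficient matrix applied to `G` at `e6` below.
  -- `D j` is the partial derivative of its `j`-th component in direction `j`, arranged to display
  -- the size `|x|^(-(H+1))`.
  let Φ : Fin n → EuclideanSpace ℝ (Fin n) → ℝ := fun j x =>
    δ j * v (l x) + d (l x) * x o * x j * (‖x‖ ^ 2)⁻¹
  let D : Fin n → EuclideanSpace ℝ (Fin n) → ℝ := fun j x =>
    ‖x‖⁻¹ * (-(v' (l x) * s j x * δ j) - d' (l x) * s j x * s j x * s o x +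
      (d (l x) * s j x * δ j + d (l x) * s o x) - 2 * (d (l x) * s j x * s j x * s o x))
  have GD : ∀ i x, x ≠ 0 → HasFDerivAt u (x o • (-(v' (l x) * (‖x‖ ^ 2)⁻¹) • innerSL ℝ x) +
      v (l x) • (EuclideanSpace.proj o : EuclideanSpace ℝ (Fin n) →L[ℝ] ℝ)) x ∧
      (x o • (-(v' (l x) * (‖x‖ ^ 2)⁻¹) • innerSL ℝ x) +
      v (l x) • (EuclideanSpace.proj o : EuclideanSpace ℝ (Fin n) →L[ℝ] ℝ))
        (EuclideanSpace.single i 1) = G x i := fun i x hx => by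
    refine ⟨(hasFDerivAt_euclidean_coord o x).mul (hasFDerivAt_comp_neg_log_norm hx (hv _)), ?_⟩
    have := norm_ne_zero_iff.2 hx
    simp [G, δ, s, EuclideanSpace.inner_single_right, eq_comm (a := o)]
    field_simp
    ring
  have ΦD : ∀ j x, x ≠ 0 → ∃ L : EuclideanSpace ℝ (Fin n) →L[ℝ] ℝ, HasFDerivAt (Φ j) L x ∧
      L (EuclideanSpace.single j 1) = D j x := fun j x hx => by
    have hxn := norm_ne_zero_iff.2 hx
    have hx' : ‖x‖ ^ 2 ≠ 0 := pow_ne_zero 2 hxn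
    have e1 : HasFDerivAt (fun x : EuclideanSpace ℝ (Fin n) => ‖x‖ ^ 2) (2 • innerSL ℝ x) x :=
      (hasStrictFDerivAt_norm_sq x).hasFDerivAt
    have e2 := (hasDerivAt_inv hx').comp_hasFDerivAt x e1
    refine ⟨_, ((hasFDerivAt_comp_neg_log_norm hx (hv _)).const_mul (δ j)).add
      ((((hasFDerivAt_comp_neg_log_norm hx (hd _)).mul (hasFDerivAt_euclidean_coord o x)).mul
      (hasFDerivAt_euclidean_coord j x)).mul e2), ?_⟩
    by_cases hjo : j = o
    · subst hjo
      simp [D, δ, s, v', d', l, EuclideanSpace.inner_single_right]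
      field_simp
      ring
    · simp [D, δ, s, v', d', l, EuclideanSpace.inner_single_right, hjo, Ne.symm hjo]
      field_simp
      ring
  have lc : ∀ {w : ℝ → ℝ}, Continuous w → ContinuousOn (fun x => w (l x)) {0}ᶜ :=
    fun hw => continuousOn_comp_neg_log_norm hw
  have sc : ∀ i, ContinuousOn (s i) {0}ᶜ := continuousOn_coord_div_norm
  have Gc : ∀ i, ContinuousOn (fun x => G x i) {0}ᶜ := fun i =>
    ((lc vc).const_mul _).sub (((lc v'c).mul (sc o)).mul (sc i))
  have Dc : ∀ j, ContinuousOn (D j) {0}ᶜ := fun j => by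
    have a1 := lc v'c
    have a2 := lc d'c
    have a3 := lc dc
    have a4 := sc j
    have a5 := sc o
    have a6 : ContinuousOn (fun x : EuclideanSpace ℝ (Fin n) => ‖x‖⁻¹) {0}ᶜ :=
      continuous_norm.continuousOn.inv₀ fun x hx => norm_ne_zero_iff.2 hx
    exact a6.mul (((((a1.mul a4).mul_const _).neg.sub (((a2.mul a4).mul a4).mul a5)).add
      (((a3.mul a4).mul_const _).add (a3.mul a5))).sub
      ((((a3.mul a4).mul a4).mul a5).const_mul _))
  have rle : ∀ x : EuclideanSpace ℝ (Fin n), x ≠ 0 → ‖x‖ < 1 →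
      ‖x‖ ^ (-H) ≤ ‖x‖ ^ (-(H + 1)) := fun x hx hx1 =>
    Real.rpow_le_rpow_of_exponent_ge (norm_pos_iff.2 hx) hx1.le (by linarith)
  have rmul : ∀ x : EuclideanSpace ℝ (Fin n), x ≠ 0 →
      ‖x‖⁻¹ * ‖x‖ ^ (-H) = ‖x‖ ^ (-(H + 1)) := fun x hx => by
    rw [neg_add, Real.rpow_add (norm_pos_iff.2 hx), Real.rpow_neg_one, mul_comm]
  have rnn : ∀ x : EuclideanSpace ℝ (Fin n), 0 ≤ ‖x‖ ^ (-H) := fun x =>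
    Real.rpow_nonneg (norm_nonneg _) _
  have ub : ∀ x, x ≠ 0 → ‖x‖ < 1 → |u x| ≤ ‖x‖ * ‖x‖ ^ (-H) := fun x hx hx1 => by
    simp only [u, abs_mul]
    exact mul_le_mul (by simpa using PiLp.norm_apply_le x o) (vb x hx hx1) (abs_nonneg _)
      (norm_nonneg _)
  have ub' : ∀ x, x ≠ 0 → ‖x‖ < 1 → |u x| ≤ 1 * ‖x‖ ^ (-H) := fun x hx hx1 =>
    (ub x hx hx1).trans (mul_le_mul_of_nonneg_right hx1.le (rnn x))
  have Gb : ∀ i x, x ≠ 0 → ‖x‖ < 1 → |G x i| ≤ 4 * ‖x‖ ^ (-H) := fun i x hx hx1 => by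
    have e1 : |δ i * v (l x)| ≤ ‖x‖ ^ (-H) := by
      rw [mul_comm]
      exact abs_mul_le_of_abs_le_one (vb x hx hx1) (δle i)
    have e2 := abs_mul_le_of_abs_le_one (abs_mul_le_of_abs_le_one (v'b x hx hx1) (sle o x))
      (sle i x)
    refine (abs_sub _ _).trans ?_
    linarith
  have Φb : ∀ j x, x ≠ 0 → ‖x‖ < 1 → |Φ j x| ≤ 2 * ‖x‖ ^ (-H) := fun j x hx hx1 => by
    have e1 : |δ j * v (l x)| ≤ ‖x‖ ^ (-H) := by
      rw [mul_comm]
      exact abs_mul_le_of_abs_le_one (vb x hx hx1) (δle j)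
    have e2 := abs_mul_le_of_abs_le_one (abs_mul_le_of_abs_le_one (db x hx hx1) (sle o x))
      (sle j x)
    have e3 : d (l x) * x o * x j * (‖x‖ ^ 2)⁻¹ = d (l x) * s o x * s j x := by
      have := norm_ne_zero_iff.2 hx
      simp only [s]
      field_simp
    simp only [Φ]
    rw [e3]
    refine (abs_add_le _ _).trans ?_
    linarith
  have Db : ∀ j x, x ≠ 0 → ‖x‖ < 1 → |D j x| ≤ (n + 9) * ‖x‖ ^ (-(H + 1)) := fun j x hx hx1 => by
    have e1 := abs_mul_le_of_abs_le_one (abs_mul_le_of_abs_le_one (v'b x hx hx1) (sle j x))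
      (δle j)
    have e2 := abs_mul_le_of_abs_le_one (abs_mul_le_of_abs_le_one (abs_mul_le_of_abs_le_one
      (d'b x hx hx1) (sle j x)) (sle j x)) (sle o x)
    have e3 := abs_mul_le_of_abs_le_one (abs_mul_le_of_abs_le_one (db x hx hx1) (sle j x))
      (δle j)
    have e4 := abs_mul_le_of_abs_le_one (db x hx hx1) (sle o x)
    have e5 := abs_mul_le_of_abs_le_one (abs_mul_le_of_abs_le_one (abs_mul_le_of_abs_le_one
      (db x hx hx1) (sle j x)) (sle j x)) (sle o x)
    simp only [D]
    rw [abs_mul, abs_inv, abs_norm, ← rmul x hx, mul_left_comm (_ + _ : ℝ)]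
    refine mul_le_mul_of_nonneg_left ?_ (inv_nonneg.2 (norm_nonneg _))
    rw [abs_le] at e1 e2 e3 e4 e5 ⊢
    constructor <;> nlinarith [e1.1, e1.2, e2.1, e2.2, e3.1, e3.2, e4.1, e4.2, e5.1, e5.2]
  -- The divergence of the flux is `θ₁/|x|` times `(n-1) d - v' - d'`, which the system makes zero.
  have Dsum : ∀ x, x ≠ 0 → ∑ j, D j x = 0 := fun x hx => by
    have e1 : ∑ j, s j x ^ 2 = 1 := sum_sq_coord_div_norm hx
    have e2 : ∑ j, s j x * δ j = s o x := by simp [δ]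
    have e3 : ∀ j, D j x = ‖x‖⁻¹ * ((d (l x) - v' (l x)) * (s j x * δ j) -
        (d' (l x) + 2 * d (l x)) * s o x * s j x ^ 2 + d (l x) * s o x) := fun j => by
      simp only [D]
      ring
    simp_rw [e3]
    rw [← Finset.mul_sum, Finset.sum_add_distrib, Finset.sum_sub_distrib, ← Finset.mul_sum,
      ← Finset.mul_sum, e1, e2]
    simp [v', d']
    right
    ring
  refine ⟨u, ⟨G, ⟨?_, ?_, ?_⟩, ?_⟩, ?_, ?_⟩
  · refine locallySquareIntegrableOn_of_singular_bound hn1 hΩ1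
      (aestronglyMeasurable_of_continuousOn_compl_zero hn1 fun x hx =>
        ((GD o x hx).1.continuousAt.continuousWithinAt)) (by linarith) ub'
  · refine locallySquareIntegrableOn_of_singular_bound (C := n * 4) hn1 hΩ1
      (aestronglyMeasurable_of_continuousOn_compl_zero hn1 ?_) (by linarith) fun x hx hx1 => ?_
    · exact (PiLp.continuous_toLp 2 _).comp_continuousOn (continuousOn_pi.2 Gc)
    · rw [EuclideanSpace.norm_eq]
      refine Real.sqrt_le_iff.2 ⟨by have := rnn x; positivity, ?_⟩
      calc ∑ i, ‖G x i‖ ^ 2 ≤ ∑ i : Fin n, (4 * ‖x‖ ^ (-H)) ^ 2 :=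
            Finset.sum_le_sum fun i _ => by
              have := Gb i x hx hx1
              rw [Real.norm_eq_abs]
              gcongr
        _ = n * (4 * ‖x‖ ^ (-H)) ^ 2 := by simp
        _ ≤ n * 4 * ‖x‖ ^ (-H) * (n * 4 * ‖x‖ ^ (-H)) := by
          have : 0 ≤ (‖x‖ ^ (-H)) ^ 2 := by positivity
          nlinarith
        _ = _ := by ring
  · intro φ hφ i
    have hφ' : IsTestFunction (ball 0 1) φ := ⟨hφ.1, hφ.2.1, hφ.2.2.trans hΩ1⟩
    have key := (integral_mul_partialDeriv_of_singular hn1 (i := i) (α := H) (C := 4)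
      (fun x hx => (GD i x hx).1)
      (fun x hx => (GD i x hx).2) (Gc i) (by linarith)
      (fun x hx hx1 => (ub' x hx hx1).trans (by nlinarith [rnn x]))
      (fun x hx hx1 => (Gb i x hx hx1).trans (by nlinarith [rle x hx hx1])) hφ').2.2
    rw [setIntegral_eq_integral_of_forall_compl_eq_zero fun x hx => ?_,
      setIntegral_eq_integral_of_forall_compl_eq_zero fun x hx => ?_]
    · exact key
    · rw [image_eq_zero_of_notMem_tsupport fun h => hx (hφ.2.2 h), mul_zero]
    · have : x ∉ tsupport (fun x => fderiv ℝ φ x (EuclideanSpace.single i 1)) := fun h =>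
        hx (hφ.2.2 (tsupport_fderiv_apply_subset ℝ _ h))
      have : partialDeriv i φ x = 0 := image_eq_zero_of_notMem_tsupport this
      rw [this, mul_zero]
  · intro φ hφ
    have hφ' : IsTestFunction (ball 0 1) φ := ⟨hφ.1, hφ.2.1, hφ.2.2.trans hΩ1⟩
    have p0 : ∀ j x, x ∉ Ω → partialDeriv j φ x = 0 := fun j x hx => by
      have : x ∉ tsupport (fun x => fderiv ℝ φ x (EuclideanSpace.single j 1)) := fun h =>
        hx (hφ.2.2 (tsupport_fderiv_apply_subset ℝ _ h))
      exact image_eq_zero_of_notMem_tsupport this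
    choose! L hL hLe using ΦD
    have key := fun j => integral_mul_partialDeriv_of_singular hn1 (i := j) (α := H)
      (C := n + 9) (hL j) (hLe j) (Dc j) (by linarith)
      (fun x hx hx1 => (Φb j x hx hx1).trans (by nlinarith [rnn x]))
      (Db j) hφ'
    rw [setIntegral_eq_integral_of_forall_compl_eq_zero fun x hx => by simp [p0 _ x hx]]
    have e : (fun x => ∑ i, ∑ j, gilbargSerrinCoeff g i j x * G x i * partialDeriv j φ x) =ᵐ[volume]
        fun x => ∑ j, Φ j x * partialDeriv j φ x := by
      filter_upwards [ae0] with x hx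
      by_cases hxΩ : x ∈ Ω
      · rw [Finset.sum_comm]
        refine Finset.sum_congr rfl fun j _ => ?_
        rw [← Finset.sum_mul]
        congr 1
        have e1 : ∑ j, s j x ^ 2 = 1 := sum_sq_coord_div_norm hx
        have e2 : ∑ j, s j x * δ j = s o x := by simp [δ]
        have e3 := hgh x hxΩ hx
        have e4 : ∀ i, gilbargSerrinCoeff g i j x * G x i =
            (if i = j then 1 else 0) * (δ i * v (l x) - v' (l x) * s o x * s i x) +
              g ‖x‖ * s j x * v (l x) * (s i x * δ i) -
                g ‖x‖ * s j x * v' (l x) * s o x * s i x ^ 2 := fun i => by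
          simp only [gilbargSerrinCoeff, G, s]
          ring
        simp_rw [e4]
        rw [Finset.sum_sub_distrib, Finset.sum_add_distrib, ← Finset.mul_sum, ← Finset.mul_sum, e1,
          e2]
        simp only [ite_mul, one_mul, zero_mul, Finset.sum_ite_eq', Finset.mem_univ, if_true]
        have e5 : d (l x) * x o * x j * (‖x‖ ^ 2)⁻¹ = d (l x) * s o x * s j x := by
          have := norm_ne_zero_iff.2 hx
          simp only [s]
          field_simp
        simp only [Φ, e5]
        -- This is the relation `d = g v - (1+g) v'`, obtained from `h (1+g) = g` without dividing.
        have e6 : v' (l x) * (1 + g ‖x‖) = g ‖x‖ * v (l x) - d (l x) := by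
          simp only [v', l]
          linear_combination (v (-Real.log ‖x‖) + d (-Real.log ‖x‖)) * e3
        linear_combination (- s o x * s j x) * e6
      · simp [p0 _ x hxΩ]
    rw [integral_congr_ae e, integral_finsetSum _ fun j _ => (key j).1]
    simp_rw [(key _).2.2]
    rw [Finset.sum_neg_distrib, ← integral_finsetSum _ fun j _ => (key j).2.1, neg_eq_zero]
    refine integral_eq_zero_of_ae ?_
    filter_upwards [ae0] with x hx
    rw [← Finset.sum_mul, Dsum x hx, zero_mul]
    rfl
  · intro x hx
    by_cases hx0 : x = 0
    · subst hx0
      have u0 : u 0 = 0 := by simp [u]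
      refine ContinuousAt.continuousWithinAt ?_
      rw [ContinuousAt, u0]
      refine squeeze_zero_norm' (a := fun x => ‖x‖ ^ (1 - H)) ?_ ?_
      · filter_upwards [ball_mem_nhds (0 : EuclideanSpace ℝ (Fin n)) one_pos] with x hx
        by_cases hx0 : x = 0
        · subst hx0
          rw [u0, norm_zero]
          positivity
        · refine (ub x hx0 (by simpa using hx)).trans_eq ?_
          rw [sub_eq_add_neg, Real.rpow_add (norm_pos_iff.2 hx0), Real.rpow_one]
      · have : ContinuousAt (fun x : EuclideanSpace ℝ (Fin n) => ‖x‖ ^ (1 - H)) 0 :=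
          continuous_norm.continuousAt.rpow_const (Or.inr (by linarith))
        have h := this.tendsto
        simp only [norm_zero] at h
        rwa [Real.zero_rpow (by linarith)] at h
    · exact (GD o x hx0).1.continuousAt.continuousWithinAt
  · rintro ⟨c, ρ, hρ, hcl⟩
    -- Along the points `exp(-t) e₁` the quotient `u(x)/|x|` equals `v t`, which exceeds any
    -- proposed constant.
    have : ∀ᶠ t in atTop, c + 1 ≤ v t ∧ Real.exp (-t) < ρ := by
      refine (htop.eventually_ge_atTop _).and ?_
      have : Tendsto (fun t : ℝ => Real.exp (-t)) atTop (𝓝 0) :=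
        Real.tendsto_exp_neg_atTop_nhds_zero
      exact this.eventually (gt_mem_nhds hρ)
    obtain ⟨t, ht1, ht2⟩ := this.exists
    have hp := Real.exp_pos (-t)
    have hnorm : ‖(EuclideanSpace.single o (Real.exp (-t)) : EuclideanSpace ℝ (Fin n))‖ =
        Real.exp (-t) := by
      rw [PiLp.norm_single, Real.norm_eq_abs, abs_of_pos hp]
    have h2 := hcl (EuclideanSpace.single o (Real.exp (-t))) (by
      rw [mem_ball_zero_iff, hnorm]; exact ht2)
    have h3 : u (EuclideanSpace.single o (Real.exp (-t))) = Real.exp (-t) * v t := by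
      simp only [u, l]
      rw [hnorm]
      simp
    have u0 : u 0 = 0 := by simp [u]
    rw [u0, sub_zero, h3, hnorm] at h2
    have := le_abs_self (Real.exp (-t) * v t)
    nlinarith

/-! ### Failure of Dini mean oscillation for `γ ≤ 1` -/

theorem logPow_nonneg (γ r : ℝ) : 0 ≤ logPow γ r := Real.rpow_nonneg (abs_nonneg _) _

theorem logPow_mono {γ : ℝ} (hγ : 0 < γ) {s r : ℝ} (hs : 0 ≤ s) (hsr : s ≤ r) (hr : r < 1) :
    logPow γ s ≤ logPow γ r := by
  rcases hs.eq_or_lt with rfl | hs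
  · simp only [logPow, Real.log_zero, abs_zero, Real.zero_rpow (neg_ne_zero.2 hγ.ne')]
    exact Real.rpow_nonneg (abs_nonneg _) _
  · have h1 : Real.log s ≤ Real.log r := Real.log_le_log hs hsr
    have h2 : Real.log r < 0 := Real.log_neg (hs.trans_le hsr) hr
    refine Real.rpow_le_rpow_of_nonpos (abs_pos.2 h2.ne) ?_ (by linarith)
    rw [abs_of_neg h2, abs_of_neg (h1.trans_lt h2)]
    linarith

theorem measurable_gilbargSerrinCoeff {n : ℕ} {g : ℝ → ℝ} (hg : Measurable g) (i j : Fin n) :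
    Measurable (gilbargSerrinCoeff g i j) := by
  unfold gilbargSerrinCoeff
  have h : ∀ k : Fin n, Measurable fun x : EuclideanSpace ℝ (Fin n) => x k := fun k =>
    (by fun_prop : Continuous fun x : EuclideanSpace ℝ (Fin n) => x k).measurable
  exact measurable_const.add (((hg.comp measurable_norm).mul ((h i).div measurable_norm)).mul
    ((h j).div measurable_norm))

theorem measurable_logPow (γ : ℝ) : Measurable (logPow γ) := by
  unfold logPow
  have : Measurable fun r => |Real.log r| := Real.measurable_log.norm
  exact this.pow_const _

/-- The reflection changing the sign of `x i` preserves the ball and the measure and reverses the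
sign of the coefficient. -/
theorem setIntegral_ball_gilbargSerrinCoeff_eq_zero {n : ℕ} {g : ℝ → ℝ} {i j : Fin n}
    (hij : i ≠ j) (r : ℝ) :
    ∫ x in ball (0 : EuclideanSpace ℝ (Fin n)) r, gilbargSerrinCoeff g i j x = 0 := by
  let e : EuclideanSpace ℝ (Fin n) ≃ₗᵢ[ℝ] EuclideanSpace ℝ (Fin n) :=
    LinearIsometryEquiv.piLpCongrRight 2 fun k =>
      if k = i then LinearIsometryEquiv.neg ℝ else LinearIsometryEquiv.refl ℝ ℝ
  have h1 := e.measurePreserving.setIntegral_preimage_emb e.toHomeomorph.measurableEmbedding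
    (gilbargSerrinCoeff g i j) (ball 0 r)
  have h2 : e ⁻¹' ball 0 r = ball 0 r := by
    ext x
    simp
  have h3 : ∀ x, gilbargSerrinCoeff g i j (e x) = -gilbargSerrinCoeff g i j x := fun x => by
    have e1 : e x i = - x i := by simp [e]
    have e2 : e x j = x j := by simp [e, hij.symm]
    simp only [gilbargSerrinCoeff, e1, e2, e.norm_map, if_neg hij]
    ring
  rw [h2] at h1
  simp_rw [h3] at h1
  rw [integral_neg] at h1
  linarith

theorem norm_gilbargSerrinCoeff_offDiag_le {n : ℕ} {g : ℝ → ℝ} {i j : Fin n} (hij : i ≠ j)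
    (x : EuclideanSpace ℝ (Fin n)) : ‖gilbargSerrinCoeff g i j x‖ ≤ |g ‖x‖| := by
  simp only [gilbargSerrinCoeff, if_neg hij, zero_add]
  exact abs_mul_le_of_abs_le_one (abs_mul_le_of_abs_le_one le_rfl (abs_coord_div_norm_le_one i x))
    (abs_coord_div_norm_le_one j x)

theorem le_average_abs_gilbargSerrinCoeff {n : ℕ} {γ : ℝ} (hγ : 0 < γ) {i j : Fin n}
    (hij : i ≠ j) {r : ℝ} (hr : 0 < r) (hr1 : r < 1) :
    logPow γ (r / 6) * (1 / 36) * (1 / 6) ^ n ≤ ⨍ y in ball (0 : EuclideanSpace ℝ (Fin n)) r,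
      |gilbargSerrinCoeff (logPow γ) i j y| := by
  have : Nonempty (Fin n) := ⟨i⟩
  -- On the ball of radius `r/6` about `q`, both coordinates are at least `r/6`, so `x i/|x|` and `x
  -- j/|x|` exceed `1/6` and `logPow γ |x|` is at least its value at `r/6`. That ball fills the
  -- fraction `(1/6)^n` of the large one.
  let q : EuclideanSpace ℝ (Fin n) := EuclideanSpace.single i (r / 3) +
    EuclideanSpace.single j (r / 3)
  have qi : q i = r / 3 := by simp [q, hij]
  have qj : q j = r / 3 := by simp [q, hij.symm]
  have qn : ‖q‖ ≤ 2 * r / 3 := by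
    refine (norm_add_le _ _).trans ?_
    rw [PiLp.norm_single, PiLp.norm_single, Real.norm_eq_abs, abs_of_pos (by linarith)]
    linarith
  have sub : ball q (r / 6) ⊆ ball 0 r := by
    refine ball_subset_ball' ?_
    rw [dist_zero_right]
    linarith
  have int : IntegrableOn (fun y => |gilbargSerrinCoeff (logPow γ) i j y|)
      (ball (0 : EuclideanSpace ℝ (Fin n)) r) := by
    refine Integrable.abs ?_
    refine Measure.integrableOn_of_bounded (M := logPow γ r) measure_ball_lt_top.ne
      (measurable_gilbargSerrinCoeff (measurable_logPow γ) i j).aestronglyMeasurable ?_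
    rw [ae_restrict_iff' measurableSet_ball]
    refine ae_of_all _ fun x hx => ?_
    refine (norm_gilbargSerrinCoeff_offDiag_le hij x).trans ?_
    rw [abs_of_nonneg (logPow_nonneg _ _)]
    exact logPow_mono hγ (norm_nonneg _) (mem_ball_zero_iff.1 hx).le hr1
  have low : ∀ x ∈ ball q (r / 6), logPow γ (r / 6) * (1 / 36) ≤
      |gilbargSerrinCoeff (logPow γ) i j x| := fun x hx => by
    have hxr : ‖x‖ < r := mem_ball_zero_iff.1 (sub hx)
    have coord : ∀ k, q k = r / 3 → r / 6 ≤ x k := fun k hk => by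
      have h1 : |(x - q) k| ≤ ‖x - q‖ := by simpa using PiLp.norm_apply_le (x - q) k
      have h2 : ‖x - q‖ < r / 6 := by simpa [dist_eq_norm] using hx
      have h3 : (x - q) k = x k - r / 3 := by simp [hk]
      rw [h3] at h1
      have := (abs_le.1 h1).1
      linarith
    have c1 := coord i qi
    have c2 := coord j qj
    have hx6 : r / 6 ≤ ‖x‖ := c1.trans ((le_abs_self _).trans (by
      simpa using PiLp.norm_apply_le x i))
    have hx0 : 0 < ‖x‖ := by linarith
    have k1 : 1 / 6 ≤ x i / ‖x‖ := by
      rw [le_div_iff₀ hx0]; linarith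
    have k2 : 1 / 6 ≤ x j / ‖x‖ := by
      rw [le_div_iff₀ hx0]; linarith
    have k3 := logPow_mono hγ (by linarith) hx6 (hxr.trans hr1)
    have k0 := logPow_nonneg γ (r / 6)
    have k4 := logPow_nonneg γ ‖x‖
    have k5 : 0 ≤ x i / ‖x‖ := k1.trans' (by norm_num)
    refine le_trans ?_ (le_abs_self _)
    simp only [gilbargSerrinCoeff, if_neg hij, zero_add]
    calc logPow γ (r / 6) * (1 / 36) = logPow γ (r / 6) * (1 / 6) * (1 / 6) := by ring
      _ ≤ _ := by gcongr
  have vol : volume.real (ball q (r / 6)) =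
      (1 / 6) ^ n * volume.real (ball (0 : EuclideanSpace ℝ (Fin n)) r) := by
    rw [Measure.real, Measure.real, show r / 6 = 1 / 6 * r by ring,
      Measure.addHaar_ball_mul _ _ (by norm_num), ENNReal.toReal_mul,
      ENNReal.toReal_ofReal (by positivity)]
    simp
  have vpos : 0 < volume.real (ball (0 : EuclideanSpace ℝ (Fin n)) r) :=
    ENNReal.toReal_pos (measure_ball_pos _ _ hr).ne' measure_ball_lt_top.ne
  rw [setAverage_eq, smul_eq_mul, ← div_eq_inv_mul, le_div_iff₀ vpos]
  calc logPow γ (r / 6) * (1 / 36) * (1 / 6) ^ n *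
        volume.real (ball (0 : EuclideanSpace ℝ (Fin n)) r)
      = ∫ y in ball q (r / 6), logPow γ (r / 6) * (1 / 36) := by
        rw [setIntegral_const, vol, smul_eq_mul]
        ring
    _ ≤ ∫ y in ball q (r / 6), |gilbargSerrinCoeff (logPow γ) i j y| :=
        setIntegral_mono_on (integrableOn_const measure_ball_lt_top.ne) (int.mono_set sub) measurableSet_ball low
    _ ≤ _ := setIntegral_mono_set int (ae_of_all _ fun _ => abs_nonneg _)
        (Eventually.of_forall sub)

/-- Compare with `log (-log (r/6))`, which tends to infinity at 0. Its derivative has absolute value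
`1/(r (-log (r/6)))`, and `γ ≤ 1` makes this at most `logPow γ (r/6) / r` once `-log (r/6) ≥ 1`. -/
theorem not_integrableOn_logPow_div {γ : ℝ} (hγ1 : γ ≤ 1) {ρ c : ℝ} (hρ : 0 < ρ)
    (hc : 0 < c) : ¬ IntegrableOn (fun r => c * logPow γ (r / 6) / r) (Ioo 0 ρ) := by
  have t0 : Tendsto (fun r : ℝ => r / 6) (𝓝[>] 0) (𝓝[>] 0) := by
    refine tendsto_nhdsWithin_iff.2 ⟨?_, ?_⟩
    · have : Tendsto (fun r : ℝ => r / 6) (𝓝 0) (𝓝 (0 / 6)) := tendsto_id.div_const 6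
      rw [zero_div] at this
      exact this.mono_left nhdsWithin_le_nhds
    · filter_upwards [self_mem_nhdsWithin] with r hr
      exact div_pos (mem_Ioi.1 hr) (by norm_num)
  have tl : Tendsto (fun r : ℝ => -Real.log (r / 6)) (𝓝[>] 0) atTop :=
    tendsto_neg_atBot_atTop.comp (Real.tendsto_log_nhdsGT_zero.comp t0)
  have ev : ∀ᶠ r : ℝ in 𝓝[>] 0, 0 < r ∧ 1 ≤ -Real.log (r / 6) :=
    (eventually_mem_nhdsWithin).and (tl.eventually_ge_atTop 1)
  have hd : ∀ r : ℝ, 0 < r → 1 ≤ -Real.log (r / 6) →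
      HasDerivAt (fun r => Real.log (-Real.log (r / 6))) (-(1 / 6 / (r / 6)) / -Real.log (r / 6)) r :=
    fun r hr h1 => ((((hasDerivAt_id r).div_const 6).log (by simp only [id]; positivity)).neg).log
      (show -Real.log (r / 6) ≠ 0 by linarith)
  refine not_integrableOn_of_tendsto_norm_atTop_of_deriv_isBigO_filter
    (f := fun r => Real.log (-Real.log (r / 6))) (𝓝[>] 0) (Ioo_mem_nhdsGT hρ) ?_ ?_ ?_
  · filter_upwards [ev] with r hr
    exact (hd r hr.1 hr.2).differentiableAt
  · exact tendsto_norm_atTop_atTop.comp (Real.tendsto_log_atTop.comp tl)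
  · refine Asymptotics.IsBigO.of_bound (1 / c) ?_
    filter_upwards [ev] with r ⟨hr, h1⟩
    rw [(hd r hr h1).deriv]
    have h2 : (-Real.log (r / 6))⁻¹ ≤ logPow γ (r / 6) := by
      rw [logPow, abs_of_nonpos (by linarith), ← Real.rpow_neg_one]
      exact Real.rpow_le_rpow_of_exponent_le h1 (by linarith)
    have h3 : -(1 / 6 / (r / 6)) / -Real.log (r / 6) = -(r⁻¹ * (-Real.log (r / 6))⁻¹) := by
      field_simp
    have h4 : 0 ≤ (-Real.log (r / 6))⁻¹ := inv_nonneg.2 (by linarith)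
    rw [h3, norm_neg, Real.norm_eq_abs, Real.norm_eq_abs, abs_of_nonneg (by positivity),
      abs_of_nonneg (by have := logPow_nonneg γ (r / 6); positivity)]
    calc r⁻¹ * (-Real.log (r / 6))⁻¹ ≤ r⁻¹ * logPow γ (r / 6) := by gcongr
      _ = _ := by field_simp

theorem not_hasDiniMeanOscillation_offDiag {n : ℕ} {Ω : Set (EuclideanSpace ℝ (Fin n))}
    (hΩ : IsOpen Ω) (h0 : (0 : EuclideanSpace ℝ (Fin n)) ∈ Ω) {γ : ℝ} (hγ : 0 < γ)
    (hγ1 : γ ≤ 1) {i j : Fin n} (hij : i ≠ j) :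
    ¬ HasDiniMeanOscillation Ω (gilbargSerrinCoeff (logPow γ) i j) := by
  intro hfin
  obtain ⟨ρ0, hρ0, hball⟩ := Metric.isOpen_iff.1 hΩ 0 h0
  let ρ := min ρ0 (1 / 2)
  have hρ : 0 < ρ := lt_min hρ0 (by norm_num)
  let c : ℝ := 1 / 36 * (1 / 6) ^ n
  have hc : 0 < c := by positivity
  refine not_integrableOn_logPow_div hγ1 hρ hc ?_
  have hmeas : Measurable fun r => c * logPow γ (r / 6) / r :=
    (((measurable_logPow γ).comp (measurable_id.div_const 6)).const_mul c).div measurable_id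
  refine ⟨hmeas.aestronglyMeasurable, ?_⟩
  rw [hasFiniteIntegral_iff_ofReal]
  · refine lt_of_le_of_lt ?_ hfin
    refine (setLIntegral_mono' measurableSet_Ioo fun r hr => ?_).trans
      (lintegral_mono_set (Ioo_subset_Ioo_right (min_le_right _ _)))
    rw [ENNReal.ofReal_div_of_pos hr.1]
    gcongr
    have hrΩ : ball (0 : EuclideanSpace ℝ (Fin n)) r ⊆ Ω :=
      (ball_subset_ball (hr.2.le.trans (min_le_left _ _))).trans hball
    refine le_trans ?_ (le_iSup₂ (f := fun (x : EuclideanSpace ℝ (Fin n)) (_ : ball x r ⊆ Ω) =>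
      ENNReal.ofReal (⨍ y in ball x r, |gilbargSerrinCoeff (logPow γ) i j y -
        ⨍ z in ball x r, gilbargSerrinCoeff (logPow γ) i j z|)) 0 hrΩ)
    refine ENNReal.ofReal_le_ofReal ?_
    have h1 : ⨍ z in ball (0 : EuclideanSpace ℝ (Fin n)) r,
        gilbargSerrinCoeff (logPow γ) i j z = 0 := by
      rw [setAverage_eq, setIntegral_ball_gilbargSerrinCoeff_eq_zero hij, smul_zero]
    simp only [h1, sub_zero]
    refine le_trans (le_of_eq ?_) (le_average_abs_gilbargSerrinCoeff hγ hij hr.1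
      ((hr.2.trans_le (min_le_right _ _)).trans (by norm_num)))
    simp only [c]
    ring
  · rw [EventuallyLE, ae_restrict_iff' measurableSet_Ioo]
    refine ae_of_all _ fun r hr => ?_
    have := logPow_nonneg γ (r / 6)
    have := hr.1
    simp only [Pi.zero_apply]
    positivity

/-! ### The non-Lipschitz solution for `γ ≤ 1` -/

theorem exists_not_isLipschitzAtZero {n : ℕ} (hn : 2 ≤ n) {Ω : Set (EuclideanSpace ℝ (Fin n))}
    (hΩ1 : closure Ω ⊆ ball (0 : EuclideanSpace ℝ (Fin n)) 1) {γ : ℝ} (hγ : 0 < γ)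
    (hγ1 : γ ≤ 1) :
    ∃ u : EuclideanSpace ℝ (Fin n) → ℝ,
      IsWeakSolution Ω (gilbargSerrinCoeff (logPow γ)) u ∧ ContinuousOn u Ω ∧
        ¬ IsLipschitzAtZero u := by
  obtain ⟨R, ⟨hR0, hR1⟩, hR⟩ := exists_pos_lt_subset_ball one_pos isClosed_closure hΩ1
  let t0 := -Real.log R
  have ht0 : 0 < t0 := neg_pos.2 (Real.log_neg hR0 hR1)
  -- This is `g` in the variable `t`, frozen for `t < t0` to avoid the blow-up of `|log r|^(-γ)` at
  -- `r = 1`. Points of the domain satisfy `|x| < R`, that is `t > t0`, so nothing changes there,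
  -- and `h` becomes bounded by `h t0 < 1`.
  let k : ℝ → ℝ := fun t => (max t t0) ^ (-γ)
  have mpos : ∀ t, 0 < max t t0 := fun t => ht0.trans_le (le_max_right _ _)
  have kpos : ∀ t, 0 < k t := fun t => Real.rpow_pos_of_pos (mpos t) _
  have kc : Continuous k := (continuous_id.max continuous_const).rpow_const fun t =>
    Or.inl (mpos t).ne'
  have ka : Antitone k := fun s t hst =>
    Real.rpow_le_rpow_of_nonpos (mpos s) (max_le_max_right _ hst) (by linarith)
  let h : ℝ → ℝ := fun t => k t / (1 + k t)
  have hc : Continuous h := kc.div (continuous_const.add kc) fun t => by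
    have := kpos t
    positivity
  have hh : ∀ s t, k s ≤ k t → h s ≤ h t := fun s t hst => by
    have h1 := kpos s
    have h2 := kpos t
    simp only [h]
    rw [div_le_div_iff₀ (by positivity) (by positivity)]
    nlinarith
  have ha : Antitone h := fun s t hst => hh _ _ (ka hst)
  have hnn : ∀ t, 0 ≤ h t := fun t => by
    have := kpos t
    positivity
  have hlt : h t0 < 1 := by
    have := kpos t0
    simp only [h]
    rw [div_lt_one (by positivity)]
    linarith
  have hle : ∀ t, h t ≤ h t0 := fun t => hh _ _
    (Real.rpow_le_rpow_of_nonpos (mpos t0) (by simp) (by linarith))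
  -- Here `γ ≤ 1` enters: for `t ≥ 1` one has `1/t ≤ t^(-γ) ≤ 1`, and the denominator `1 + k t` is
  -- at most 2.
  have hlow : ∀ t, max 1 t0 ≤ t → (1 / 2) / t ≤ h t := fun t ht => by
    have h1 : 1 ≤ t := (le_max_left _ _).trans ht
    have h2 : max t t0 = t := max_eq_left ((le_max_right _ _).trans ht)
    have h3 : t⁻¹ ≤ k t := by
      simp only [k, h2]
      rw [← Real.rpow_neg_one]
      exact Real.rpow_le_rpow_of_exponent_le h1 (by linarith)
    have h4 : k t ≤ 1 := by
      simp only [k, h2]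
      exact Real.rpow_le_one_of_one_le_of_nonpos h1 (by linarith)
    have h5 := kpos t
    calc (1 / 2) / t = t⁻¹ / 2 := by field_simp
      _ ≤ k t / 2 := by gcongr
      _ ≤ k t / (1 + k t) := by gcongr; linarith
  have hnR : (2 : ℝ) ≤ n := by exact_mod_cast hn
  obtain ⟨v, d, hv, hd, hb, htop⟩ := exists_slow_solution hnR hc ha hnn hlt hle
    (by norm_num : (0 : ℝ) < 1 / 2) (le_trans zero_le_one (le_max_left 1 t0)) hlow
  refine exists_weakSolution_of_profile hn (subset_closure.trans hΩ1) hlt hc hnn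
    (fun t => (hle t).trans hlt.le) hv hd hb htop fun x hx hx0 => ?_
  have hxR : ‖x‖ < R := mem_ball_zero_iff.1 (hR (subset_closure hx))
  have hxp : 0 < ‖x‖ := norm_pos_iff.2 hx0
  have h1 : t0 ≤ -Real.log ‖x‖ := neg_le_neg (Real.log_le_log hxp hxR.le)
  have h2 : k (-Real.log ‖x‖) = logPow γ ‖x‖ := by
    simp only [k, logPow]
    rw [max_eq_left h1, abs_of_nonpos (by linarith)]
  have h3 := kpos (-Real.log ‖x‖)
  simp only [h]
  rw [← h2]
  field_simp

/-! ### A radial kernel that telescopes over dyadic scales -/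

/-- The cutoff equals 1 for `s ≤ 1/4`, so the coefficient of the singular power vanishes identically
there. -/
theorem contDiff_smoothTransition_profile {p : ℝ} :
    ContDiff ℝ (⊤ : ℕ∞) fun s : ℝ => Real.smoothTransition ((1 - s) * (4 / 3)) +
      (1 - Real.smoothTransition ((1 - s) * (4 / 3))) * s ^ p := by
  have hP : ContDiff ℝ (⊤ : ℕ∞) fun s : ℝ => Real.smoothTransition ((1 - s) * (4 / 3)) :=
    Real.smoothTransition.contDiff.comp (by fun_prop)
  rw [contDiff_iff_contDiffAt]
  intro s
  by_cases hs : s < 1 / 4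
  · refine contDiffAt_const (c := (1 : ℝ)) |>.congr_of_eventuallyEq ?_
    filter_upwards [gt_mem_nhds hs] with x hx
    rw [Real.smoothTransition.one_of_one_le (by linarith)]
    ring
  · exact hP.contDiffAt.add ((contDiffAt_const.sub hP.contDiffAt).mul
      (Real.contDiffAt_rpow_const_of_ne (by linarith)))

/-- A radial profile `K` whose associated divergence telescopes over dyadic scales. -/
theorem exists_telescoping_profile {n : ℕ} (hn : 1 ≤ n) :
    ∃ (K η : ℝ → ℝ) (M : ℝ), ContDiff ℝ (⊤ : ℕ∞) K ∧ Continuous η ∧ (∀ s, 1 ≤ s → K s = 0) ∧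
      (∀ s, 1 ≤ s → η s = 0) ∧ (∀ s, 0 ≤ η s) ∧ (∀ s, s ≤ 1 / 4 → 1 ≤ η s) ∧
      (∀ s, n * K s + 2 * s * deriv K s = 2 ^ n * η (4 * s) - η s) ∧
      ∀ s, 0 ≤ s → |K s| ≤ M ∧ |deriv K s| ≤ M ∧ |η s| ≤ M := by
  let p : ℝ := -(n / 2)
  have hp : p ≤ 0 := by
    have : (0 : ℝ) ≤ n := Nat.cast_nonneg n
    simp only [p]
    linarith
  let P : ℝ → ℝ := fun s => Real.smoothTransition ((1 - s) * (4 / 3))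
  have Ps : ContDiff ℝ (⊤ : ℕ∞) P := Real.smoothTransition.contDiff.comp (by fun_prop)
  have Pd : Differentiable ℝ P := Ps.differentiable (by simp)
  have P0 : ∀ s, 1 ≤ s → P s = 0 := fun s hs =>
    Real.smoothTransition.zero_of_nonpos (by linarith)
  have Pnn : ∀ s, 0 ≤ P s := fun s => Real.smoothTransition.nonneg _
  have Panti : Antitone P := fun s t hst => Real.smoothTransition.monotone (by linarith)
  -- The vector field `F(|x|²) x` has divergence `η(|x|²)`. For `s ≥ 1`, `F s = s^(-n/2)` gives the
  -- field `x/|x|^n`, divergence free off the origin; hence `η` is supported in `s ≤ 1`.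
  let F : ℝ → ℝ := fun s => P s + (1 - P s) * s ^ p
  have Fs : ContDiff ℝ (⊤ : ℕ∞) F := contDiff_smoothTransition_profile
  have Fd : Differentiable ℝ F := Fs.differentiable (by simp)
  let η : ℝ → ℝ := fun s => n * F s + 2 * s * deriv F s
  have F1 : ∀ s, 1 ≤ s → F s = s ^ p := fun s hs => by simp [F, P0 s hs]
  have Fone : ∀ s, s ≤ 1 / 4 → F s = 1 := fun s hs => by
    have : P s = 1 := Real.smoothTransition.one_of_one_le (by linarith)
    simp [F, this]
  have ηpos : ∀ s, 0 < s → η s = n * P s + 2 * s * deriv P s * (1 - s ^ p) := fun s hs => by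
    have h1 : HasDerivAt F (deriv P s + (-deriv P s * s ^ p + (1 - P s) * (p * s ^ (p - 1)))) s :=
      (Pd s).hasDerivAt.add (((Pd s).hasDerivAt.const_sub 1).mul
        (Real.hasDerivAt_rpow_const (Or.inl hs.ne')))
    have h2 : s * s ^ (p - 1) = s ^ p := by
      rw [Real.rpow_sub_one hs.ne']
      field_simp
    simp only [η, h1.deriv, F]
    have h3 : 2 * p = -n := by simp only [p]; ring
    linear_combination (1 - P s) * s ^ p * h3 + 2 * p * (1 - P s) * h2
  have ηsmall : ∀ s, s < 1 / 4 → η s = n := fun s hs => by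
    have h1 : deriv F s = 0 := by
      have : F =ᶠ[𝓝 s] fun _ => 1 := by
        filter_upwards [gt_mem_nhds hs] with x hx using Fone x hx.le
      rw [this.deriv_eq, deriv_const]
    simp [η, h1, Fone s hs.le]
  have P'le : ∀ s, deriv P s ≤ 0 := fun s => Panti.deriv_nonpos
  have η0 : ∀ s, 1 ≤ s → η s = 0 := fun s hs => by
    rw [ηpos s (by linarith), P0 s hs]
    rcases hs.eq_or_lt with rfl | hs
    · simp
    · have h1 : deriv P s = 0 := by
        have : P =ᶠ[𝓝 s] fun _ => 0 := by
          filter_upwards [lt_mem_nhds hs] with x hx using P0 x hx.le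
        rw [this.deriv_eq, deriv_const]
      simp [h1]
  -- For `s < 1` the extra term is a product of two nonpositive factors: `P` decreases and `s^p ≥
  -- 1`.
  have ηge : ∀ s, n * P s ≤ η s := fun s => by
    rcases lt_or_ge s (1 / 4) with hs | hs
    · rw [ηsmall s hs]
      exact mul_le_of_le_one_right (Nat.cast_nonneg n) (Real.smoothTransition.le_one _)
    · rcases lt_or_ge s 1 with hs1 | hs1
      · rw [ηpos s (by linarith)]
        have h1 : 1 ≤ s ^ p := Real.one_le_rpow_of_pos_of_le_one_of_nonpos (by linarith) hs1.le hp
        have h2 := P'le s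
        have : 0 ≤ 2 * s * (deriv P s * (1 - s ^ p)) :=
          mul_nonneg (by linarith) (mul_nonneg_of_nonpos_of_nonpos h2 (by linarith))
        linarith
      · rw [η0 s hs1, P0 s hs1, mul_zero]
  have dFs : Continuous (deriv F) := Fs.continuous_deriv (by simp)
  have ηc : Continuous η := by
    have := Fs.continuous
    fun_prop
  -- Difference of the field at two consecutive scales. Homogeneity of `F` of degree `-n/2` beyond 1
  -- makes `2^n F(4s)` and `F s` cancel, so `K` has bounded support although `F` does not.
  let K : ℝ → ℝ := fun s => 2 ^ n * F (4 * s) - F s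
  have Ks : ContDiff ℝ (⊤ : ℕ∞) K := by fun_prop
  have K0 : ∀ s, 1 ≤ s → K s = 0 := fun s hs => by
    have h1 : (4 : ℝ) ^ p = (2 ^ n)⁻¹ := by
      rw [show (4 : ℝ) = 2 ^ (2 : ℝ) by norm_num, ← Real.rpow_mul (by norm_num),
        show 2 * p = -n by simp only [p]; ring, Real.rpow_neg (by norm_num), Real.rpow_natCast]
    simp only [K]
    rw [F1 s hs, F1 (4 * s) (by linarith), Real.mul_rpow (by norm_num) (by linarith), h1]
    field_simp
    ring
  have K'eq : ∀ s, deriv K s = 2 ^ n * (deriv F (4 * s) * 4) - deriv F s := fun s => by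
    have h1 : HasDerivAt (fun s => F (4 * s)) (deriv F (4 * s) * (4 * 1)) s :=
      (Fd (4 * s)).hasDerivAt.comp s ((hasDerivAt_id s).const_mul 4)
    rw [mul_one] at h1
    exact ((h1.const_mul _).sub (Fd s).hasDerivAt).deriv
  have bdd : ∀ f : ℝ → ℝ, Continuous f → (∀ s, 1 < s → f s = 0) →
      ∃ M, ∀ s, 0 ≤ s → |f s| ≤ M := fun f hf h0 => by
    obtain ⟨M, hM⟩ := (isCompact_Icc (a := (0 : ℝ)) (b := 1)).exists_bound_of_continuousOn
      hf.continuousOn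
    refine ⟨M, fun s hs => ?_⟩
    rcases le_or_gt s 1 with hs1 | hs1
    · exact hM s ⟨hs, hs1⟩
    · rw [h0 s hs1, abs_zero]
      exact (norm_nonneg _).trans (hM 0 ⟨le_rfl, zero_le_one⟩)
  obtain ⟨M1, hM1⟩ := bdd K Ks.continuous fun s hs => K0 s hs.le
  obtain ⟨M2, hM2⟩ := bdd (deriv K) (Ks.continuous_deriv (by simp)) fun s hs => by
    have : K =ᶠ[𝓝 s] fun _ => 0 := by
      filter_upwards [lt_mem_nhds hs] with x hx using K0 x hx.le
    rw [this.deriv_eq, deriv_const]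
  obtain ⟨M3, hM3⟩ := bdd η ηc fun s hs => η0 s hs.le
  refine ⟨K, η, max M1 (max M2 M3), Ks, ηc, K0, η0, fun s => ?_, fun s hs => ?_, fun s => ?_,
    fun s hs => ⟨(hM1 s hs).trans (le_max_left _ _),
      (hM2 s hs).trans ((le_max_left _ _).trans (le_max_right _ _)),
      (hM3 s hs).trans ((le_max_right _ _).trans (le_max_right _ _))⟩⟩
  · exact (mul_nonneg (Nat.cast_nonneg n) (Pnn s)).trans (ηge s)
  · have : P s = 1 := Real.smoothTransition.one_of_one_le (by linarith)
    have h1 := ηge s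
    have h2 : (1 : ℝ) ≤ n := by exact_mod_cast hn
    rw [this] at h1
    linarith
  · simp only [η, K'eq, K]
    ring

/-! ### Frozen inverse matrices and kernel test functions -/

/-- `B` inverts the symmetric positive matrix `a`, with quadratic form comparable to the
squared norm. -/
structure IsFrozenInverse {n : ℕ} (a : Fin n → Fin n → ℝ)
    (B : EuclideanSpace ℝ (Fin n) →L[ℝ] EuclideanSpace ℝ (Fin n)) (S : ℝ) : Prop where
  symm : ∀ z w, inner ℝ (B z) w = inner ℝ z (B w)
  quad_le : ∀ z, inner ℝ z (B z) ≤ ‖z‖ ^ 2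
  le_quad : ∀ z, ‖z‖ ^ 2 ≤ S ^ 2 * inner ℝ z (B z)
  norm_le : ∀ z, ‖B z‖ ≤ ‖z‖
  mul_eq : ∀ z i, ∑ j, a i j * B z j = z i

theorem IsFrozenInverse.quad_nonneg {n : ℕ} {a : Fin n → Fin n → ℝ}
    {B : EuclideanSpace ℝ (Fin n) →L[ℝ] EuclideanSpace ℝ (Fin n)} {S : ℝ} (hS : 0 < S)
    (hB : IsFrozenInverse a B S) (z : EuclideanSpace ℝ (Fin n)) : 0 ≤ inner ℝ z (B z) := by
  have h1 := hB.le_quad z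
  have h2 : 0 < S ^ 2 := by positivity
  by_contra! h
  nlinarith [sq_nonneg ‖z‖]

/-- The function `κ(⟨z, Bz⟩) ℓ(z)` of `z = t (x - y)`. -/
noncomputable def kernelTest {n : ℕ} (κ : ℝ → ℝ)
    (B : EuclideanSpace ℝ (Fin n) →L[ℝ] EuclideanSpace ℝ (Fin n))
    (l : EuclideanSpace ℝ (Fin n) →L[ℝ] ℝ) (t : ℝ) (y x : EuclideanSpace ℝ (Fin n)) : ℝ :=
  κ (inner ℝ (t • (x - y)) (B (t • (x - y)))) * l (t • (x - y))

/-- The purpose of `S`: the ellipsoid `⟨z, Bz⟩ ≤ 1` lies in the ball `‖z‖ ≤ S`, so every kernel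
supported in `s ≤ 1` lives in `closedBall y (S / t)`. -/
theorem IsFrozenInverse.one_le_quad {n : ℕ} {a : Fin n → Fin n → ℝ}
    {B : EuclideanSpace ℝ (Fin n) →L[ℝ] EuclideanSpace ℝ (Fin n)} {S : ℝ} (hS : 0 < S)
    (hB : IsFrozenInverse a B S) {t : ℝ} (ht : 0 < t) {x y : EuclideanSpace ℝ (Fin n)}
    (hx : x ∉ closedBall y (S / t)) : 1 < inner ℝ (t • (x - y)) (B (t • (x - y))) := by
  have h1 := hB.le_quad (t • (x - y))
  rw [mem_closedBall, dist_eq_norm, not_le, div_lt_iff₀ ht] at hx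
  rw [norm_smul, Real.norm_eq_abs, abs_of_pos ht] at h1
  by_contra! h
  have h2 : S ^ 2 < (t * ‖x - y‖) ^ 2 := by
    apply pow_lt_pow_left₀ (by linarith) hS.le two_ne_zero
  nlinarith [mul_le_mul_of_nonneg_left h (sq_nonneg S)]

theorem kernelTest_eq_zero {n : ℕ} {κ : ℝ → ℝ} (hκ0 : ∀ s, 1 ≤ s → κ s = 0)
    {a : Fin n → Fin n → ℝ}
    {B : EuclideanSpace ℝ (Fin n) →L[ℝ] EuclideanSpace ℝ (Fin n)} {S : ℝ} (hS : 0 < S)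
    (hB : IsFrozenInverse a B S) (l : EuclideanSpace ℝ (Fin n) →L[ℝ] ℝ) {t : ℝ} (ht : 0 < t)
    {x y : EuclideanSpace ℝ (Fin n)} (hx : x ∉ closedBall y (S / t)) :
    kernelTest κ B l t y x = 0 := by
  rw [kernelTest, hκ0 _ (hB.one_le_quad hS ht hx).le, zero_mul]

theorem tsupport_kernelTest_subset {n : ℕ} {κ : ℝ → ℝ} (hκ0 : ∀ s, 1 ≤ s → κ s = 0)
    {a : Fin n → Fin n → ℝ}
    {B : EuclideanSpace ℝ (Fin n) →L[ℝ] EuclideanSpace ℝ (Fin n)} {S : ℝ} (hS : 0 < S)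
    (hB : IsFrozenInverse a B S) (l : EuclideanSpace ℝ (Fin n) →L[ℝ] ℝ) {t : ℝ} (ht : 0 < t)
    (y : EuclideanSpace ℝ (Fin n)) :
    tsupport (kernelTest κ B l t y) ⊆ closedBall y (S / t) := by
  refine closure_minimal (fun x hx => ?_) isClosed_closedBall
  by_contra h
  exact hx (kernelTest_eq_zero hκ0 hS hB l ht h)

theorem isTestFunction_kernelTest {n : ℕ} {κ : ℝ → ℝ} (hκ : ContDiff ℝ (⊤ : ℕ∞) κ)
    (hκ0 : ∀ s, 1 ≤ s → κ s = 0) {a : Fin n → Fin n → ℝ}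
    {B : EuclideanSpace ℝ (Fin n) →L[ℝ] EuclideanSpace ℝ (Fin n)} {S : ℝ} (hS : 0 < S)
    (hB : IsFrozenInverse a B S) (l : EuclideanSpace ℝ (Fin n) →L[ℝ] ℝ) {t : ℝ} (ht : 0 < t)
    {y : EuclideanSpace ℝ (Fin n)} {Ω : Set (EuclideanSpace ℝ (Fin n))}
    (hy : closedBall y (S / t) ⊆ Ω) : IsTestFunction Ω (kernelTest κ B l t y) := by
  have hsub := tsupport_kernelTest_subset hκ0 hS hB l ht y
  refine ⟨?_, (isCompact_closedBall y (S / t)).of_isClosed_subset isClosed_closure hsub,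
    hsub.trans hy⟩
  unfold kernelTest
  have h1 : ContDiff ℝ (⊤ : ℕ∞) fun x : EuclideanSpace ℝ (Fin n) => t • (x - y) := by fun_prop
  exact (hκ.comp (h1.inner ℝ (B.contDiff.comp h1))).mul (l.contDiff.comp h1)

theorem partialDeriv_kernelTest {n : ℕ} {κ : ℝ → ℝ} (hκ : ContDiff ℝ (⊤ : ℕ∞) κ)
    {a : Fin n → Fin n → ℝ}
    {B : EuclideanSpace ℝ (Fin n) →L[ℝ] EuclideanSpace ℝ (Fin n)} {S : ℝ}
    (hB : IsFrozenInverse a B S) (l : EuclideanSpace ℝ (Fin n) →L[ℝ] ℝ) (t : ℝ)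
    (x y : EuclideanSpace ℝ (Fin n)) (j : Fin n) :
    partialDeriv j (kernelTest κ B l t y) x =
      t * (2 * deriv κ (inner ℝ (t • (x - y)) (B (t • (x - y)))) * B (t • (x - y)) j *
        l (t • (x - y)) + κ (inner ℝ (t • (x - y)) (B (t • (x - y)))) *
          l (EuclideanSpace.single j 1)) := by
  have h1 : HasFDerivAt (fun x : EuclideanSpace ℝ (Fin n) => t • (x - y))
      (t • ContinuousLinearMap.id ℝ (EuclideanSpace ℝ (Fin n))) x :=
    ((hasFDerivAt_id x).sub_const y).const_smul t
  have h2 := h1.inner ℝ (B.hasFDerivAt.comp x h1)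
  have h3 := (hκ.differentiable (by simp) (inner ℝ (t • (x - y))
    (B (t • (x - y))))).hasDerivAt.comp_hasFDerivAt x h2
  have h4 := h3.mul (l.hasFDerivAt.comp x h1)
  have h5 : HasFDerivAt (kernelTest κ B l t y) _ x := h4
  rw [partialDeriv, h5.fderiv]
  have e1 : inner ℝ (t • (x - y)) (B (t • EuclideanSpace.single j (1 : ℝ))) =
      t * B (t • (x - y)) j := by
    rw [← hB.symm, inner_smul_right, EuclideanSpace.inner_single_right]
    simp
  have e2 : inner ℝ (t • EuclideanSpace.single j (1 : ℝ)) (B (t • (x - y))) =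
      t * B (t • (x - y)) j := by
    rw [real_inner_smul_left, EuclideanSpace.inner_single_left]
    simp
  have e3 : l (t • EuclideanSpace.single j (1 : ℝ)) = t * l (EuclideanSpace.single j 1) := by
    rw [map_smul, smul_eq_mul]
  simp only [add_apply, smul_apply, ContinuousLinearMap.comp_apply, fderivInnerCLM_apply,
    ContinuousLinearMap.prod_apply, ContinuousLinearMap.id_apply, smul_eq_mul, Function.comp,
    e1, e2, e3]
  ring

/-! ### Kernel averages of the gradient at consecutive scales -/

theorem integrableOn_coord_mul_of_bounded {n : ℕ} {Ω : Set (EuclideanSpace ℝ (Fin n))}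
    {G : EuclideanSpace ℝ (Fin n) → EuclideanSpace ℝ (Fin n)}
    (hG : LocallySquareIntegrableOn Ω G) {K : Set (EuclideanSpace ℝ (Fin n))} (hK : IsCompact K)
    (hKΩ : K ⊆ Ω) {w : EuclideanSpace ℝ (Fin n) → ℝ} (hw : AEStronglyMeasurable w volume) {M : ℝ}
    (hM : ∀ x ∈ K, |w x| ≤ M) (h0 : ∀ x, x ∉ K → w x = 0) (i : Fin n) :
    IntegrableOn (fun x => G x i * w x) Ω := by
  have : Fact (volume K < ⊤) := ⟨hK.measure_lt_top⟩
  have h1 : IntegrableOn G K := (hG K hKΩ hK).integrable (by norm_num)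
  have h2 : IntegrableOn (fun x => G x i) K :=
    (EuclideanSpace.proj i : EuclideanSpace ℝ (Fin n) →L[ℝ] ℝ).integrable_comp h1
  have h3 : IntegrableOn (fun x => G x i * w x) K := by
    refine Integrable.mul_bdd (c := M) h2 hw.restrict ?_
    rw [ae_restrict_iff' hK.measurableSet]
    exact ae_of_all _ hM
  have h4 : Integrable (fun x => G x i * w x) := by
    rwa [← integrableOn_iff_integrable_of_support_subset (s := K)]
    intro x hx
    by_contra hxK
    exact hx (by simp [h0 x hxK])
  exact h4.integrableOn

theorem IsTestFunction.isTestFunction_partialDeriv {n : ℕ} {Ω : Set (EuclideanSpace ℝ (Fin n))}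
    {φ : EuclideanSpace ℝ (Fin n) → ℝ} (hφ : IsTestFunction Ω φ) (k : Fin n) :
    IsTestFunction Ω (partialDeriv k φ) := by
  refine ⟨?_, hφ.2.1.fderiv_apply (𝕜 := ℝ) _,
    (tsupport_fderiv_apply_subset ℝ _).trans hφ.2.2⟩
  exact (hφ.1.fderiv_right (m := (⊤ : ℕ∞)) (by simp)).clm_apply contDiff_const

theorem partialDeriv_comm {n : ℕ} {φ : EuclideanSpace ℝ (Fin n) → ℝ}
    (hφ : ContDiff ℝ (⊤ : ℕ∞) φ) (i k : Fin n) (x : EuclideanSpace ℝ (Fin n)) :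
    partialDeriv i (partialDeriv k φ) x = partialDeriv k (partialDeriv i φ) x := by
  have h1 : IsSymmSndFDerivAt ℝ φ x := hφ.contDiffAt.isSymmSndFDerivAt (by
    rw [minSmoothness_of_isRCLikeNormedField]
    exact WithTop.coe_le_coe.2 (le_top (a := (2 : ℕ∞))))
  have h2 : DifferentiableAt ℝ (fderiv ℝ φ) x :=
    ((hφ.fderiv_right (m := (⊤ : ℕ∞)) (by simp)).differentiable (by simp)) x
  have h3 : ∀ i k : Fin n, partialDeriv i (partialDeriv k φ) x =
      fderiv ℝ (fderiv ℝ φ) x (EuclideanSpace.single i 1) (EuclideanSpace.single k 1) :=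
    fun i k => by
      have : HasFDerivAt (partialDeriv k φ) _ x :=
        h2.hasFDerivAt.clm_apply (hasFDerivAt_const (EuclideanSpace.single k (1 : ℝ)) x)
      rw [partialDeriv, this.fderiv]
      simp
  rw [h3, h3]
  exact h1 _ _

/-- A weak gradient is curl free: test its definition with `∂_k ψ` and `∂_i ψ` and use that second
derivatives of `ψ` commute. -/
theorem HasWeakGradientOn.integral_swap {n : ℕ} {Ω : Set (EuclideanSpace ℝ (Fin n))}
    {u : EuclideanSpace ℝ (Fin n) → ℝ}
    {G : EuclideanSpace ℝ (Fin n) → EuclideanSpace ℝ (Fin n)} (hG : HasWeakGradientOn Ω u G)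
    {ψ : EuclideanSpace ℝ (Fin n) → ℝ} (hψ : IsTestFunction Ω ψ) (i k : Fin n) :
    ∫ x in Ω, G x i * partialDeriv k ψ x = ∫ x in Ω, G x k * partialDeriv i ψ x := by
  have h1 := hG.2.2 _ (hψ.isTestFunction_partialDeriv k) i
  have h2 := hG.2.2 _ (hψ.isTestFunction_partialDeriv i) k
  simp_rw [partialDeriv_comm hψ.1 i k] at h1
  linarith

theorem IsTestFunction.integrableOn_coord_mul_partialDeriv {n : ℕ}
    {Ω : Set (EuclideanSpace ℝ (Fin n))}
    {G : EuclideanSpace ℝ (Fin n) → EuclideanSpace ℝ (Fin n)}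
    (hG : LocallySquareIntegrableOn Ω G) {φ : EuclideanSpace ℝ (Fin n) → ℝ}
    (hφ : IsTestFunction Ω φ) (i k : Fin n) :
    IntegrableOn (fun x => G x i * partialDeriv k φ x) Ω := by
  have h := hφ.isTestFunction_partialDeriv k
  obtain ⟨M, hM⟩ := h.2.1.exists_bound_of_continuous h.1.continuous
  exact integrableOn_coord_mul_of_bounded hG h.2.1 h.2.2 h.1.continuous.aestronglyMeasurable
    (fun x _ => hM x) (fun x hx => image_eq_zero_of_notMem_tsupport hx) i

theorem IsFrozenInverse.comp_coord {n : ℕ} {a : Fin n → Fin n → ℝ}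
    {B : EuclideanSpace ℝ (Fin n) →L[ℝ] EuclideanSpace ℝ (Fin n)} {S : ℝ}
    (hB : IsFrozenInverse a B S) (j k : Fin n) :
    B (EuclideanSpace.single j 1) k = B (EuclideanSpace.single k 1) j := by
  have := hB.symm (EuclideanSpace.single j 1) (EuclideanSpace.single k 1)
  rw [EuclideanSpace.inner_single_right, EuclideanSpace.inner_single_left] at this
  simpa using this

theorem abs_partialDeriv_kernelTest_le {n : ℕ} {K : ℝ → ℝ} {M : ℝ}
    (hK : ContDiff ℝ (⊤ : ℕ∞) K) (hK0 : ∀ s, 1 ≤ s → K s = 0)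
    (hM : ∀ s, 0 ≤ s → |K s| ≤ M ∧ |deriv K s| ≤ M) {a0 : Fin n → Fin n → ℝ}
    {B : EuclideanSpace ℝ (Fin n) →L[ℝ] EuclideanSpace ℝ (Fin n)} {S : ℝ} (hS : 0 < S)
    (hB : IsFrozenInverse a0 B S) {t : ℝ} (ht : 0 < t) (x y : EuclideanSpace ℝ (Fin n))
    (j k : Fin n) :
    |partialDeriv j (kernelTest K B ((EuclideanSpace.proj k).comp B) t y) x| ≤
      t * (2 * M * S ^ 2 + M) := by
  have M0 : 0 ≤ M := (abs_nonneg _).trans (hM 0 le_rfl).1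
  by_cases hx : x ∈ closedBall y (S / t)
  · rw [partialDeriv_kernelTest hK hB, abs_mul, abs_of_pos ht]
    set z := t • (x - y) with hz
    have hzS : ‖z‖ ≤ S := by
      rw [hz, norm_smul, Real.norm_eq_abs, abs_of_pos ht, ← le_div_iff₀' ht, ← dist_eq_norm]
      exact hx
    have hQ := hM _ (hB.quad_nonneg hS z)
    have hc : ∀ i, |B z i| ≤ S := fun i =>
      (by simpa using PiLp.norm_apply_le (B z) i : |B z i| ≤ ‖B z‖).trans
        ((hB.norm_le z).trans hzS)
    have he : |B (EuclideanSpace.single j (1 : ℝ)) k| ≤ 1 := by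
      have h1 : |B (EuclideanSpace.single j (1 : ℝ)) k| ≤ ‖B (EuclideanSpace.single j (1 : ℝ))‖ := by
        simpa using PiLp.norm_apply_le (B (EuclideanSpace.single j (1 : ℝ))) k
      refine h1.trans ((hB.norm_le _).trans ?_)
      simp
    refine mul_le_mul_of_nonneg_left ((abs_add_le _ _).trans (add_le_add ?_ ?_)) ht.le
    · simp only [ContinuousLinearMap.comp_apply, PiLp.proj_apply, abs_mul, abs_two]
      calc 2 * |deriv K (inner ℝ z (B z))| * |B z j| * |B z k| ≤ 2 * M * S * S := by
            have := hc j
            have := hc k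
            have := hQ.2
            gcongr
        _ = _ := by ring
    · exact abs_mul_le_of_abs_le_one hQ.1 he
  · have hx' : x ∉ tsupport (fun x => fderiv ℝ
        (kernelTest K B ((EuclideanSpace.proj k).comp B) t y) x (EuclideanSpace.single j 1)) :=
      fun h => hx (tsupport_kernelTest_subset hK0 hS hB _ ht y (tsupport_fderiv_apply_subset ℝ _ h))
    have : partialDeriv j (kernelTest K B ((EuclideanSpace.proj k).comp B) t y) x = 0 :=
      image_eq_zero_of_notMem_tsupport hx'
    rw [this, abs_zero]
    positivity

/-- Comparison of kernel averages of the gradient at two consecutive dyadic scales. -/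
theorem abs_kernelAverage_sub_le {n : ℕ} {K η : ℝ → ℝ} {M : ℝ}
    (hK : ContDiff ℝ (⊤ : ℕ∞) K) (hη : Continuous η)
    (hK0 : ∀ s, 1 ≤ s → K s = 0) (hη0 : ∀ s, 1 ≤ s → η s = 0)
    (hKη : ∀ s, n * K s + 2 * s * deriv K s = 2 ^ n * η (4 * s) - η s)
    (hM : ∀ s, 0 ≤ s → |K s| ≤ M ∧ |deriv K s| ≤ M ∧ |η s| ≤ M)
    {Ω : Set (EuclideanSpace ℝ (Fin n))} (hΩ : IsOpen Ω)
    {u : EuclideanSpace ℝ (Fin n) → ℝ}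
    {G : EuclideanSpace ℝ (Fin n) → EuclideanSpace ℝ (Fin n)} (hG : HasWeakGradientOn Ω u G)
    {a : Fin n → Fin n → EuclideanSpace ℝ (Fin n) → ℝ} (ha : ∀ i j, Measurable (a i j))
    (hu : ∀ φ, IsTestFunction Ω φ →
      ∫ x in Ω, ∑ i, ∑ j, a i j x * G x i * partialDeriv j φ x = 0)
    {a0 : Fin n → Fin n → ℝ}
    {B : EuclideanSpace ℝ (Fin n) →L[ℝ] EuclideanSpace ℝ (Fin n)} {S : ℝ} (hS : 0 < S)
    (hB : IsFrozenInverse a0 B S) {t : ℝ} (ht : 0 < t) {y : EuclideanSpace ℝ (Fin n)}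
    (hy : closedBall y (S / t) ⊆ Ω) {ω : ℝ}
    (hω : ∀ x ∈ closedBall y (S / t), ∀ i j, |a0 i j - a i j x| ≤ ω) (k : Fin n) :
    |2 ^ n * (∫ x in Ω, G x k * η (inner ℝ ((2 * t) • (x - y)) (B ((2 * t) • (x - y))))) -
      ∫ x in Ω, G x k * η (inner ℝ (t • (x - y)) (B (t • (x - y))))| ≤
      n ^ 2 * (2 * M * S ^ 2 + M) * ω * ∫ x in closedBall y (S / t), ‖G x‖ := by
  have hω0 : 0 ≤ ω := by
    have := hω y (mem_closedBall_self (by positivity)) k k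
    exact (abs_nonneg _).trans this
  let C : ℝ := 2 * M * S ^ 2 + M
  have M0 : 0 ≤ M := (abs_nonneg _).trans (hM 0 le_rfl).1
  have C0 : 0 ≤ C := by positivity
  let q : EuclideanSpace ℝ (Fin n) → ℝ := fun x => inner ℝ (t • (x - y)) (B (t • (x - y)))
  have hzc : Continuous fun x : EuclideanSpace ℝ (Fin n) => t • (x - y) := by fun_prop
  have qc : Continuous q := hzc.inner (B.continuous.comp hzc)
  have qnn : ∀ x, 0 ≤ q x := fun x => hB.quad_nonneg hS _
  have q4 : ∀ x, inner ℝ ((2 * t) • (x - y)) (B ((2 * t) • (x - y))) = 4 * q x := fun x => by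
    simp only [q, mul_smul, map_smul, inner_smul_right, real_inner_smul_left]
    ring
  have hcomp : IsCompact (closedBall y (S / t)) := isCompact_closedBall _ _
  have q1 : ∀ x, x ∉ closedBall y (S / t) → 1 ≤ q x := fun x hx => (hB.one_le_quad hS ht hx).le
  have I1 : IntegrableOn (fun x => G x k * η (4 * q x)) Ω :=
    integrableOn_coord_mul_of_bounded (w := fun x => η (4 * q x)) hG.2.1 hcomp hy
      (hη.comp (continuous_const.mul qc)).aestronglyMeasurable
      (fun x _ => (hM (4 * q x) (by have := qnn x; positivity)).2.2)
      (fun x hx => hη0 _ (by linarith [q1 x hx])) k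
  have I2 : IntegrableOn (fun x => G x k * η (q x)) Ω :=
    integrableOn_coord_mul_of_bounded (w := fun x => η (q x)) hG.2.1 hcomp hy (hη.comp qc).aestronglyMeasurable
      (fun x _ => (hM (q x) (qnn x)).2.2) (fun x hx => hη0 _ (q1 x hx)) k
  let φ := kernelTest K B ((EuclideanSpace.proj k).comp B) t y
  have hφ : IsTestFunction Ω φ := isTestFunction_kernelTest hK hK0 hS hB _ ht hy
  let ψ : Fin n → EuclideanSpace ℝ (Fin n) → ℝ := fun i =>
    kernelTest K B (EuclideanSpace.proj i) t y
  have hψ : ∀ i, IsTestFunction Ω (ψ i) := fun i => isTestFunction_kernelTest hK hK0 hS hB _ ht hy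
  -- Applying `a0` to the gradient of `K(⟨z,Bz⟩) (Bz)_k` undoes `B`, leaving `2 K' z_i (Bz)_k + K
  -- δ_ik` up to the factor `t`; this is exactly `∂_k` of `K(⟨z,Bz⟩) z_i`.
  have hφψ : ∀ i x, ∑ j, a0 i j * partialDeriv j φ x = partialDeriv k (ψ i) x := fun i x => by
    simp only [φ, ψ, partialDeriv_kernelTest hK hB]
    set z := t • (x - y)
    have e1 := hB.mul_eq z i
    have e2 := hB.mul_eq (EuclideanSpace.single k 1) i
    have e3 : ∀ j, a0 i j * (t * (2 * deriv K (inner ℝ z (B z)) * B z j *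
        ((EuclideanSpace.proj k).comp B : EuclideanSpace ℝ (Fin n) →L[ℝ] ℝ) z +
        K (inner ℝ z (B z)) * ((EuclideanSpace.proj k).comp B : EuclideanSpace ℝ (Fin n) →L[ℝ] ℝ)
          (EuclideanSpace.single j 1))) =
        t * (2 * deriv K (inner ℝ z (B z)) * B z k) * (a0 i j * B z j) +
          t * K (inner ℝ z (B z)) * (a0 i j * B (EuclideanSpace.single k 1) j) := fun j => by
      simp only [ContinuousLinearMap.comp_apply, PiLp.proj_apply, hB.comp_coord j k]
      ring
    simp_rw [e3]
    rw [Finset.sum_add_distrib, ← Finset.mul_sum, ← Finset.mul_sum, e1, e2]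
    simp only [PiLp.proj_apply]
    ring
  have hdiv : ∀ x, ∑ i, partialDeriv i (ψ i) x = t * (2 ^ n * η (4 * q x) - η (q x)) := fun x => by
    simp only [ψ, partialDeriv_kernelTest hK hB, ← hKη]
    set z := t • (x - y) with hz
    have e1 : ∑ i, B z i * z i = inner ℝ z (B z) := by
      simp [PiLp.inner_apply]
    have e2 : ∀ i, t * (2 * deriv K (inner ℝ z (B z)) * B z i *
        (EuclideanSpace.proj i : EuclideanSpace ℝ (Fin n) →L[ℝ] ℝ) z + K (inner ℝ z (B z)) *
        (EuclideanSpace.proj i : EuclideanSpace ℝ (Fin n) →L[ℝ] ℝ) (EuclideanSpace.single i 1)) =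
        t * (2 * deriv K (inner ℝ z (B z))) * (B z i * z i) + t * K (inner ℝ z (B z)) := fun i => by
      simp only [PiLp.proj_apply, PiLp.single_apply, if_true]
      ring
    simp_rw [e2]
    rw [Finset.sum_add_distrib, ← Finset.mul_sum, e1]
    simp only [Finset.sum_const, Finset.card_univ, Fintype.card_fin, nsmul_eq_mul, q, ← hz]
    ring
  have J1 : ∀ i j, IntegrableOn (fun x => G x i * partialDeriv j φ x) Ω := fun i j =>
    hφ.integrableOn_coord_mul_partialDeriv hG.2.1 i j
  have φ0 : ∀ j x, x ∉ closedBall y (S / t) → partialDeriv j φ x = 0 := fun j x hx => by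
    have : x ∉ tsupport (fun x => fderiv ℝ φ x (EuclideanSpace.single j 1)) := fun h =>
      hx (tsupport_kernelTest_subset hK0 hS hB _ ht y (tsupport_fderiv_apply_subset ℝ _ h))
    exact image_eq_zero_of_notMem_tsupport this
  have φb : ∀ j x, |partialDeriv j φ x| ≤ t * C := fun j x =>
    abs_partialDeriv_kernelTest_le hK hK0 (fun s hs => ⟨(hM s hs).1, (hM s hs).2.1⟩) hS hB ht x y j k
  have J2 : ∀ i j, IntegrableOn (fun x => G x i * ((a0 i j - a i j x) * partialDeriv j φ x)) Ω :=
    fun i j => integrableOn_coord_mul_of_bounded (M := ω * (t * C))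
      (w := fun x => (a0 i j - a i j x) * partialDeriv j φ x) hG.2.1 hcomp hy
      (((measurable_const.sub (ha i j)).aestronglyMeasurable).mul
        (hφ.isTestFunction_partialDeriv j).1.continuous.aestronglyMeasurable)
      (fun x hx => by
        rw [abs_mul]
        exact mul_le_mul (hω x hx i j) (φb j x) (abs_nonneg _) hω0)
      (fun x hx => by rw [φ0 j x hx, mul_zero]) i
  -- The divergence of `ψ` produces the two averages; the curl-free identity trades `G_k ∂_i ψ_i`
  -- for `G_i ∂_k ψ_i`, which is the frozen equation tested with `φ`. Subtracting the true equation
  -- leaves only `a0 - a`.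
  have key : t * (2 ^ n * (∫ x in Ω, G x k * η (4 * q x)) - ∫ x in Ω, G x k * η (q x)) =
      ∫ x in Ω, ∑ i, ∑ j, G x i * ((a0 i j - a i j x) * partialDeriv j φ x) := by
    have s1 : t * (2 ^ n * (∫ x in Ω, G x k * η (4 * q x)) - ∫ x in Ω, G x k * η (q x)) =
        ∫ x in Ω, ∑ i, G x k * partialDeriv i (ψ i) x := by
      rw [← integral_const_mul, ← integral_sub (I1.const_mul _) I2, ← integral_const_mul]
      refine integral_congr_ae (ae_of_all _ fun x => ?_)
      simp only [← Finset.mul_sum, hdiv x]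
      ring
    have s2 : ∫ x in Ω, ∑ i, G x k * partialDeriv i (ψ i) x =
        ∫ x in Ω, ∑ i, ∑ j, G x i * (a0 i j * partialDeriv j φ x) := by
      rw [integral_finsetSum _ fun i _ =>
        (hψ i).integrableOn_coord_mul_partialDeriv hG.2.1 k i]
      simp_rw [← hG.integral_swap (hψ _) _ k]
      rw [← integral_finsetSum _ fun i _ =>
        (hψ i).integrableOn_coord_mul_partialDeriv hG.2.1 i k]
      refine integral_congr_ae (ae_of_all _ fun x => ?_)
      simp only [← Finset.mul_sum, hφψ]
    have J3 : ∀ i j, IntegrableOn (fun x => G x i * (a0 i j * partialDeriv j φ x)) Ω := fun i j => by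
      refine ((J1 i j).const_mul (a0 i j)).congr (ae_of_all _ fun x => ?_)
      simp only
      ring
    have J4 : IntegrableOn (fun x => ∑ i, ∑ j, G x i * (a0 i j * partialDeriv j φ x)) Ω :=
      integrable_finsetSum _ fun i _ => integrable_finsetSum _ fun j _ => J3 i j
    have J5 : IntegrableOn (fun x => ∑ i, ∑ j,
        G x i * ((a0 i j - a i j x) * partialDeriv j φ x)) Ω :=
      integrable_finsetSum _ fun i _ => integrable_finsetSum _ fun j _ => J2 i j
    rw [s1, s2, ← sub_eq_zero, ← integral_sub J4 J5, ← hu φ hφ]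
    refine integral_congr_ae (ae_of_all _ fun x => ?_)
    simp only [← Finset.sum_sub_distrib]
    refine Finset.sum_congr rfl fun i _ => Finset.sum_congr rfl fun j _ => ?_
    ring
  have hGn : IntegrableOn (fun x => ‖G x‖) (closedBall y (S / t)) := by
    have : Fact (volume (closedBall y (S / t)) < ⊤) := ⟨hcomp.measure_lt_top⟩
    exact ((hG.2.1 _ hy hcomp).integrable (by norm_num)).norm
  have hbound : |∫ x in Ω, ∑ i, ∑ j, G x i * ((a0 i j - a i j x) * partialDeriv j φ x)| ≤
      ∫ x in closedBall y (S / t), n ^ 2 * (ω * (t * C)) * ‖G x‖ := by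
    have hres : ∫ x in Ω, ∑ i, ∑ j, G x i * ((a0 i j - a i j x) * partialDeriv j φ x) =
        ∫ x in closedBall y (S / t),
          ∑ i, ∑ j, G x i * ((a0 i j - a i j x) * partialDeriv j φ x) :=
      setIntegral_eq_of_subset_of_forall_sdiff_eq_zero hΩ.measurableSet hy fun x hx =>
        Finset.sum_eq_zero fun i _ => Finset.sum_eq_zero fun j _ => by
          rw [φ0 j x hx.2, mul_zero, mul_zero]
    rw [hres]
    rw [← Real.norm_eq_abs]
    refine norm_integral_le_of_norm_le (hGn.const_mul _) ?_
    rw [ae_restrict_iff' hcomp.measurableSet]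
    refine ae_of_all _ fun x hx => ?_
    calc ‖∑ i, ∑ j, G x i * ((a0 i j - a i j x) * partialDeriv j φ x)‖
        ≤ ∑ i : Fin n, ∑ j : Fin n, ‖G x‖ * (ω * (t * C)) := by
          refine norm_sum_le_of_le _ fun i _ => norm_sum_le_of_le _ fun j _ => ?_
          rw [norm_mul, norm_mul]
          have := φb j x
          have := hω x hx i j
          have := PiLp.norm_apply_le (G x) i
          gcongr
          · exact hω x hx i j
          · exact φb j x
      _ = _ := by
        simp only [Finset.sum_const, Finset.card_univ, Fintype.card_fin, nsmul_eq_mul]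
        ring
  rw [← key, integral_const_mul, abs_mul, abs_of_pos ht] at hbound
  simp_rw [q4]
  -- The factor `t` from the gradient of the test function cancels the one from the divergence, so
  -- the constant does not depend on the scale.
  refine le_of_mul_le_mul_left (hbound.trans_eq ?_) ht
  ring

/-! ### Pointwise control of the gradient by its dyadic averages -/

theorem integrableOn_of_locallySquareIntegrableOn {n : ℕ} {F : Type*} [NormedAddCommGroup F]
    {Ω : Set (EuclideanSpace ℝ (Fin n))} {G : EuclideanSpace ℝ (Fin n) → F}
    (hG : LocallySquareIntegrableOn Ω G) {K : Set (EuclideanSpace ℝ (Fin n))} (hK : IsCompact K)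
    (hKΩ : K ⊆ Ω) : IntegrableOn G K := by
  have : Fact (volume K < ⊤) := ⟨hK.measure_lt_top⟩
  exact (hG K hKΩ hK).integrable (by norm_num)

theorem volume_real_closedBall_div_pow {n : ℕ} (y : EuclideanSpace ℝ (Fin n)) {S : ℝ} (hS : 0 ≤ S)
    (k : ℕ) : (2 : ℝ) ^ (n * k) * volume.real (closedBall y (S / 2 ^ k)) =
      S ^ n * volume.real (closedBall (0 : EuclideanSpace ℝ (Fin n)) 1) := by
  rw [Measure.addHaar_real_closedBall' _ _ (by positivity), finrank_euclideanSpace_fin, div_pow,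
    ← pow_mul, mul_comm k n]
  field_simp

/-- Pointwise control of the gradient at a Lebesgue point by its averages over dyadic balls. -/
theorem ofReal_abs_gradient_le_of_lebesguePoint {n : ℕ} {K η : ℝ → ℝ} {M : ℝ}
    (hK : ContDiff ℝ (⊤ : ℕ∞) K) (hη : Continuous η)
    (hK0 : ∀ s, 1 ≤ s → K s = 0) (hη0 : ∀ s, 1 ≤ s → η s = 0)
    (hηnn : ∀ s, 0 ≤ η s) (hη1 : ∀ s, s ≤ 1 / 4 → 1 ≤ η s)
    (hKη : ∀ s, n * K s + 2 * s * deriv K s = 2 ^ n * η (4 * s) - η s)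
    (hM : ∀ s, 0 ≤ s → |K s| ≤ M ∧ |deriv K s| ≤ M ∧ |η s| ≤ M)
    {Ω : Set (EuclideanSpace ℝ (Fin n))} (hΩ : IsOpen Ω)
    {u : EuclideanSpace ℝ (Fin n) → ℝ}
    {G : EuclideanSpace ℝ (Fin n) → EuclideanSpace ℝ (Fin n)} (hG : HasWeakGradientOn Ω u G)
    {a : Fin n → Fin n → EuclideanSpace ℝ (Fin n) → ℝ} (ha : ∀ i j, Measurable (a i j))
    (hu : ∀ φ, IsTestFunction Ω φ →
      ∫ x in Ω, ∑ i, ∑ j, a i j x * G x i * partialDeriv j φ x = 0)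
    {S : ℝ} (hS : 0 < S) {y : EuclideanSpace ℝ (Fin n)}
    {B : EuclideanSpace ℝ (Fin n) →L[ℝ] EuclideanSpace ℝ (Fin n)}
    (hB : IsFrozenInverse (fun i j => a i j y) B S) {j₀ : ℕ}
    (hy : closedBall y (S / 2 ^ j₀) ⊆ Ω) {ω : ℕ → ℝ}
    (hω : ∀ k, j₀ ≤ k → ∀ x ∈ closedBall y (S / 2 ^ k), ∀ i j, |a i j y - a i j x| ≤ ω k)
    (hleb : Tendsto (fun k : ℕ => ⨍ x in closedBall y (S / 2 ^ k), ‖G x - G y‖) atTop (𝓝 0))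
    (i : Fin n) :
    ENNReal.ofReal ((1 / 2) ^ n * volume.real (closedBall (0 : EuclideanSpace ℝ (Fin n)) 1) *
        |G y i|) ≤
      ENNReal.ofReal (M * (2 ^ (n * j₀) * ∫ x in closedBall y (S / 2 ^ j₀), ‖G x‖)) +
      ∑' j, ENNReal.ofReal (n ^ 2 * (2 * M * S ^ 2 + M) * (ω (j₀ + j) * (2 ^ (n * (j₀ + j)) *
        ∫ x in closedBall y (S / 2 ^ (j₀ + j)), ‖G x‖))) := by
  set c₀ : ℝ := (1 / 2) ^ n * volume.real (closedBall (0 : EuclideanSpace ℝ (Fin n)) 1) with hc₀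
  let C : ℝ := n ^ 2 * (2 * M * S ^ 2 + M)
  have M0 : 0 ≤ M := (abs_nonneg _).trans (hM 0 le_rfl).1
  let q : ℕ → EuclideanSpace ℝ (Fin n) → ℝ := fun k x =>
    inner ℝ ((2 : ℝ) ^ k • (x - y)) (B ((2 : ℝ) ^ k • (x - y)))
  have qc : ∀ k, Continuous (q k) := fun k => by
    have hzc : Continuous fun x : EuclideanSpace ℝ (Fin n) => (2 : ℝ) ^ k • (x - y) := by fun_prop
    exact hzc.inner (B.continuous.comp hzc)
  have qnn : ∀ k x, 0 ≤ q k x := fun k x => hB.quad_nonneg hS _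
  have hp : ∀ k : ℕ, (0 : ℝ) < 2 ^ k := fun k => by positivity
  have hsub : ∀ k, j₀ ≤ k → closedBall y (S / 2 ^ k) ⊆ Ω := fun k hk =>
    (closedBall_subset_closedBall (by
      have : (2 : ℝ) ^ j₀ ≤ 2 ^ k := pow_le_pow_right₀ one_le_two hk
      gcongr)).trans hy
  have hcomp : ∀ k, IsCompact (closedBall y (S / 2 ^ k)) := fun k => isCompact_closedBall _ _
  have q1 : ∀ k x, x ∉ closedBall y (S / 2 ^ k) → η (q k x) = 0 := fun k x hx =>
    hη0 _ (hB.one_le_quad hS (hp k) hx).le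
  let A : ℕ → ℝ := fun k => ∫ x in closedBall y (S / 2 ^ k), ‖G x‖
  -- The average at scale `2^-k`, normalised by volume only up to constants. Its total mass is
  -- bounded below by `c₀`, because `η ≥ 1` where `‖z‖ ≤ 1/2`, that is, where `⟨z,Bz⟩ ≤ 1/4`.
  let m : ℕ → ℝ := fun k => 2 ^ (n * k) * ∫ x in Ω, G x i * η (q k x)
  let e : ℕ → ℝ := fun k => C * (ω k * (2 ^ (n * k) * A k))
  have hstep : ∀ k, j₀ ≤ k → |m (k + 1) - m k| ≤ e k := fun k hk => by
    have h := abs_kernelAverage_sub_le hK hη hK0 hη0 hKη hM hΩ hG ha hu hS hB (hp k) (hsub k hk)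
      (hω k hk) i
    have h2 : (2 : ℝ) * 2 ^ k = 2 ^ (k + 1) := by ring
    rw [h2] at h
    have h3 : m (k + 1) - m k = 2 ^ (n * k) * (2 ^ n * (∫ x in Ω, G x i * η (q (k + 1) x)) -
        ∫ x in Ω, G x i * η (q k x)) := by
      simp only [m]
      rw [mul_add, pow_add, mul_one]
      ring
    rw [h3, abs_mul, abs_of_pos (hp _)]
    refine (mul_le_mul_of_nonneg_left h (hp _).le).trans_eq ?_
    simp only [e, C, A]
    ring
  have hG1 : ∀ k, j₀ ≤ k → IntegrableOn G (closedBall y (S / 2 ^ k)) := fun k hk =>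
    integrableOn_of_locallySquareIntegrableOn hG.2.1 (hcomp k) (hsub k hk)
  have hres : ∀ k, j₀ ≤ k → ∀ w : EuclideanSpace ℝ (Fin n) → ℝ,
      ∫ x in Ω, w x * η (q k x) = ∫ x in closedBall y (S / 2 ^ k), w x * η (q k x) :=
    fun k hk w => setIntegral_eq_of_subset_of_forall_sdiff_eq_zero hΩ.measurableSet (hsub k hk)
      fun x hx => by rw [q1 k x hx.2, mul_zero]
  have hηb : ∀ k x, |η (q k x)| ≤ M := fun k x => (hM _ (qnn k x)).2.2
  have hηm : ∀ k (μ : Measure (EuclideanSpace ℝ (Fin n))),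
      AEStronglyMeasurable (fun x => η (q k x)) μ := fun k μ =>
    (hη.comp (qc k)).aestronglyMeasurable
  have hm0 : |m j₀| ≤ M * (2 ^ (n * j₀) * A j₀) := by
    simp only [m]
    rw [hres j₀ le_rfl, abs_mul, abs_of_pos (hp _), mul_left_comm]
    refine mul_le_mul_of_nonneg_left ?_ (hp _).le
    simp only [A]
    rw [← integral_const_mul, ← Real.norm_eq_abs]
    refine norm_integral_le_of_norm_le ((hG1 j₀ le_rfl).norm.const_mul _) (ae_of_all _ fun x => ?_)
    rw [norm_mul, mul_comm M]
    exact mul_le_mul (PiLp.norm_apply_le _ i) (hηb _ _) (norm_nonneg _) (norm_nonneg _)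
  have hlow : ∀ k, j₀ ≤ k → c₀ ≤ 2 ^ (n * k) * ∫ x in closedBall y (S / 2 ^ k), η (q k x) :=
    fun k hk => by
    have hsm : closedBall y (1 / 2 / 2 ^ k) ⊆ {x | q k x ≤ 1 / 4} := fun x hx => by
      refine (hB.quad_le _).trans ?_
      rw [norm_smul, Real.norm_eq_abs, abs_of_pos (hp k)]
      rw [mem_closedBall, dist_eq_norm, le_div_iff₀ (hp k), mul_comm] at hx
      have := mul_nonneg (hp k).le (norm_nonneg (x - y))
      nlinarith
    have hss : closedBall y (1 / 2 / 2 ^ k) ⊆ closedBall y (S / 2 ^ k) := fun x hx => by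
      by_contra h
      have h1 := hB.one_le_quad hS (hp k) h
      have h2 : q k x ≤ 1 / 4 := hsm hx
      simp only [q] at h2
      linarith
    rw [hc₀, ← volume_real_closedBall_div_pow y (by norm_num) k]
    refine mul_le_mul_of_nonneg_left ?_ (hp _).le
    have hint : IntegrableOn (fun x => η (q k x)) (closedBall y (S / 2 ^ k)) :=
      (hη.comp (qc k)).continuousOn.integrableOn_compact (hcomp k)
    calc volume.real (closedBall y (1 / 2 / 2 ^ k)) = ∫ x in closedBall y (1 / 2 / 2 ^ k), 1 := by
          simp
      _ ≤ ∫ x in closedBall y (1 / 2 / 2 ^ k), η (q k x) :=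
          setIntegral_mono_on (integrableOn_const measure_closedBall_lt_top.ne)
            (hint.mono_set hss) measurableSet_closedBall fun x hx => hη1 _ (hsm hx)
      _ ≤ _ := setIntegral_mono_set hint (ae_of_all _ fun x => hηnn _) (Eventually.of_forall hss)
  let D : ℕ → ℝ := fun k => ⨍ x in closedBall y (S / 2 ^ k), ‖G x - G y‖
  let V : ℝ := S ^ n * volume.real (closedBall (0 : EuclideanSpace ℝ (Fin n)) 1)
  -- Replacing `G x` by `G y` in `m k` costs a multiple of the mean of `‖G x - G y‖`, which vanishes
  -- in the limit at a Lebesgue point.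
  have herr : ∀ k, j₀ ≤ k → c₀ * |G y i| ≤ |m k| + M * V * D k := fun k hk => by
    have hGy : IntegrableOn (fun x => ‖G x - G y‖) (closedBall y (S / 2 ^ k)) :=
      ((hG1 k hk).sub (integrableOn_const measure_closedBall_lt_top.ne)).norm
    have hGi : IntegrableOn (fun x => G x i * η (q k x)) (closedBall y (S / 2 ^ k)) :=
      Integrable.mul_bdd (c := M)
        ((EuclideanSpace.proj i : EuclideanSpace ℝ (Fin n) →L[ℝ] ℝ).integrable_comp (hG1 k hk))
        (hηm k _) (ae_of_all _ (hηb k))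
    have hci : IntegrableOn (fun x => G y i * η (q k x)) (closedBall y (S / 2 ^ k)) :=
      ((hη.comp (qc k)).continuousOn.integrableOn_compact (hcomp k)).const_mul _
    have h1 : |(∫ x in closedBall y (S / 2 ^ k), G y i * η (q k x)) -
        ∫ x in closedBall y (S / 2 ^ k), G x i * η (q k x)| ≤
        M * ∫ x in closedBall y (S / 2 ^ k), ‖G x - G y‖ := by
      rw [← integral_sub hci hGi, ← integral_const_mul, ← Real.norm_eq_abs]
      refine norm_integral_le_of_norm_le (hGy.const_mul _) (ae_of_all _ fun x => ?_)
      rw [← sub_mul, norm_mul, mul_comm M, norm_sub_rev]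
      have h5 : ‖G x i - G y i‖ ≤ ‖G x - G y‖ := PiLp.norm_apply_le (G x - G y) i
      exact mul_le_mul h5 (hηb _ _) (norm_nonneg _) (norm_nonneg _)
    have h2 : (2 : ℝ) ^ (n * k) * ∫ x in closedBall y (S / 2 ^ k), ‖G x - G y‖ = V * D k := by
      have hv : 0 < volume.real (closedBall y (S / 2 ^ k)) :=
        ENNReal.toReal_pos (measure_closedBall_pos _ _ (div_pos hS (hp k))).ne'
          measure_closedBall_lt_top.ne
      simp only [V, D]
      rw [← volume_real_closedBall_div_pow y hS.le k, setAverage_eq, smul_eq_mul]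
      field_simp
    have h3 := hlow k hk
    have h4 : c₀ * |G y i| ≤ 2 ^ (n * k) *
        |∫ x in closedBall y (S / 2 ^ k), G y i * η (q k x)| := by
      rw [integral_const_mul, abs_mul, abs_of_nonneg (integral_nonneg fun x => hηnn _)]
      calc c₀ * |G y i| ≤ (2 ^ (n * k) * ∫ x in closedBall y (S / 2 ^ k), η (q k x)) * |G y i| := by
            gcongr
        _ = _ := by ring
    have h5 : |m k| = 2 ^ (n * k) * |∫ x in closedBall y (S / 2 ^ k), G x i * η (q k x)| := by
      simp only [m]
      rw [hres k hk, abs_mul, abs_of_pos (hp _)]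
    calc c₀ * |G y i| ≤ 2 ^ (n * k) * |∫ x in closedBall y (S / 2 ^ k), G y i * η (q k x)| := h4
      _ ≤ 2 ^ (n * k) * (|∫ x in closedBall y (S / 2 ^ k), G x i * η (q k x)| +
          M * ∫ x in closedBall y (S / 2 ^ k), ‖G x - G y‖) := by
            gcongr
            have := abs_sub_abs_le_abs_sub
              (∫ x in closedBall y (S / 2 ^ k), G y i * η (q k x))
              (∫ x in closedBall y (S / 2 ^ k), G x i * η (q k x))
            linarith
      _ = |m k| + M * (2 ^ (n * k) * ∫ x in closedBall y (S / 2 ^ k), ‖G x - G y‖) := by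
            rw [h5]; ring
      _ = _ := by rw [h2]; ring
  have hsum : ∀ N, |m (j₀ + N)| ≤ |m j₀| + ∑ j ∈ Finset.range N, e (j₀ + j) := fun N => by
    induction N with
    | zero => simp
    | succ N ih =>
      rw [Finset.sum_range_succ, ← add_assoc j₀ N 1]
      have h1 := hstep (j₀ + N) (by omega)
      have h2 := abs_sub_abs_le_abs_sub (m (j₀ + N + 1)) (m (j₀ + N))
      linarith
  -- In `ℝ≥0∞` the series makes sense before it is known to converge, which is needed because `G` is
  -- not yet bounded.
  have hfin : ∀ N, ENNReal.ofReal (c₀ * |G y i|) ≤ ENNReal.ofReal (M * (2 ^ (n * j₀) * A j₀)) +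
      ∑' j, ENNReal.ofReal (e (j₀ + j)) + ENNReal.ofReal (M * V * D (j₀ + N)) := fun N => by
    have h1 : c₀ * |G y i| ≤ M * (2 ^ (n * j₀) * A j₀) + ∑ j ∈ Finset.range N, e (j₀ + j) +
        M * V * D (j₀ + N) := by
      linarith [herr (j₀ + N) (by omega), hsum N, hm0]
    have he : ∀ k, j₀ ≤ k → 0 ≤ e k := fun k hk => (abs_nonneg _).trans (hstep k hk)
    refine (ENNReal.ofReal_le_ofReal h1).trans (ENNReal.ofReal_add_le.trans ?_)
    gcongr
    refine ENNReal.ofReal_add_le.trans ?_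
    gcongr
    rw [ENNReal.ofReal_sum_of_nonneg fun j _ => he _ (by omega)]
    exact ENNReal.sum_le_tsum _
  have hlim : Tendsto (fun N => ENNReal.ofReal (M * (2 ^ (n * j₀) * A j₀)) +
      ∑' j, ENNReal.ofReal (e (j₀ + j)) + ENNReal.ofReal (M * V * D (j₀ + N))) atTop
      (𝓝 (ENNReal.ofReal (M * (2 ^ (n * j₀) * A j₀)) + ∑' j, ENNReal.ofReal (e (j₀ + j)) + 0)) := by
    refine Tendsto.const_add _ ?_
    have h1 : Tendsto (fun N => D (j₀ + N)) atTop (𝓝 0) := by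
      have := (tendsto_add_atTop_iff_nat j₀).2 hleb
      simpa only [add_comm j₀] using this
    have h2 := ENNReal.tendsto_ofReal (h1.const_mul (M * V))
    simpa using h2
  rw [add_zero] at hlim
  exact ge_of_tendsto' hlim hfin

/-- Almost everywhere control of the gradient of a weak solution by its averages over dyadic
balls, weighted by the modulus of continuity of the coefficients. -/
theorem exists_ae_enorm_gradient_le {n : ℕ} (hn : 1 ≤ n) {Ω : Set (EuclideanSpace ℝ (Fin n))}
    (hΩ : IsOpen Ω) {u : EuclideanSpace ℝ (Fin n) → ℝ}
    {G : EuclideanSpace ℝ (Fin n) → EuclideanSpace ℝ (Fin n)} (hG : HasWeakGradientOn Ω u G)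
    {a : Fin n → Fin n → EuclideanSpace ℝ (Fin n) → ℝ} (ha : ∀ i j, Measurable (a i j))
    (hu : ∀ φ, IsTestFunction Ω φ →
      ∫ x in Ω, ∑ i, ∑ j, a i j x * G x i * partialDeriv j φ x = 0)
    {S : ℝ} (hS : 0 < S) (hB : ∀ y ∈ Ω, ∃ B, IsFrozenInverse (fun i j => a i j y) B S)
    {ω : ℕ → ℝ} {k₀ : ℕ} (hω0 : ∀ k, 0 ≤ ω k)
    (hω : ∀ k, k₀ ≤ k → ∀ x ∈ Ω, ∀ y ∈ Ω, dist x y ≤ S / 2 ^ k →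
      ∀ i j, |a i j y - a i j x| ≤ ω k)
    {x₀ : EuclideanSpace ℝ (Fin n)} {ρ : ℝ} (hρ : closedBall x₀ ρ ⊆ Ω) :
    ∃ C : ℝ, ∀ᵐ y, ∀ j₀, k₀ ≤ j₀ → closedBall y (S / 2 ^ j₀) ⊆ closedBall x₀ ρ →
      ‖G y‖ₑ ≤ ENNReal.ofReal C * (ENNReal.ofReal (2 ^ (n * j₀)) * ∫⁻ x in closedBall x₀ ρ, ‖G x‖ₑ) +
        ∑' j, ENNReal.ofReal (C * ω (j₀ + j)) * (ENNReal.ofReal (2 ^ (n * (j₀ + j))) *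
          ∫⁻ x in closedBall y (S / 2 ^ (j₀ + j)), ‖G x‖ₑ) := by
  obtain ⟨K, η, M, hK, hη, hK0, hη0, hηnn, hη1, hKη, hM⟩ := exists_telescoping_profile hn
  have M0 : 0 ≤ M := (abs_nonneg _).trans (hM 0 le_rfl).1
  have hcomp : IsCompact (closedBall x₀ ρ) := isCompact_closedBall _ _
  have hint : IntegrableOn G (closedBall x₀ ρ) :=
    integrableOn_of_locallySquareIntegrableOn hG.2.1 hcomp hρ
  -- The Lebesgue differentiation theorem requires a globally defined locally integrable function,
  -- hence the truncation; all small balls used lie where `f = G`.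
  let f : EuclideanSpace ℝ (Fin n) → EuclideanSpace ℝ (Fin n) := (closedBall x₀ ρ).indicator G
  have hf : Integrable f := (integrable_indicator_iff hcomp.measurableSet).2 hint
  let c₀ : ℝ := (1 / 2) ^ n * volume.real (closedBall (0 : EuclideanSpace ℝ (Fin n)) 1)
  have c₀pos : 0 < c₀ := mul_pos (by positivity) (ENNReal.toReal_pos
    (measure_closedBall_pos _ _ one_pos).ne' measure_closedBall_lt_top.ne)
  let C₁ : ℝ := n ^ 2 * (2 * M * S ^ 2 + M)
  have C₁0 : 0 ≤ C₁ := by positivity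
  let C : ℝ := n * ((M + C₁) / c₀)
  refine ⟨C, ?_⟩
  filter_upwards [IsUnifLocDoublingMeasure.ae_tendsto_average_norm_sub volume
    hf.locallyIntegrable 1] with y hyleb j₀ hj₀ hysub
  have hp : ∀ k : ℕ, (0 : ℝ) < 2 ^ k := fun k => by positivity
  have hymem : ∀ k, y ∈ closedBall y (S / 2 ^ k) := fun k =>
    mem_closedBall_self (div_pos hS (hp k)).le
  have hsub : ∀ k, j₀ ≤ k → closedBall y (S / 2 ^ k) ⊆ closedBall x₀ ρ := fun k hk =>
    (closedBall_subset_closedBall (by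
      have : (2 : ℝ) ^ j₀ ≤ 2 ^ k := pow_le_pow_right₀ one_le_two hk
      gcongr)).trans hysub
  have hyΩ : y ∈ Ω := hρ (hysub (hymem j₀))
  obtain ⟨B, hBy⟩ := hB y hyΩ
  have hleb : Tendsto (fun k : ℕ => ⨍ x in closedBall y (S / 2 ^ k), ‖G x - G y‖) atTop (𝓝 0) := by
    have h1 : Tendsto (fun k : ℕ => S / 2 ^ k) atTop (𝓝[>] 0) := by
      refine tendsto_nhdsWithin_iff.2 ⟨?_, Eventually.of_forall fun k => div_pos hS (hp k)⟩
      have := (tendsto_pow_atTop_nhds_zero_of_lt_one (by norm_num : (0 : ℝ) ≤ 1 / 2)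
        (by norm_num)).const_mul S
      simpa [div_eq_mul_inv] using this
    refine (hyleb (fun _ => y) _ h1 (Eventually.of_forall fun k => by
      rw [one_mul]; exact hymem k)).congr' ?_
    filter_upwards [eventually_ge_atTop j₀] with k hk
    rw [setAverage_eq, setAverage_eq]
    congr 1
    refine setIntegral_congr_fun measurableSet_closedBall fun x hx => ?_
    simp only [f]
    rw [indicator_of_mem (hsub k hk hx), indicator_of_mem (hysub (hymem j₀))]
  have hcoord := fun i => ofReal_abs_gradient_le_of_lebesguePoint hK hη hK0 hη0 hηnn hη1 hKη hM
    hΩ hG ha hu hS hBy (hysub.trans hρ) (ω := ω) (fun k hk x hx =>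
      hω k (hj₀.trans hk) x (hρ (hsub k hk hx)) y hyΩ hx) hleb i
  have hA : ∀ k, j₀ ≤ k → ENNReal.ofReal (∫ x in closedBall y (S / 2 ^ k), ‖G x‖) =
      ∫⁻ x in closedBall y (S / 2 ^ k), ‖G x‖ₑ := fun k hk =>
    ofReal_integral_norm_eq_lintegral_enorm (hint.mono_set (hsub k hk))
  have hbd : ∀ i, ‖G y i‖ₑ ≤ ENNReal.ofReal ((M + C₁) / c₀) * (ENNReal.ofReal (2 ^ (n * j₀)) *
      ∫⁻ x in closedBall x₀ ρ, ‖G x‖ₑ) + ∑' j, ENNReal.ofReal ((M + C₁) / c₀ * ω (j₀ + j)) *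
        (ENNReal.ofReal (2 ^ (n * (j₀ + j))) *
          ∫⁻ x in closedBall y (S / 2 ^ (j₀ + j)), ‖G x‖ₑ) := fun i => by
    have h1 : ‖G y i‖ₑ = ENNReal.ofReal c₀⁻¹ * ENNReal.ofReal (c₀ * |G y i|) := by
      rw [← ENNReal.ofReal_mul (by positivity), Real.enorm_eq_ofReal_abs]
      congr 1
      field_simp
    rw [h1]
    refine (mul_le_mul_right (hcoord i) _).trans ?_
    rw [mul_add, ← ENNReal.tsum_mul_left]
    refine add_le_add ?_ (ENNReal.tsum_le_tsum fun j => ?_)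
    · rw [ENNReal.ofReal_mul M0, ENNReal.ofReal_mul (hp _).le, hA j₀ le_rfl, ← mul_assoc,
        ← ENNReal.ofReal_mul (by positivity)]
      have : c₀⁻¹ * M ≤ (M + C₁) / c₀ := by
        rw [inv_mul_eq_div]
        gcongr
        linarith
      gcongr
    · have hA' := hA (j₀ + j) (by omega)
      rw [ENNReal.ofReal_mul C₁0, ENNReal.ofReal_mul (hω0 _), ENNReal.ofReal_mul (hp _).le, hA',
        ← mul_assoc, ← mul_assoc, ← ENNReal.ofReal_mul (by positivity),
        ← ENNReal.ofReal_mul (by positivity)]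
      have : c₀⁻¹ * C₁ * ω (j₀ + j) ≤ (M + C₁) / c₀ * ω (j₀ + j) := by
        have := hω0 (j₀ + j)
        rw [inv_mul_eq_div]
        gcongr
        linarith
      gcongr
  have hsum : ‖G y‖ₑ ≤ ∑ i, ‖G y i‖ₑ := by
    have h1 : G y = ∑ i, G y i • EuclideanSpace.single i (1 : ℝ) := by
      ext k
      simp [Pi.single_apply]
    conv_lhs => rw [h1]
    refine (enorm_sum_le _ _).trans (Finset.sum_le_sum fun i _ => ?_)
    rw [enorm_smul]
    have : ‖(EuclideanSpace.single i (1 : ℝ) : EuclideanSpace ℝ (Fin n))‖ₑ = 1 := by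
      rw [← ofReal_norm, PiLp.norm_single]
      simp
    rw [this, mul_one]
  refine hsum.trans ((Finset.sum_le_sum fun i _ => hbd i).trans_eq ?_)
  rw [Finset.sum_const, Finset.card_univ, Fintype.card_fin, nsmul_eq_mul, mul_add,
    ← ENNReal.tsum_mul_left]
  have hnR : (n : ℝ≥0∞) = ENNReal.ofReal n := by simp
  congr 1
  · rw [← mul_assoc, hnR, ← ENNReal.ofReal_mul (by positivity)]
  · congr 1
    ext j
    rw [← mul_assoc, hnR, ← ENNReal.ofReal_mul (by positivity)]
    simp only [C]
    ring_nf

/-! ### Absorbing a small potential -/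

theorem aemeasurable_lintegral_closedBall {n : ℕ} {g : EuclideanSpace ℝ (Fin n) → ℝ≥0∞}
    (hg : AEMeasurable g) (s : ℝ) : AEMeasurable fun y => ∫⁻ x in closedBall y s, g x := by
  have hm : MeasurableSet {p : EuclideanSpace ℝ (Fin n) × EuclideanSpace ℝ (Fin n) |
      dist p.2 p.1 ≤ s} := measurableSet_le (by fun_prop) measurable_const
  have h1 : AEMeasurable (fun p : EuclideanSpace ℝ (Fin n) × EuclideanSpace ℝ (Fin n) =>
      {p : EuclideanSpace ℝ (Fin n) × EuclideanSpace ℝ (Fin n) | dist p.2 p.1 ≤ s}.indicator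
        (fun p => g p.2) p) (volume.prod volume) :=
    (hg.comp_quasiMeasurePreserving Measure.quasiMeasurePreserving_snd).indicator hm
  refine h1.lintegral_prod_right'.congr (ae_of_all _ fun y => ?_)
  beta_reduce
  rw [← lintegral_indicator measurableSet_closedBall]
  rfl

/-- Tonelli: each `x` is counted by those `y` within distance `s`, a set of the volume of a ball of
radius `s`. -/
theorem lintegral_lintegral_closedBall_le {n : ℕ} {g : EuclideanSpace ℝ (Fin n) → ℝ≥0∞}
    (hg : AEMeasurable g) {s : ℝ} {V W : Set (EuclideanSpace ℝ (Fin n))} (hV : MeasurableSet V)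
    (hW : MeasurableSet W) (hVW : ∀ y ∈ V, closedBall y s ⊆ W) :
    ∫⁻ y in V, ∫⁻ x in closedBall y s, g x ≤
      volume (closedBall (0 : EuclideanSpace ℝ (Fin n)) s) * ∫⁻ x in W, g x := by
  let E := EuclideanSpace ℝ (Fin n)
  let D : Set (E × E) := {p | dist p.2 p.1 ≤ s}
  have hD : MeasurableSet D := measurableSet_le (by fun_prop) measurable_const
  have h1 : AEMeasurable (fun p : E × E => D.indicator (fun p => W.indicator g p.2) p)
      (volume.prod volume) :=
    ((hg.indicator hW).comp_quasiMeasurePreserving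
      Measure.quasiMeasurePreserving_snd).indicator hD
  calc ∫⁻ y in V, ∫⁻ x in closedBall y s, g x
      ≤ ∫⁻ y in V, ∫⁻ x, D.indicator (fun p => W.indicator g p.2) (y, x) := by
        refine setLIntegral_mono' hV fun y hy => ?_
        rw [← lintegral_indicator measurableSet_closedBall]
        refine lintegral_mono fun x => ?_
        by_cases hx : x ∈ closedBall y s
        · rw [indicator_of_mem hx, indicator_of_mem (show (y, x) ∈ D from hx),
            indicator_of_mem (hVW y hy hx)]
        · rw [indicator_of_notMem hx]
          exact zero_le
    _ ≤ ∫⁻ y, ∫⁻ x, D.indicator (fun p => W.indicator g p.2) (y, x) := setLIntegral_le_lintegral _ _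
    _ = ∫⁻ x, ∫⁻ y, D.indicator (fun p => W.indicator g p.2) (y, x) :=
        lintegral_lintegral_swap h1
    _ = ∫⁻ x, volume (closedBall (0 : E) s) * W.indicator g x := by
        refine lintegral_congr fun x => ?_
        have h2 : ∀ y, D.indicator (fun p => W.indicator g p.2) (y, x) =
            (closedBall x s).indicator (fun _ => W.indicator g x) y := fun y => by
          by_cases hy : y ∈ closedBall x s
          · rw [indicator_of_mem hy, indicator_of_mem]
            simpa [D, dist_comm] using hy
          · rw [indicator_of_notMem hy, indicator_of_notMem]
            simpa [D, dist_comm] using hy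
        simp_rw [h2]
        rw [lintegral_indicator measurableSet_closedBall, setLIntegral_const,
          Measure.addHaar_closedBall_center, mul_comm]
    _ = _ := by
        rw [lintegral_const_mul'' _ (hg.indicator hW), lintegral_indicator hW]

theorem two_pow_mul_volume_closedBall {n : ℕ} (y : EuclideanSpace ℝ (Fin n)) {S : ℝ} (hS : 0 ≤ S)
    (k : ℕ) : (2 : ℝ≥0∞) ^ (n * k) * volume (closedBall y (S / 2 ^ k)) =
      ENNReal.ofReal (S ^ n) * volume (closedBall (0 : EuclideanSpace ℝ (Fin n)) 1) := by
  have h2 : (2 : ℝ≥0∞) ^ (n * k) = ENNReal.ofReal (2 ^ (n * k)) := by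
    rw [ENNReal.ofReal_pow (by norm_num)]; simp
  rw [Measure.addHaar_closedBall' _ _ (by positivity), finrank_euclideanSpace_fin, h2,
    ← mul_assoc, ← ENNReal.ofReal_mul (by positivity)]
  congr 2
  rw [div_pow, ← pow_mul, mul_comm k n]
  field_simp

/-- A function dominated by a constant plus a small potential of itself, at all small dyadic
scales, is locally essentially bounded. -/
theorem exists_ae_le_of_le_potential {n : ℕ} {f : EuclideanSpace ℝ (Fin n) → ℝ≥0∞}
    (hf : AEMeasurable f) {x₀ : EuclideanSpace ℝ (Fin n)} {ρ S : ℝ} (hS : 0 < S)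
    {w : ℕ → ℝ≥0∞} {c : ℝ≥0∞} (hc : c ≠ ⊤) {j₁ : ℕ}
    (hw : ∀ k, j₁ ≤ k → (∑' j, w (k + j)) * (ENNReal.ofReal (S ^ n) *
      volume (closedBall (0 : EuclideanSpace ℝ (Fin n)) 1)) ≤ (2 ^ (n + 1))⁻¹)
    (hI : ∫⁻ x in closedBall x₀ ρ, f x ≠ ⊤)
    (hle : ∀ᵐ y, ∀ j₀, j₁ ≤ j₀ → closedBall y (S / 2 ^ j₀) ⊆ closedBall x₀ ρ →
      f y ≤ c * (2 ^ (n * j₀) * ∫⁻ x in closedBall x₀ ρ, f x) +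
        ∑' j, w (j₀ + j) * (2 ^ (n * (j₀ + j)) *
          ∫⁻ x in closedBall y (S / 2 ^ (j₀ + j)), f x)) :
    ∃ b : ℝ≥0∞, b ≠ ⊤ ∧ ∀ᵐ y ∂volume.restrict (closedBall x₀ (ρ - 2 * (S / 2 ^ j₁))), f y ≤ b := by
  let I := ∫⁻ x in closedBall x₀ ρ, f x
  -- The level `b k` is twice the constant term at scale `j₁ + k`, so it grows by `2^n` per step.
  -- The smallness `2^-(n+1)` of the weights is chosen so that the potential of the constant `b
  -- (k+1)` is at most `b k / 2`.
  let b : ℕ → ℝ≥0∞ := fun k => 2 * (c * (2 ^ (n * (j₁ + k)) * I))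
  -- The radii increase so that a ball of radius `S/2^(j₁+k)` about a point of `U k` remains in `U
  -- (k+1)`.
  let U : ℕ → Set (EuclideanSpace ℝ (Fin n)) := fun k =>
    closedBall x₀ (ρ - 2 * (S / 2 ^ (j₁ + k)))
  let J : ℕ → ℝ≥0∞ := fun k => ∫⁻ x in U k, f x - b k
  have hU : ∀ k, U k ⊆ closedBall x₀ ρ := fun k => closedBall_subset_closedBall (by
    have : 0 < S / 2 ^ (j₁ + k) := by positivity
    linarith)
  have hball : ∀ k, ∀ y ∈ U k, closedBall y (S / 2 ^ (j₁ + k)) ⊆ U (k + 1) := fun k y hy => by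
    refine closedBall_subset_closedBall' ?_
    have h1 : dist y x₀ ≤ ρ - 2 * (S / 2 ^ (j₁ + k)) := hy
    have h2 : 2 * (S / 2 ^ (j₁ + (k + 1))) = S / 2 ^ (j₁ + k) := by
      rw [← add_assoc, pow_succ]
      field_simp
    rw [h2]
    linarith
  have hballj : ∀ k j, ∀ y ∈ U k, closedBall y (S / 2 ^ (j₁ + k + j)) ⊆ U (k + 1) :=
    fun k j y hy => (closedBall_subset_closedBall (by
      have : (2 : ℝ) ^ (j₁ + k) ≤ 2 ^ (j₁ + k + j) := pow_le_pow_right₀ one_le_two (by omega)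
      gcongr)).trans (hball k y hy)
  have hbhalf : ∀ k, b (k + 1) * (2 ^ (n + 1))⁻¹ = c * (2 ^ (n * (j₁ + k)) * I) := fun k => by
    have h1 : b (k + 1) = c * (2 ^ (n * (j₁ + k)) * I) * 2 ^ (n + 1) := by
      simp only [b]
      rw [← add_assoc, mul_add n, pow_add, pow_add 2 n 1, mul_one, pow_one]
      ring
    rw [h1, mul_assoc, ENNReal.mul_inv_cancel (by positivity) (ENNReal.pow_ne_top (by simp)),
      mul_one]
  -- Split `f ≤ b (k+1) + (f - b (k+1))` inside the potential. The constant part and the initial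
  -- term add up to at most `b k`; integrating the rest over `U k` by Tonelli gives the small factor
  -- times the excess over `U (k+1)`.
  have hJ : ∀ k, J k ≤ (2 ^ (n + 1))⁻¹ * J (k + 1) := fun k => by
    have hfb : AEMeasurable fun x => f x - b (k + 1) := hf.sub aemeasurable_const
    let T : EuclideanSpace ℝ (Fin n) → ℝ≥0∞ := fun y => ∑' j, w (j₁ + k + j) *
      (2 ^ (n * (j₁ + k + j)) * ∫⁻ x in closedBall y (S / 2 ^ (j₁ + k + j)), (f x - b (k + 1)))
    have hT : J k ≤ ∫⁻ y in U k, T y := by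
      refine lintegral_mono_ae ?_
      rw [ae_restrict_iff' measurableSet_closedBall]
      filter_upwards [hle] with y hy hyU
      rw [tsub_le_iff_left]
      refine (hy (j₁ + k) (by omega) ((hball k y hyU).trans (hU _))).trans ?_
      have h1 : ∀ j, w (j₁ + k + j) * (2 ^ (n * (j₁ + k + j)) *
          ∫⁻ x in closedBall y (S / 2 ^ (j₁ + k + j)), f x) ≤
          b (k + 1) * (w (j₁ + k + j) * (ENNReal.ofReal (S ^ n) *
            volume (closedBall (0 : EuclideanSpace ℝ (Fin n)) 1))) +
          w (j₁ + k + j) * (2 ^ (n * (j₁ + k + j)) *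
            ∫⁻ x in closedBall y (S / 2 ^ (j₁ + k + j)), (f x - b (k + 1))) := fun j => by
        have h2 : ∫⁻ x in closedBall y (S / 2 ^ (j₁ + k + j)), f x ≤
            b (k + 1) * volume (closedBall y (S / 2 ^ (j₁ + k + j))) +
              ∫⁻ x in closedBall y (S / 2 ^ (j₁ + k + j)), (f x - b (k + 1)) := by
          rw [← setLIntegral_const, ← lintegral_add_left measurable_const]
          exact lintegral_mono fun x => le_add_tsub
        rw [← two_pow_mul_volume_closedBall y hS.le (j₁ + k + j)]
        calc _ ≤ w (j₁ + k + j) * (2 ^ (n * (j₁ + k + j)) *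
              (b (k + 1) * volume (closedBall y (S / 2 ^ (j₁ + k + j))) +
              ∫⁻ x in closedBall y (S / 2 ^ (j₁ + k + j)), (f x - b (k + 1)))) := by gcongr
          _ = _ := by ring
      have h3 : b (k + 1) * ((∑' j, w (j₁ + k + j)) * (ENNReal.ofReal (S ^ n) *
            volume (closedBall (0 : EuclideanSpace ℝ (Fin n)) 1))) ≤
          c * (2 ^ (n * (j₁ + k)) * I) := by
        rw [← hbhalf k]
        gcongr
        exact hw (j₁ + k) (by omega)
      calc _ ≤ c * (2 ^ (n * (j₁ + k)) * I) +
            (b (k + 1) * ((∑' j, w (j₁ + k + j)) * (ENNReal.ofReal (S ^ n) *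
            volume (closedBall (0 : EuclideanSpace ℝ (Fin n)) 1))) + T y) := by
            refine add_le_add le_rfl ((ENNReal.tsum_le_tsum h1).trans_eq ?_)
            rw [ENNReal.tsum_add, ENNReal.tsum_mul_left, ENNReal.tsum_mul_right]
        _ ≤ c * (2 ^ (n * (j₁ + k)) * I) + (c * (2 ^ (n * (j₁ + k)) * I) + T y) := by gcongr
        _ = b k + T y := by simp only [b]; ring
    refine hT.trans ?_
    simp only [T]
    rw [lintegral_tsum fun j => (((aemeasurable_lintegral_closedBall hfb _).const_mul
      _).const_mul _).restrict]
    have h4 : ∀ j, ∫⁻ y in U k, w (j₁ + k + j) * (2 ^ (n * (j₁ + k + j)) *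
        ∫⁻ x in closedBall y (S / 2 ^ (j₁ + k + j)), (f x - b (k + 1))) ≤
        w (j₁ + k + j) * (ENNReal.ofReal (S ^ n) *
            volume (closedBall (0 : EuclideanSpace ℝ (Fin n)) 1)) * J (k + 1) := fun j => by
      rw [lintegral_const_mul'' _
        ((aemeasurable_lintegral_closedBall hfb _).const_mul _).restrict,
        lintegral_const_mul'' _ (aemeasurable_lintegral_closedBall hfb _).restrict,
        ← two_pow_mul_volume_closedBall 0 hS.le (j₁ + k + j), mul_assoc, mul_assoc]
      gcongr
      exact lintegral_lintegral_closedBall_le hfb measurableSet_closedBall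
        measurableSet_closedBall (hballj k j)
    refine (ENNReal.tsum_le_tsum h4).trans ?_
    rw [ENNReal.tsum_mul_right, ENNReal.tsum_mul_right]
    gcongr
    exact hw (j₁ + k) (by omega)
  have hδ : ((2 : ℝ≥0∞) ^ (n + 1))⁻¹ < 1 :=
    ENNReal.inv_lt_one.2 (one_lt_pow₀ (by norm_num) (by omega))
  have hiter : ∀ k, J 0 ≤ ((2 ^ (n + 1))⁻¹) ^ k * J k := fun k => by
    induction k with
    | zero => simp
    | succ k ih =>
      refine ih.trans ?_
      rw [pow_succ _ k, mul_assoc]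
      gcongr
      exact hJ k
  have hJI : ∀ k, J k ≤ I := fun k =>
    (lintegral_mono fun x => tsub_le_self).trans (lintegral_mono_set (hU k))
  -- All `J k` are bounded by the finite integral `I`, so iterating the contraction forces `J 0 =
  -- 0`, that is `f ≤ b 0` almost everywhere on `U 0`.
  have hJ0 : J 0 = 0 := by
    have h1 : Tendsto (fun k => (((2 : ℝ≥0∞) ^ (n + 1))⁻¹) ^ k * I) atTop (𝓝 (0 * I)) :=
      ENNReal.Tendsto.mul_const (ENNReal.tendsto_pow_atTop_nhds_zero_of_lt_one hδ) (Or.inr hI)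
    rw [zero_mul] at h1
    exact le_antisymm (ge_of_tendsto' h1 fun k => (hiter k).trans (by gcongr; exact hJI k))
      zero_le
  refine ⟨b 0, ?_, ?_⟩
  · exact ENNReal.mul_ne_top (by simp) (ENNReal.mul_ne_top hc
      (ENNReal.mul_ne_top (ENNReal.pow_ne_top (by simp)) hI))
  · have h1 := (lintegral_eq_zero_iff' (hf.sub aemeasurable_const).restrict).1 hJ0
    filter_upwards [h1] with x hx
    exact tsub_eq_zero_iff_le.1 hx

/-! ### From a bounded weak gradient to a locally Lipschitz representative -/

/-- The gradient of a mollification of a function with bounded weak gradient is bounded. -/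
theorem norm_fderiv_mollification_le {n : ℕ} {Ω : Set (EuclideanSpace ℝ (Fin n))}
    (hΩ : IsOpen Ω) {u : EuclideanSpace ℝ (Fin n) → ℝ}
    {G : EuclideanSpace ℝ (Fin n) → EuclideanSpace ℝ (Fin n)} (hG : HasWeakGradientOn Ω u G)
    {x₀ : EuclideanSpace ℝ (Fin n)} {r L : ℝ} (hr : closedBall x₀ r ⊆ Ω)
    (hL : ∀ᵐ x ∂volume.restrict (closedBall x₀ r), ‖G x‖ ≤ L)
    (β : ContDiffBump (0 : EuclideanSpace ℝ (Fin n))) {x : EuclideanSpace ℝ (Fin n)}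
    (hx : closedBall x β.rOut ⊆ closedBall x₀ r) :
    DifferentiableAt ℝ (convolution ((closedBall x₀ r).indicator u) (β.normed volume)
      (ContinuousLinearMap.lsmul ℝ ℝ) volume) x ∧
    ‖fderiv ℝ (convolution ((closedBall x₀ r).indicator u) (β.normed volume)
      (ContinuousLinearMap.lsmul ℝ ℝ) volume) x‖ ≤ n * L := by
  let E := EuclideanSpace ℝ (Fin n)
  have hcomp : IsCompact (closedBall x₀ r) := isCompact_closedBall _ _
  have huI : IntegrableOn u (closedBall x₀ r) :=
    integrableOn_of_locallySquareIntegrableOn hG.1 hcomp hr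
  have hGI : IntegrableOn G (closedBall x₀ r) :=
    integrableOn_of_locallySquareIntegrableOn hG.2.1 hcomp hr
  have hf : Integrable ((closedBall x₀ r).indicator u) :=
    (integrable_indicator_iff hcomp.measurableSet).2 huI
  have hβs : ContDiff ℝ (⊤ : ℕ∞) (β.normed volume) := β.contDiff_normed
  have hβc : HasCompactSupport (β.normed volume) := β.hasCompactSupport_normed
  have hd := hβc.hasFDerivAt_convolution_right (ContinuousLinearMap.lsmul ℝ ℝ)
    hf.locallyIntegrable (hβs.of_le (by simp)) x
  have hsupp : ∀ t, t ∉ closedBall x β.rOut → x - t ∉ tsupport (β.normed volume) := fun t ht => by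
    rwa [β.tsupport_normed_eq, mem_closedBall_zero_iff, ← dist_eq_norm, dist_comm]
  let Ψ : E → ℝ := fun t => β.normed volume (x - t)
  have hΨ0 : ∀ t, t ∉ closedBall x β.rOut → Ψ t = 0 := fun t ht =>
    image_eq_zero_of_notMem_tsupport (f := β.normed volume) (hsupp t ht)
  have hΨt : tsupport Ψ ⊆ closedBall x β.rOut :=
    closure_minimal (fun t ht => by
      by_contra h
      exact ht (hΨ0 t h)) isClosed_closedBall
  have hΨ : IsTestFunction Ω Ψ :=
    ⟨hβs.comp (by fun_prop), (isCompact_closedBall x _).of_isClosed_subset isClosed_closure hΨt,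
      hΨt.trans (hx.trans hr)⟩
  have hΨd : ∀ i t, partialDeriv i Ψ t =
      -fderiv ℝ (β.normed volume) (x - t) (EuclideanSpace.single i 1) := fun i t => by
    have h1 : HasFDerivAt (fun t : E => x - t) (-ContinuousLinearMap.id ℝ E) t :=
      (hasFDerivAt_id t).const_sub x
    have h2 : HasFDerivAt Ψ _ t :=
      ((hβs.differentiable (by simp)) (x - t)).hasFDerivAt.comp t h1
    rw [partialDeriv, h2.fderiv]
    simp only [ContinuousLinearMap.comp_apply, neg_apply, map_neg]
    rfl
  have hΨd0 : ∀ i t, t ∉ closedBall x β.rOut → partialDeriv i Ψ t = 0 := fun i t ht => by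
    have : t ∉ tsupport (fun x => fderiv ℝ Ψ x (EuclideanSpace.single i 1)) := fun h =>
      ht (hΨt (tsupport_fderiv_apply_subset ℝ _ h))
    exact image_eq_zero_of_notMem_tsupport this
  -- The translated mollifier is an admissible test function, so the derivative of the mollification
  -- is an average of `G t i` against a nonnegative weight of mass 1.
  have hpart : ∀ i, |(convolution ((closedBall x₀ r).indicator u) (fderiv ℝ (β.normed volume))
      (ContinuousLinearMap.precompR E (ContinuousLinearMap.lsmul ℝ ℝ)) volume x)
      (EuclideanSpace.single i 1)| ≤ L := fun i => by
    rw [convolution_precompR_apply _ hf.locallyIntegrable (hβc.fderiv (𝕜 := ℝ))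
      (hβs.continuous_fderiv (by simp))]
    have e1 : ((closedBall x₀ r).indicator u ⋆[ContinuousLinearMap.lsmul ℝ ℝ, volume]
        fun a => fderiv ℝ (β.normed volume) a (EuclideanSpace.single i 1)) x =
        -∫ t in Ω, u t * partialDeriv i Ψ t := by
      have e0 : ∫ t in Ω, u t * partialDeriv i Ψ t =
          ∫ t in closedBall x₀ r, u t * partialDeriv i Ψ t :=
        setIntegral_eq_of_subset_of_forall_sdiff_eq_zero hΩ.measurableSet hr
          fun t ht => by rw [hΨd0 i t fun h => ht.2 (hx h), mul_zero]
      rw [convolution, e0, ← integral_neg, ← integral_indicator hcomp.measurableSet]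
      refine integral_congr_ae (ae_of_all _ fun t => ?_)
      by_cases ht : t ∈ closedBall x₀ r
      · simp [indicator_of_mem ht, hΨd]
      · simp [indicator_of_notMem ht]
    have e4 : ∫ t in Ω, G t i * Ψ t = ∫ t in closedBall x₀ r, G t i * Ψ t :=
      setIntegral_eq_of_subset_of_forall_sdiff_eq_zero hΩ.measurableSet hr
        fun t ht => by rw [hΨ0 t fun h => ht.2 (hx h), mul_zero]
    rw [e1, hG.2.2 Ψ hΨ i, neg_neg, e4]
    have hΨint : Integrable Ψ := hΨ.1.continuous.integrable_of_hasCompactSupport hΨ.2.1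
    have hΨnn : ∀ t, 0 ≤ Ψ t := fun t => β.nonneg_normed _
    have e2 : ∫ t, Ψ t = 1 := by
      simp only [Ψ]
      rw [integral_sub_left_eq_self (fun t => β.normed volume t)]
      exact β.integral_normed
    have e3 : ∫ t in closedBall x₀ r, L * Ψ t = L := by
      rw [integral_const_mul, setIntegral_eq_integral_of_forall_compl_eq_zero fun t ht =>
        hΨ0 t fun h => ht (hx h), e2, mul_one]
    rw [← Real.norm_eq_abs, ← e3]
    refine norm_integral_le_of_norm_le (hΨint.const_mul L).integrableOn ?_
    filter_upwards [hL] with t ht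
    rw [norm_mul, Real.norm_eq_abs (Ψ t), abs_of_nonneg (hΨnn t)]
    exact mul_le_mul_of_nonneg_right ((PiLp.norm_apply_le _ i).trans ht) (hΨnn t)
  refine ⟨hd.differentiableAt, ?_⟩
  rw [hd.fderiv]
  rcases Nat.eq_zero_or_pos n with rfl | hn
  · have : Subsingleton E := inferInstanceAs (Subsingleton (EuclideanSpace ℝ (Fin 0)))
    rw [Nat.cast_zero, zero_mul]
    refine ContinuousLinearMap.opNorm_le_bound _ le_rfl fun e => ?_
    rw [Subsingleton.elim e 0]
    simp
  have L0 : 0 ≤ L := (abs_nonneg _).trans (hpart ⟨0, hn⟩)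
  refine ContinuousLinearMap.opNorm_le_bound _ (by positivity) fun e => ?_
  have he : e = ∑ i, e i • EuclideanSpace.single i (1 : ℝ) := by
    ext k
    simp [Pi.single_apply]
  conv_lhs => rw [he]
  rw [map_sum]
  refine (norm_sum_le_of_le (f := fun i => _) (n := fun _ => ‖e‖ * L) _ fun i _ => ?_).trans_eq ?_
  · rw [map_smul, norm_smul]
    exact mul_le_mul (PiLp.norm_apply_le _ i) (hpart i) (norm_nonneg _) (norm_nonneg _)
  · rw [Finset.sum_const, Finset.card_univ, Fintype.card_fin, nsmul_eq_mul]
    ring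

/-- A function with bounded weak gradient agrees almost everywhere with a Lipschitz function. -/
theorem exists_lipschitzWith_ae_eq_of_bounded_gradient {n : ℕ}
    {Ω : Set (EuclideanSpace ℝ (Fin n))}
    (hΩ : IsOpen Ω) {u : EuclideanSpace ℝ (Fin n) → ℝ}
    {G : EuclideanSpace ℝ (Fin n) → EuclideanSpace ℝ (Fin n)} (hG : HasWeakGradientOn Ω u G)
    {x₀ : EuclideanSpace ℝ (Fin n)} {r L : ℝ} (hr0 : 0 < r) (hr : closedBall x₀ r ⊆ Ω)
    (hL : ∀ᵐ x ∂volume.restrict (closedBall x₀ r), ‖G x‖ ≤ L) :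
    ∃ (K : NNReal) (v : EuclideanSpace ℝ (Fin n) → ℝ), LipschitzWith K v ∧
      u =ᵐ[volume.restrict (ball x₀ (r / 2))] v := by
  have hcomp : IsCompact (closedBall x₀ r) := isCompact_closedBall _ _
  let f := (closedBall x₀ r).indicator u
  have hf : Integrable f := (integrable_indicator_iff hcomp.measurableSet).2
    (integrableOn_of_locallySquareIntegrableOn hG.1 hcomp hr)
  -- Outer radii at most `r/2` keep the mollification of points of `ball x₀ (r/2)` inside the region
  -- of bounded gradient; the fixed ratio 2 of the radii gives convergence almost everywhere.
  let β : ℕ → ContDiffBump (0 : EuclideanSpace ℝ (Fin n)) := fun k =>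
    ⟨r / 4 / (k + 1), r / 2 / (k + 1), by positivity, by gcongr; linarith⟩
  have hβ0 : Tendsto (fun k => (β k).rOut) atTop (𝓝 0) :=
    tendsto_const_div_atTop_nhds_zero_nat (r / 2) |>.comp (tendsto_add_atTop_nat 1) |>.congr
      fun k => by simp [β]
  have hconv := ContDiffBump.ae_convolution_tendsto_right_of_locallyIntegrable (μ := volume)
    (φ := β) (K := 2) hβ0 (Eventually.of_forall fun k => by
      simp only [β]
      apply le_of_eq
      ring) hf.locallyIntegrable
  let c : ℕ → EuclideanSpace ℝ (Fin n) → ℝ := fun k =>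
    convolution f ((β k).normed volume) (ContinuousLinearMap.lsmul ℝ ℝ) volume
  have hcc : ∀ k x, convolution ((β k).normed volume) f (ContinuousLinearMap.lsmul ℝ ℝ) volume x =
      c k x := fun k x => by
    rw [convolution_lsmul_swap]
    simp only [c, convolution, ContinuousLinearMap.lsmul_apply, smul_eq_mul, mul_comm]
  have hder : ∀ k, ∀ x ∈ ball x₀ (r / 2), DifferentiableAt ℝ (c k) x ∧
      ‖fderiv ℝ (c k) x‖ ≤ n * L := fun k x hx => by
    refine norm_fderiv_mollification_le hΩ hG hr hL (β k) (closedBall_subset_closedBall' ?_)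
    have h1 : dist x x₀ < r / 2 := hx
    have h2 : (β k).rOut ≤ r / 2 := div_le_self (by positivity) (by simp)
    linarith
  have hlip : ∀ k, LipschitzOnWith (n * L).toNNReal (c k) (ball x₀ (r / 2)) := fun k =>
    (convex_ball x₀ (r / 2)).lipschitzOnWith_of_nnnorm_fderiv_le (𝕜 := ℝ)
      (fun x hx => (hder k x hx).1) fun x hx => by
        rw [← NNReal.coe_le_coe, coe_nnnorm]
        exact (hder k x hx).2.trans (Real.le_coe_toNNReal _)
  -- On the full-measure subset where the mollifications converge, `u` inherits their common
  -- Lipschitz constant; it is then extended from `A` to the whole space.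
  let A : Set (EuclideanSpace ℝ (Fin n)) :=
    {x | x ∈ ball x₀ (r / 2) ∧ Tendsto (fun k => c k x) atTop (𝓝 (u x))}
  have hA : LipschitzOnWith (n * L).toNNReal u A := by
    refine LipschitzOnWith.of_dist_le_mul fun x hx y hy => ?_
    exact le_of_tendsto (hx.2.dist hy.2) (Eventually.of_forall fun k =>
      (hlip k).dist_le_mul x hx.1 y hy.1)
  obtain ⟨v, hv, huv⟩ := hA.extend_real
  refine ⟨_, v, hv, ?_⟩
  rw [EventuallyEq, ae_restrict_iff' measurableSet_ball]
  filter_upwards [hconv] with x hx hxb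
  refine huv ⟨hxb, ?_⟩
  have h1 : f x = u x := indicator_of_mem (ball_subset_closedBall (ball_subset_ball (by linarith) hxb)) u
  rw [h1] at hx
  exact hx.congr fun k => hcc k x

/-- A function that is almost everywhere locally Lipschitz has a locally Lipschitz version. -/
theorem exists_locallyLipschitzOn_ae_eq {n : ℕ} {Ω : Set (EuclideanSpace ℝ (Fin n))}
    (hΩ : IsOpen Ω) {u : EuclideanSpace ℝ (Fin n) → ℝ}
    (h : ∀ x₀ ∈ Ω, ∃ r > 0, ∃ (K : NNReal) (v : EuclideanSpace ℝ (Fin n) → ℝ),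
      LipschitzWith K v ∧ u =ᵐ[volume.restrict (ball x₀ r)] v) :
    ∃ v : EuclideanSpace ℝ (Fin n) → ℝ, u =ᵐ[volume.restrict Ω] v ∧ LocallyLipschitzOn Ω v := by
  choose! r hr K w hw huw using h
  -- Diagonal gluing: two continuous local versions agree almost everywhere, hence everywhere, on
  -- the open intersection of their balls.
  let v : EuclideanSpace ℝ (Fin n) → ℝ := fun x => w x x
  have key : ∀ x₀ ∈ Ω, ∀ x ∈ ball x₀ (r x₀) ∩ Ω, v x = w x₀ x := fun x₀ hx₀ x hx => by
    have h1 : w x =ᵐ[volume.restrict (ball x (r x) ∩ ball x₀ (r x₀))] w x₀ :=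
      ((huw x hx.2).symm.filter_mono (ae_mono (Measure.restrict_mono inter_subset_left le_rfl))).trans
        ((huw x₀ hx₀).filter_mono (ae_mono (Measure.restrict_mono inter_subset_right le_rfl)))
    exact Measure.eqOn_open_of_ae_eq h1 (isOpen_ball.inter isOpen_ball)
      (hw x hx.2).continuous.continuousOn (hw x₀ hx₀).continuous.continuousOn
      ⟨mem_ball_self (hr x hx.2), hx.1⟩
  refine ⟨v, ?_, fun x₀ hx₀ => ?_⟩
  · rw [EventuallyEq, ae_restrict_iff' hΩ.measurableSet, ae_iff]
    refine measure_null_of_locally_null _ fun x₀ hx₀ => ?_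
    have hx₀Ω : x₀ ∈ Ω := by
      by_contra hh
      exact hx₀ fun h => absurd h hh
    refine ⟨{x | ¬ (x ∈ Ω → u x = v x)} ∩ ball x₀ (r x₀),
      inter_mem self_mem_nhdsWithin
        (mem_nhdsWithin_of_mem_nhds (ball_mem_nhds _ (hr x₀ hx₀Ω))), ?_⟩
    have h1 := huw x₀ hx₀Ω
    rw [EventuallyEq, ae_restrict_iff' measurableSet_ball, ae_iff] at h1
    refine measure_mono_null (fun x hx => ?_) h1
    have hx1 : ¬ (x ∈ Ω → u x = v x) := hx.1
    have hx2 := hx.2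
    push Not at hx1
    refine fun h2 => hx1.2 ?_
    rw [h2 hx2, key x₀ hx₀Ω x ⟨hx2, hx1.1⟩]
  · refine ⟨K x₀, ball x₀ (r x₀) ∩ Ω, inter_mem
      (mem_nhdsWithin_of_mem_nhds (ball_mem_nhds _ (hr x₀ hx₀))) self_mem_nhdsWithin, ?_⟩
    intro x hx y hy
    rw [key x₀ hx₀ x hx, key x₀ hx₀ y hy]
    exact hw x₀ hx₀ x y

/-! ### Inverse and modulus of continuity of the Gilbarg–Serrin coefficients -/

/-- The inverse of a rank-one perturbation of the identity. -/
theorem exists_isFrozenInverse_rankOne {n : ℕ} {θ : EuclideanSpace ℝ (Fin n)} {g S : ℝ}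
    -- The condition `g * ‖θ‖ ^ 2 = g` means that `θ` is a unit vector or `g = 0`, so it also covers
    -- `θ = 0` at the origin.
    (hg : 0 ≤ g) (hθ : ‖θ‖ ≤ 1) (hgθ : g * ‖θ‖ ^ 2 = g) (hS : 1 + g ≤ S ^ 2) :
    ∃ B, IsFrozenInverse (fun i j => (if i = j then 1 else 0) + g * θ i * θ j) B S := by
  set k := g / (1 + g) with hk
  have hk0 : 0 ≤ k := by positivity
  have hk1 : k ≤ 1 := div_le_one_of_le₀ (by linarith) (by positivity)
  have hkg : k * (1 + g) = g := div_mul_cancel₀ _ (by positivity)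
  let B : EuclideanSpace ℝ (Fin n) →L[ℝ] EuclideanSpace ℝ (Fin n) :=
    ContinuousLinearMap.id ℝ _ - k • (innerSL ℝ θ).smulRight θ
  have hB : ∀ z, B z = z - (k * inner ℝ θ z) • θ := fun z => by
    simp [B, smul_smul]
  have hquad : ∀ z, inner ℝ z (B z) = ‖z‖ ^ 2 - k * inner ℝ θ z ^ 2 := fun z => by
    rw [hB, inner_sub_right, real_inner_self_eq_norm_sq, inner_smul_right, real_inner_comm]
    ring
  have hcs : ∀ z, inner ℝ θ z ^ 2 ≤ ‖z‖ ^ 2 := fun z => by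
    rw [← sq_abs]
    refine pow_le_pow_left₀ (abs_nonneg _) ((abs_real_inner_le_norm θ z).trans ?_) 2
    exact mul_le_of_le_one_left (norm_nonneg _) hθ
  refine ⟨B, ⟨fun z w => ?_, fun z => ?_, fun z => ?_, fun z => ?_, fun z i => ?_⟩⟩
  · rw [hB, hB, inner_sub_left, inner_sub_right, inner_smul_left, inner_smul_right,
      real_inner_comm θ z]
    simp only [conj_trivial]
    ring
  · rw [hquad]
    have : 0 ≤ k * inner ℝ θ z ^ 2 := by positivity
    linarith
  · rw [hquad]
    have h1 : ‖z‖ ^ 2 - k * ‖z‖ ^ 2 ≤ ‖z‖ ^ 2 - k * inner ℝ θ z ^ 2 :=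
      sub_le_sub_left (mul_le_mul_of_nonneg_left (hcs z) hk0) _
    have h2 : 0 ≤ (1 - k) * ‖z‖ ^ 2 := mul_nonneg (by linarith) (by positivity)
    calc ‖z‖ ^ 2 = (1 + g) * (‖z‖ ^ 2 - k * ‖z‖ ^ 2) := by linear_combination hkg * ‖z‖ ^ 2
      _ ≤ S ^ 2 * (‖z‖ ^ 2 - k * ‖z‖ ^ 2) := mul_le_mul_of_nonneg_right hS (by linarith)
      _ ≤ _ := mul_le_mul_of_nonneg_left h1 (by positivity)
  · refine le_of_sq_le_sq ?_ (norm_nonneg _)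
    rw [hB, @norm_sub_sq_real, inner_smul_right, norm_smul, real_inner_comm θ z, mul_pow,
      Real.norm_eq_abs, sq_abs]
    have h1 : (k * inner ℝ θ z) ^ 2 * ‖θ‖ ^ 2 ≤ (k * inner ℝ θ z) ^ 2 :=
      mul_le_of_le_one_right (by positivity) (pow_le_one₀ (norm_nonneg _) hθ)
    have h2 : k * (k * inner ℝ θ z ^ 2) ≤ k * inner ℝ θ z ^ 2 :=
      mul_le_of_le_one_left (by positivity) hk1
    have h3 : 0 ≤ k * inner ℝ θ z ^ 2 := by positivity
    nlinarith
  · have h1 : ∑ j, θ j * z j = inner ℝ θ z := by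
      rw [PiLp.inner_apply]
      simp [mul_comm]
    have h2 : ∑ j, θ j * θ j = ‖θ‖ ^ 2 := by
      rw [EuclideanSpace.real_norm_sq_eq]
      simp [sq]
    have h3 : ∑ j, ((if i = j then (1 : ℝ) else 0) + g * θ i * θ j) * B z j =
        B z i + g * θ i * (∑ j, θ j * z j - k * inner ℝ θ z * ∑ j, θ j * θ j) := by
      simp only [add_mul, Finset.sum_add_distrib, ite_mul, one_mul, zero_mul, Finset.sum_ite_eq,
        Finset.mem_univ, if_true, Finset.mul_sum, ← Finset.sum_sub_distrib]
      congr 1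
      refine Finset.sum_congr rfl fun j _ => ?_
      rw [hB]
      simp
      ring
    rw [h3, h1, h2, hB]
    simp only [PiLp.sub_apply, PiLp.smul_apply, smul_eq_mul]
    linear_combination (-θ i * k * inner ℝ θ z) * hgθ - θ i * inner ℝ θ z * hkg

theorem logPow_zero_right {γ : ℝ} (hγ : 0 < γ) : logPow γ 0 = 0 := by
  rw [logPow, Real.log_zero, abs_zero, Real.zero_rpow (by linarith)]

theorem exists_isFrozenInverse_gilbargSerrinCoeff {n : ℕ} {γ : ℝ} (hγ : 0 < γ) {S : ℝ}
    (y : EuclideanSpace ℝ (Fin n)) (hS : 1 + logPow γ ‖y‖ ≤ S ^ 2) :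
    ∃ B, IsFrozenInverse (fun i j => gilbargSerrinCoeff (logPow γ) i j y) B S := by
  have h := exists_isFrozenInverse_rankOne (θ := ‖y‖⁻¹ • y) (logPow_nonneg γ ‖y‖) (S := S) ?_ ?_ hS
  · convert h using 5 with B i j
    simp only [gilbargSerrinCoeff, PiLp.smul_apply, smul_eq_mul]
    ring
  · rw [norm_smul, norm_inv, norm_norm]
    exact inv_mul_le_one
  -- At the origin the conventions `log 0 = 0` and `0 ^ (-γ) = 0` give `g = 0`, consistent with `θ =
  -- 0`.
  · rcases eq_or_ne y 0 with rfl | hy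
    · simp [logPow_zero_right hγ]
    · rw [norm_smul, norm_inv, norm_norm, inv_mul_cancel₀ (norm_ne_zero_iff.2 hy)]
      simp

theorem abs_coord_div_norm_sub_le {n : ℕ} {x y : EuclideanSpace ℝ (Fin n)} {r : ℝ} (hr : 0 < r)
    (hx : r ≤ ‖x‖) (hy : r ≤ ‖y‖) (i : Fin n) :
    |x i / ‖x‖ - y i / ‖y‖| ≤ 2 * (dist x y / r) := by
  have hx0 : 0 < ‖x‖ := hr.trans_le hx
  have hy0 : 0 < ‖y‖ := hr.trans_le hy
  have e : x i / ‖x‖ - y i / ‖y‖ = (x i - y i) / ‖x‖ + y i / ‖y‖ * ((‖y‖ - ‖x‖) / ‖x‖) := by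
    field_simp
    ring
  have h1 : |(x i - y i) / ‖x‖| ≤ dist x y / r := by
    rw [abs_div, abs_of_pos hx0]
    refine div_le_div₀ dist_nonneg ?_ hr hx
    rw [dist_eq_norm]
    exact PiLp.norm_apply_le (x - y) i
  have h2 : |(‖y‖ - ‖x‖) / ‖x‖| ≤ dist x y / r := by
    rw [abs_div, abs_of_pos hx0]
    refine div_le_div₀ dist_nonneg ?_ hr hx
    rw [dist_comm, dist_eq_norm]
    exact abs_norm_sub_norm_le y x
  have h3 : |y i / ‖y‖ * ((‖y‖ - ‖x‖) / ‖x‖)| ≤ dist x y / r := by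
    rw [abs_mul]
    exact (mul_le_of_le_one_left (abs_nonneg _) (abs_coord_div_norm_le_one i y)).trans h2
  rw [e]
  linarith [abs_add_le ((x i - y i) / ‖x‖) (y i / ‖y‖ * ((‖y‖ - ‖x‖) / ‖x‖))]

theorem abs_log_sub_log_le {r s t : ℝ} (hr : 0 < r) (hs : r ≤ s) (ht : r ≤ t) :
    |Real.log s - Real.log t| ≤ |s - t| / r := by
  have aux : ∀ s t : ℝ, r ≤ s → r ≤ t → Real.log s - Real.log t ≤ |s - t| / r :=
    fun s t hs ht => by
      have hs0 := hr.trans_le hs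
      have ht0 := hr.trans_le ht
      rw [← Real.log_div hs0.ne' ht0.ne']
      refine (Real.log_le_sub_one_of_pos (by positivity)).trans ?_
      rw [div_sub_one ht0.ne']
      exact div_le_div₀ (abs_nonneg _) (le_abs_self _) hr ht
  rw [abs_le']
  refine ⟨aux s t hs ht, ?_⟩
  rw [neg_sub, abs_sub_comm]
  exact aux t s ht hs

/-- The power `x^(-γ)` has derivative at most `γ (-log R)^(-γ-1)` on `[-log R, ∞)`, and `log` is
Lipschitz with constant `1/r` on `[r, ∞)`. -/
theorem abs_logPow_sub_le {γ : ℝ} (hγ : 0 < γ) {r R s t : ℝ} (hr : 0 < r) (hR : R < 1)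
    (hs : r ≤ s) (ht : r ≤ t) (hsR : s ≤ R) (htR : t ≤ R) :
    |logPow γ s - logPow γ t| ≤ γ * (-Real.log R) ^ (-γ - 1) * (|s - t| / r) := by
  have hL : 0 < -Real.log R := neg_pos.2 (Real.log_neg (hr.trans_le (hs.trans hsR)) hR)
  have key : ∀ s, r ≤ s → s ≤ R → logPow γ s = (-Real.log s) ^ (-γ) ∧ -Real.log s ∈
      Ici (-Real.log R) := fun s hs hsR => by
    have h1 : Real.log s ≤ Real.log R := Real.log_le_log (hr.trans_le hs) hsR
    refine ⟨?_, neg_le_neg h1⟩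
    rw [logPow, abs_of_nonpos (by linarith)]
  obtain ⟨es, ms⟩ := key s hs hsR
  obtain ⟨et, mt⟩ := key t ht htR
  have hmv := (convex_Ici (-Real.log R)).norm_image_sub_le_of_norm_hasDerivWithin_le
    (f := fun x : ℝ => x ^ (-γ)) (f' := fun x => -γ * x ^ (-γ - 1))
    (C := γ * (-Real.log R) ^ (-γ - 1))
    (fun x hx => (Real.hasDerivAt_rpow_const (Or.inl (hL.trans_le hx).ne')).hasDerivWithinAt)
    (fun x hx => by
      have hx0 : 0 < x := hL.trans_le hx
      rw [norm_mul, norm_neg, Real.norm_of_nonneg hγ.le, Real.norm_of_nonneg (by positivity)]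
      exact mul_le_mul_of_nonneg_left
        (Real.rpow_le_rpow_of_nonpos hL hx (by linarith)) hγ.le) mt ms
  rw [es, et, ← Real.norm_eq_abs]
  refine hmv.trans (mul_le_mul_of_nonneg_left ?_ (by positivity))
  rw [Real.norm_eq_abs, neg_sub_neg, abs_sub_comm]
  exact abs_log_sub_log_le hr hs ht

/-- The modulus of continuity of the coefficients, at scale `s`. -/
theorem abs_gilbargSerrinCoeff_sub_le {n : ℕ} {γ : ℝ} (hγ : 0 < γ) {R s : ℝ} (hs : 0 < s)
    (hs1 : 2 * √s < 1) (hR : R < 1) {x y : EuclideanSpace ℝ (Fin n)} (hx : ‖x‖ ≤ R)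
    (hy : ‖y‖ ≤ R) (hxy : dist x y ≤ s) (i j : Fin n) :
    |gilbargSerrinCoeff (logPow γ) i j x - gilbargSerrinCoeff (logPow γ) i j y| ≤
      2 * logPow γ (2 * √s) +
        (γ * (-Real.log R) ^ (-γ - 1) + 4 * logPow γ R) * √s := by
  have hR0 : 0 ≤ R := (norm_nonneg x).trans hx
  have hq : 0 < √s := Real.sqrt_pos.2 hs
  have hqs : √s * √s = s := Real.mul_self_sqrt hs.le
  have hsq : s ≤ √s := by nlinarith
  have hn1 : ‖x‖ ≤ ‖y‖ + s := by
    have := norm_le_norm_add_norm_sub' x y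
    rw [← dist_eq_norm] at this
    linarith
  have hn2 : ‖y‖ ≤ ‖x‖ + s := by
    have := norm_le_norm_add_norm_sub' y x
    rw [← dist_eq_norm, dist_comm] at this
    linarith
  have hlogR : 0 ≤ (-Real.log R) ^ (-γ - 1) :=
    Real.rpow_nonneg (neg_nonneg.2 (Real.log_nonpos hR0 hR.le)) _
  have hC : 0 ≤ (γ * (-Real.log R) ^ (-γ - 1) + 4 * logPow γ R) * √s := by
    have := logPow_nonneg γ R
    positivity
  set p := x i / ‖x‖
  set q := x j / ‖x‖
  set p' := y i / ‖y‖
  set q' := y j / ‖y‖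
  have hp : |p| ≤ 1 := abs_coord_div_norm_le_one i x
  have hqq : |q| ≤ 1 := abs_coord_div_norm_le_one j x
  have hp' : |p'| ≤ 1 := abs_coord_div_norm_le_one i y
  have hq' : |q'| ≤ 1 := abs_coord_div_norm_le_one j y
  have e : gilbargSerrinCoeff (logPow γ) i j x - gilbargSerrinCoeff (logPow γ) i j y =
      logPow γ ‖x‖ * (p * q) - logPow γ ‖y‖ * (p' * q') := by
    simp only [gilbargSerrinCoeff, p, q, p', q']
    ring
  have hpq : |p * q| ≤ 1 := by
    rw [abs_mul]
    exact mul_le_one₀ hp (abs_nonneg _) hqq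
  have hpq' : |p' * q'| ≤ 1 := by
    rw [abs_mul]
    exact mul_le_one₀ hp' (abs_nonneg _) hq'
  have hgx := logPow_nonneg γ ‖x‖
  have hgy := logPow_nonneg γ ‖y‖
  rw [e]
  -- Threshold `√s`: if one point is that close to 0, both are within `2√s` and smallness comes from
  -- `g` itself. Otherwise `g` and `θ` have Lipschitz constants of order `1/√s`, and `s/√s = √s`.
  rcases le_or_gt (min ‖x‖ ‖y‖) (√s) with hm | hm
  · have hb : ‖x‖ ≤ 2 * √s ∧ ‖y‖ ≤ 2 * √s := by
      rcases min_le_iff.1 hm with h | h <;> constructor <;> linarith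
    have h1 := logPow_mono hγ (norm_nonneg x) hb.1 hs1
    have h2 := logPow_mono hγ (norm_nonneg y) hb.2 hs1
    refine (abs_sub _ _).trans ?_
    rw [abs_mul (logPow γ ‖x‖), abs_mul (logPow γ ‖y‖), abs_of_nonneg hgx, abs_of_nonneg hgy]
    have h3 := mul_le_of_le_one_right hgx hpq
    have h4 := mul_le_of_le_one_right hgy hpq'
    linarith
  · obtain ⟨hx1, hy1⟩ := lt_min_iff.1 hm
    have hds : dist x y / √s ≤ √s := by
      rw [div_le_iff₀ hq, hqs]
      exact hxy
    have h1 := abs_logPow_sub_le hγ hq hR hx1.le hy1.le hx hy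
    have h2 : |‖x‖ - ‖y‖| / √s ≤ √s := le_trans (by
      gcongr
      rw [dist_eq_norm]
      exact abs_norm_sub_norm_le x y) hds
    have h3 := (abs_coord_div_norm_sub_le hq hx1.le hy1.le i).trans
      (mul_le_mul_of_nonneg_left hds zero_le_two)
    have h4 := (abs_coord_div_norm_sub_le hq hx1.le hy1.le j).trans
      (mul_le_mul_of_nonneg_left hds zero_le_two)
    have h5 : |p * q - p' * q'| ≤ 4 * √s := by
      have e2 : p * q - p' * q' = (p - p') * q + p' * (q - q') := by ring
      rw [e2]
      refine (abs_add_le _ _).trans ?_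
      rw [abs_mul, abs_mul]
      have h6 := mul_le_of_le_one_right (abs_nonneg (p - p')) hqq
      have h7 := mul_le_of_le_one_left (abs_nonneg (q - q')) hp'
      linarith
    have h6 : logPow γ ‖y‖ ≤ logPow γ R := logPow_mono hγ (norm_nonneg y) hy hR
    have e3 : logPow γ ‖x‖ * (p * q) - logPow γ ‖y‖ * (p' * q') =
        (logPow γ ‖x‖ - logPow γ ‖y‖) * (p * q) + logPow γ ‖y‖ * (p * q - p' * q') := by ring
    rw [e3]
    refine (abs_add_le _ _).trans ?_
    rw [abs_mul (logPow γ ‖x‖ - logPow γ ‖y‖), abs_mul (logPow γ ‖y‖), abs_of_nonneg hgy]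
    have h7 := mul_le_of_le_one_right (abs_nonneg (logPow γ ‖x‖ - logPow γ ‖y‖)) hpq
    have h8 : logPow γ ‖y‖ * |p * q - p' * q'| ≤ logPow γ R * (4 * √s) :=
      mul_le_mul h6 h5 (abs_nonneg _) (logPow_nonneg _ _)
    have h9 : γ * (-Real.log R) ^ (-γ - 1) * (|‖x‖ - ‖y‖| / √s) ≤
        γ * (-Real.log R) ^ (-γ - 1) * √s := mul_le_mul_of_nonneg_left h2 (by positivity)
    have h10 := logPow_nonneg γ (2 * √s)
    linarith

/-- The square root only halves the logarithm: `|log (2√(S/2^k))|` is eventually at least `k (log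
2)/4`, so the terms are dominated by a multiple of `k^(-γ)`, summable for `γ > 1`. -/
theorem summable_logPow_sqrt {γ : ℝ} (hγ : 1 < γ) {S : ℝ} (hS : 0 < S) :
    Summable fun k : ℕ => logPow γ (2 * √(S / 2 ^ k)) := by
  have hl : 0 < Real.log 2 := Real.log_pos one_lt_two
  have hlog : ∀ k : ℕ, Real.log (2 * √(S / 2 ^ k)) =
      (Real.log 2 + Real.log S / 2) - k * (Real.log 2 / 2) := fun k => by
    have h1 : 0 < S / 2 ^ k := by positivity
    rw [Real.log_mul two_ne_zero (Real.sqrt_pos.2 h1).ne', Real.log_sqrt h1.le,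
      Real.log_div hS.ne' (by positivity), Real.log_pow]
    ring
  have hsum : Summable fun k : ℕ => (Real.log 2 / 4) ^ (-γ) * (k : ℝ) ^ (-γ) :=
    (Real.summable_nat_rpow.2 (by linarith)).mul_left _
  refine hsum.of_norm_bounded_eventually_nat ?_
  have hev : ∀ᶠ k : ℕ in atTop, (Real.log 2 + Real.log S / 2) / (Real.log 2 / 4) ≤ k :=
    tendsto_natCast_atTop_atTop.eventually_ge_atTop _
  filter_upwards [hev, eventually_gt_atTop 0] with k hk hk0
  rw [div_le_iff₀ (by positivity)] at hk
  have hk0' : (0 : ℝ) < k := by exact_mod_cast hk0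
  have h1 : Real.log 2 / 4 * k ≤ |Real.log (2 * √(S / 2 ^ k))| := by
    rw [hlog, abs_sub_comm]
    refine le_trans ?_ (le_abs_self _)
    linarith
  rw [Real.norm_of_nonneg (logPow_nonneg _ _), ← Real.mul_rpow (by positivity) (by positivity)]
  exact Real.rpow_le_rpow_of_nonpos (by positivity) h1 (by linarith)

theorem summable_sqrt_div_two_pow {S : ℝ} : Summable fun k : ℕ => √(S / 2 ^ k) := by
  have h : ∀ k : ℕ, √(S / 2 ^ k) = √S * (√2)⁻¹ ^ k := fun k => by
    rw [Real.sqrt_div' _ (by positivity), inv_pow, div_eq_mul_inv]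
    congr 2
    rw [Real.sqrt_eq_iff_mul_self_eq (by positivity) (by positivity), ← mul_pow,
      Real.mul_self_sqrt zero_le_two]
  simp_rw [h]
  exact (summable_geometric_of_lt_one (by positivity)
    (inv_lt_one_of_one_lt₀ (by rw [Real.lt_sqrt] <;> norm_num))).mul_left _

/-! ### Local Lipschitz regularity for `γ > 1` and the main theorem -/

/-- A weak gradient of a solution is locally bounded when the coefficients have a summable
dyadic modulus of continuity. -/
theorem exists_ae_norm_gradient_le_of_summable {n : ℕ} (hn : 1 ≤ n)
    {Ω : Set (EuclideanSpace ℝ (Fin n))}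
    (hΩ : IsOpen Ω) {u : EuclideanSpace ℝ (Fin n) → ℝ}
    {G : EuclideanSpace ℝ (Fin n) → EuclideanSpace ℝ (Fin n)} (hG : HasWeakGradientOn Ω u G)
    {a : Fin n → Fin n → EuclideanSpace ℝ (Fin n) → ℝ} (ha : ∀ i j, Measurable (a i j))
    (hu : ∀ φ, IsTestFunction Ω φ →
      ∫ x in Ω, ∑ i, ∑ j, a i j x * G x i * partialDeriv j φ x = 0)
    {S : ℝ} (hS : 0 < S) (hB : ∀ y ∈ Ω, ∃ B, IsFrozenInverse (fun i j => a i j y) B S)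
    {ω : ℕ → ℝ} {k₀ : ℕ} (hω0 : ∀ k, 0 ≤ ω k) (hωs : Summable ω)
    (hω : ∀ k, k₀ ≤ k → ∀ x ∈ Ω, ∀ y ∈ Ω, dist x y ≤ S / 2 ^ k →
      ∀ i j, |a i j y - a i j x| ≤ ω k)
    {x₀ : EuclideanSpace ℝ (Fin n)} {ρ : ℝ} (hρ0 : 0 < ρ) (hρ : closedBall x₀ ρ ⊆ Ω) :
    ∃ L : ℝ, ∀ᵐ x ∂volume.restrict (closedBall x₀ (ρ / 2)), ‖G x‖ ≤ L := by
  obtain ⟨C, hC⟩ := exists_ae_enorm_gradient_le hn hΩ hG ha hu hS hB hω0 hω hρ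
  have hGI : IntegrableOn G (closedBall x₀ ρ) :=
    integrableOn_of_locallySquareIntegrableOn hG.2.1 (isCompact_closedBall _ _) hρ
  let f : EuclideanSpace ℝ (Fin n) → ℝ≥0∞ := (closedBall x₀ ρ).indicator fun x => ‖G x‖ₑ
  have hf : AEMeasurable f :=
    (aemeasurable_indicator_iff measurableSet_closedBall).2 hGI.aestronglyMeasurable.enorm
  have hfG : ∀ s ⊆ closedBall x₀ ρ, MeasurableSet s →
      ∫⁻ x in s, f x = ∫⁻ x in s, ‖G x‖ₑ := fun s hs hsm =>
    setLIntegral_congr_fun hsm fun x hx => indicator_of_mem (hs hx) _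
  let w : ℕ → ℝ≥0∞ := fun k => ENNReal.ofReal (C * ω k)
  let V : ℝ≥0∞ := ENNReal.ofReal (S ^ n) * volume (closedBall (0 : EuclideanSpace ℝ (Fin n)) 1)
  have hV : V ≠ ⊤ := ENNReal.mul_ne_top ENNReal.ofReal_ne_top measure_closedBall_lt_top.ne
  have hws : ∑' k, w k ≠ ⊤ := by
    refine ne_top_of_le_ne_top ?_ (ENNReal.tsum_le_tsum
      (fun k => ENNReal.ofReal_le_ofReal (mul_le_mul_of_nonneg_right (le_abs_self C) (hω0 k))))
    exact (hωs.mul_left |C|).tsum_ofReal_ne_top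
  have htail : Tendsto (fun k => (∑' j, w (k + j)) * V) atTop (𝓝 0) := by
    have h1 := ENNReal.tendsto_sum_nat_add w hws
    have h2 := ENNReal.Tendsto.mul_const h1 (Or.inr hV)
    rw [zero_mul] at h2
    simpa only [add_comm] using h2
  have hscale : Tendsto (fun k : ℕ => 2 * (S / 2 ^ k)) atTop (𝓝 0) := by
    have h1 := (tendsto_pow_atTop_nhds_zero_of_lt_one (r := (2 : ℝ)⁻¹) (by norm_num)
      (by norm_num)).const_mul (2 * S)
    rw [mul_zero] at h1
    refine h1.congr fun k => ?_
    rw [inv_pow]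
    ring
  -- Summability of the modulus enters here: its tails become small enough for the absorption
  -- argument from some scale on.
  have hev1 : ∀ᶠ k in atTop, (∑' j, w (k + j)) * V ≤ (2 ^ (n + 1))⁻¹ :=
    htail.eventually_le_const (ENNReal.inv_pos.2 (by finiteness))
  have hev2 : ∀ᶠ k : ℕ in atTop, 2 * (S / 2 ^ k) ≤ ρ / 2 :=
    hscale.eventually_le_const (by positivity)
  obtain ⟨j₁, hj₁⟩ := eventually_atTop.1 (hev1.and (hev2.and (eventually_ge_atTop k₀)))
  have hpow : ∀ m : ℕ, ENNReal.ofReal (2 ^ m) = 2 ^ m := fun m => by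
    rw [ENNReal.ofReal_pow zero_le_two, ENNReal.ofReal_ofNat]
  obtain ⟨b, hb, hfb⟩ := exists_ae_le_of_le_potential (f := f) (x₀ := x₀) (ρ := ρ) hf hS (w := w)
    (c := ENNReal.ofReal C) (j₁ := j₁) ENNReal.ofReal_ne_top (fun k hk => (hj₁ k hk).1)
    (by
      rw [hfG _ subset_rfl measurableSet_closedBall]
      exact hGI.2.ne)
    (by
      filter_upwards [hC] with y hy j₀ hj₀ hsub
      have h1 := hy j₀ ((hj₁ j₁ le_rfl).2.2.trans hj₀) hsub
      have h2 : f y ≤ ‖G y‖ₑ := indicator_le_self' (fun _ _ => zero_le) y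
      refine h2.trans (h1.trans_eq ?_)
      rw [hfG _ subset_rfl measurableSet_closedBall, hpow]
      congr 1
      refine tsum_congr fun j => ?_
      rw [hpow, hfG _ ((closedBall_subset_closedBall ?_).trans hsub) measurableSet_closedBall]
      gcongr
      · exact one_le_two
      · exact Nat.le_add_right _ _)
  refine ⟨b.toReal, ?_⟩
  have hsub : closedBall x₀ (ρ / 2) ⊆ closedBall x₀ (ρ - 2 * (S / 2 ^ j₁)) :=
    closedBall_subset_closedBall (by linarith [(hj₁ j₁ le_rfl).2.1])
  filter_upwards [ae_restrict_of_ae_restrict_of_subset hsub hfb,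
    ae_restrict_mem measurableSet_closedBall] with x hx hxb
  have h1 : f x = ‖G x‖ₑ :=
    indicator_of_mem (closedBall_subset_closedBall (by linarith) hxb) _
  rw [h1, ← ofReal_norm] at hx
  exact (ENNReal.ofReal_le_iff_le_toReal hb).1 hx

/-- Weak solutions are locally Lipschitz when `γ > 1`. -/
theorem exists_locallyLipschitzOn_ae_eq_of_isWeakSolution {n : ℕ} (hn : 1 ≤ n)
    {Ω : Set (EuclideanSpace ℝ (Fin n))} (hΩ : IsOpen Ω) (hΩ1 : closure Ω ⊆ ball 0 1) {γ : ℝ}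
    (hγ : 1 < γ) {u : EuclideanSpace ℝ (Fin n) → ℝ}
    (hu : IsWeakSolution Ω (gilbargSerrinCoeff (logPow γ)) u) :
    ∃ v : EuclideanSpace ℝ (Fin n) → ℝ, u =ᵐ[volume.restrict Ω] v ∧ LocallyLipschitzOn Ω v := by
  obtain ⟨G, hG, hu⟩ := hu
  have hγ0 : 0 < γ := by linarith
  obtain ⟨R, hR, hΩR⟩ := exists_pos_lt_subset_ball one_pos isClosed_closure hΩ1
  have hmem : ∀ y ∈ Ω, ‖y‖ ≤ R := fun y hy =>
    (mem_ball_zero_iff.1 (hΩR (subset_closure hy))).le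
  have hgR := logPow_nonneg γ R
  -- A uniform upper bound for the largest eigenvalue `1 + g` over the domain, so one `S` works for
  -- all frozen inverses.
  let S : ℝ := √(1 + logPow γ R)
  have hS : 0 < S := Real.sqrt_pos.2 (by positivity)
  have hS2 : S ^ 2 = 1 + logPow γ R := Real.sq_sqrt (by positivity)
  let M : ℝ := γ * (-Real.log R) ^ (-γ - 1) + 4 * logPow γ R
  have hM : 0 ≤ M := by
    have : 0 ≤ (-Real.log R) ^ (-γ - 1) :=
      Real.rpow_nonneg (neg_nonneg.2 (Real.log_nonpos hR.1.le hR.2.le)) _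
    positivity
  let ω : ℕ → ℝ := fun k => 2 * logPow γ (2 * √(S / 2 ^ k)) + M * √(S / 2 ^ k)
  have hω0 : ∀ k, 0 ≤ ω k := fun k => by
    have := logPow_nonneg γ (2 * √(S / 2 ^ k))
    positivity
  have hωs : Summable ω := ((summable_logPow_sqrt hγ hS).mul_left 2).add
    (summable_sqrt_div_two_pow.mul_left M)
  have hsmall : ∀ᶠ k : ℕ in atTop, 2 * √(S / 2 ^ k) < 1 := by
    have h := (summable_sqrt_div_two_pow (S := S)).tendsto_atTop_zero.const_mul 2
    rw [mul_zero] at h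
    exact h.eventually_lt_const one_pos
  obtain ⟨k₀, hk₀⟩ := eventually_atTop.1 hsmall
  refine exists_locallyLipschitzOn_ae_eq hΩ fun x₀ hx₀ => ?_
  obtain ⟨ρ, hρ0, hρ⟩ := nhds_basis_closedBall.mem_iff.1 (hΩ.mem_nhds hx₀)
  obtain ⟨L, hL⟩ := exists_ae_norm_gradient_le_of_summable hn hΩ hG
    (measurable_gilbargSerrinCoeff (measurable_logPow γ)) hu hS
    (fun y hy => exists_isFrozenInverse_gilbargSerrinCoeff hγ0 y (by
      rw [hS2]
      linarith [logPow_mono hγ0 (norm_nonneg y) (hmem y hy) hR.2]))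
    (k₀ := k₀) hω0 hωs
    (fun k hk x hx y hy hxy i j => abs_gilbargSerrinCoeff_sub_le hγ0 (by positivity) (hk₀ k hk)
      hR.2 (hmem y hy) (hmem x hx) (by rwa [dist_comm]) i j) hρ0 hρ
  obtain ⟨K, v, hv, huv⟩ := exists_lipschitzWith_ae_eq_of_bounded_gradient hΩ hG
    (r := ρ / 2) (by positivity) ((closedBall_subset_closedBall (by linarith)).trans hρ) hL
  exact ⟨ρ / 2 / 2, by positivity, K, v, hv, huv⟩

theorem mainTheorem6 (n : ℕ) (hn : 2 ≤ n) (Ω : Set (EuclideanSpace ℝ (Fin n)))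
    (hΩ : IsOpen Ω) (h0 : (0 : EuclideanSpace ℝ (Fin n)) ∈ Ω)
    (hΩ1 : closure Ω ⊆ ball (0 : EuclideanSpace ℝ (Fin n)) 1) (γ : ℝ) :
    (0 < γ → γ ≤ 1 →
      (∃ u : EuclideanSpace ℝ (Fin n) → ℝ,
        IsWeakSolution Ω (gilbargSerrinCoeff (logPow γ)) u ∧ ContinuousOn u Ω ∧
          ¬ IsLipschitzAtZero u) ∧
      ¬ ∀ i j : Fin n, HasDiniMeanOscillation Ω (gilbargSerrinCoeff (logPow γ) i j)) ∧
    (1 < γ →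
      ∀ u : EuclideanSpace ℝ (Fin n) → ℝ,
        IsWeakSolution Ω (gilbargSerrinCoeff (logPow γ)) u →
          ∃ v : EuclideanSpace ℝ (Fin n) → ℝ,
            u =ᵐ[volume.restrict Ω] v ∧ LocallyLipschitzOn Ω v) := by
  refine ⟨fun hγ hγ1 => ⟨exists_not_isLipschitzAtZero hn hΩ1 hγ hγ1, fun h => ?_⟩,
    fun hγ u hu => exists_locallyLipschitzOn_ae_eq_of_isWeakSolution (by omega) hΩ hΩ1 hγ hu⟩
  have hij : (⟨0, by omega⟩ : Fin n) ≠ ⟨1, by omega⟩ := by simp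
  exact not_hasDiniMeanOscillation_offDiag hΩ h0 hγ hγ1 hij (h _ _)
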